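/- **Setting.** $\|\cdot\|_2$ is the Euclidean norm of vectors and the spectral norm of matrices, $\sigma_1(X)\ge\sigma_2(X)\ge\cdots$ are the singular values of a real matrix $X$ (with $\sigma_i(X)=0$ for $i>\operatorname{rank}X$), $\operatorname{gap}_k(X)=(\sigma_k(X)^2-\sigma_{k+1}(X)^2)/\sigma_1(X)^2$, $\operatorname{sr}(X)=\|X\|_F^2/\|X\|_2^2$, and $X^+$ is the Moore–Penrose pseudo-inverse. For a thin SVD $X=U_X\Sigma_XV_X^T$ of an $m\times n$ matrix, $V_{X,k}$ consists of the first $k$ columns of $V_X$ and $U_{X,k+}$ of the last $\min(m,n)-k$ columns of $U_X$; a statement that uses these is meant for every choice of the thin SVD. Let $A\in\mathbb R^{n\times d}$ and $1\le k\le\operatorname{rank}A$ with $\sigma_k(A)>\sigma_{k+1}(A)$. For $b\in\mathbb R^n$ let $x_k=\arg\min_{x\in\operatorname{range}V_{A,k}}\|Ax-b\|_2$ and $b_k=Ax_k$, and for a matrix $R$ with $d$ rows let $x_{R,k}=RV_{AR,k}(ARV_{AR,k})^+b$. A vector $\tilde b$ is an $(\epsilon,\upsilon)$-approximate PCP of rank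 $k$ of $b$ if $\big|\|\tilde b-b\|_2-\|b_k-b\|_2\big|\le\epsilon\|b\|_2$ and $\|U_{A,k+}^T\tilde b\|_2\le\upsilon\|b\|_2$. In the statistical model, $b=f+\xi$ with $f\in\mathbb R^n$ fixed and $\xi$ having independent entries of mean $0$ and variance $\sigma^2$; $x^\star$ is the minimum-norm minimizer of $x\mapsto\mathbb E\|Ax-b\|_2^2/n$, and the excess risk of an estimator $\theta=\theta(b)$ is $\mathcal E(\theta)=\mathbb E\|A\theta-Ax^\star\|_2^2/n$. Here $\mathbb E$ is over $\xi$ only, with the sketching matrices fixed. A probability distribution $\mathcal D$ on real matrices with $m$ columns (and any number of rows) has the $(\epsilon,\delta)$-approximate Gram property for $X\in\mathbb R^{m\times p}$ if $\Pr_{S\sim\mathcal D}\big(\|X^TS^TSX-X^TX\|_2\ge\epsilon\|X\|_2^2\big)\le\delta$. **Theorem (two-sided sketching).** Let $\nu,\delta\in(0,1/2)$ and $$\epsilon_2=\frac{\nu}{2(1+\nu/2)}\operatorname{gap}_k(A),\qquad \epsilon_1=\epsilon_1(G)=\frac{\nu(1+\nu^2/4)^{-1/2}/2}{1+\nu(1+\nu^2/4)^{-1/2}/2}\operatorname{gap}_k(AG^T).$$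 1. Let $G$ be sampled from a distribution with the $(\epsilon_2,\delta/2)$-approximate Gram property for $A^T$, and, conditionally on $G$, let $S$ be sampled from a distribution (which may depend measurably on $G$) that, for almost every $G$ with $\operatorname{gap}_k(AG^T)>0$, has the $(\epsilon_1(G),\delta/2)$-approximate Gram property for $AG^T$. Then with probability at least $1-\delta$ over $(G,S)$ the matrix $R=G^TV_{SAG^T,k}$ is defined (that is, $G$ and $S$ have at least $k$ rows each) and, for all choices of the thin SVDs involved: for every $b\in\mathbb R^n$, $Ax_{R,k}$ is a $(\nu,\nu)$-approximate PCP of rank $k$ of $b$; and for every $f\in\mathbb R^n$, $$\mathcal E(x_{R,k})\le\mathcal E(x_k)+\frac{(2\nu+\nu^2)\|f\|_2^2}{n}.$$ 2. The conditions hold for a CountSketch $S$ and a subgaussian $G$ of the following sizes. (a) There is an absolute constant $C>0$ such that, for every $G$ with $\operatorname{gap}_k(AG^T)>0$, the CountSketch distribution (columns independent, each a uniformly random standard basis vector times a uniformly random sign) with $s$ rows has the $(\epsilon_1(G),\delta/2)$-approximate Gram property for $AG^T$ whenever $$s\ge C\,\frac{\operatorname{sr}(AG^T)^2}{\operatorname{gap}_k(AG^T)^2\,\nu^2\,\delta}.$$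 (b) For every $K\ge 0$ there is a constant $C>0$, depending only on $K$, such that the following holds. Let $\rho$ be a probability distribution on $\mathbb R$ with variance $v>0$ and $\int e^{\lambda y}\,d\rho(y)\le e^{Kv\lambda^2/2}$ for all $\lambda\in\mathbb R$ (so $\rho$ has mean $0$). Let $G$ be the $t\times d$ matrix whose entries are i.i.d. from $\rho$, multiplied by $1/\sqrt{tv}$. Then the distribution of $G$ has the $(\epsilon_2,\delta/2)$-approximate Gram property for $A^T$ whenever $$t\ge C\,\frac{\operatorname{sr}(A)+\log(1/\delta)}{\operatorname{gap}_k(A)^2\,\nu^2}.$$ -/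

import Mathlib

open MeasureTheory ProbabilityTheory
open scoped Matrix Matrix.Norms.L2Operator NNReal ENNReal

namespace SketchedPCR

/-! Throughout, `‖X‖` on matrices is the spectral norm (the operator norm for Euclidean norms). -/

/-- The Euclidean norm of a real vector. -/
noncomputable def vecNorm {ι : Type*} [Fintype ι] (v : ι → ℝ) : ℝ := ‖WithLp.toLp 2 v‖

/-- The `i`-th singular value of `X`, counted from `1`, in decreasing order (and `0` for `i` larger
than the rank). -/
noncomputable def sv {m n : ℕ} (X : Matrix (Fin m) (Fin n) ℝ) (i : ℕ) : ℝ :=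
  (Matrix.toEuclideanLin X).singularValues (i - 1)

/-- The `k`-th relative gap `(σ_k² - σ_{k+1}²) / σ_1²`. -/
noncomputable def gap {m n : ℕ} (X : Matrix (Fin m) (Fin n) ℝ) (k : ℕ) : ℝ :=
  (sv X k ^ 2 - sv X (k + 1) ^ 2) / sv X 1 ^ 2

/-- The stable rank `‖X‖_F² / ‖X‖²`. -/
noncomputable def stableRank {m n : ℕ} (X : Matrix (Fin m) (Fin n) ℝ) : ℝ :=
  (∑ i, ∑ j, X i j ^ 2) / ‖X‖ ^ 2

/-- A thin singular value decomposition `X = U Σ Vᵀ`, where `Σ` is the diagonal matrix of the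
singular values `σ_1 ≥ σ_2 ≥ ⋯`. -/
structure ThinSVD {m n : ℕ} (X : Matrix (Fin m) (Fin n) ℝ) where
  U : Matrix (Fin m) (Fin (min m n)) ℝ
  V : Matrix (Fin n) (Fin (min m n)) ℝ
  U_orthonormal : Uᵀ * U = 1
  V_orthonormal : Vᵀ * V = 1
  decomp : X = U * Matrix.diagonal (fun i : Fin (min m n) => sv X ((i : ℕ) + 1)) * Vᵀ

namespace ThinSVD

variable {m n : ℕ} {X : Matrix (Fin m) (Fin n) ℝ}

/-- The first `k` columns of `V`. -/
def Vk (D : ThinSVD X) {k : ℕ} (hk : k ≤ min m n) : Matrix (Fin n) (Fin k) ℝ :=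
  D.V.submatrix id (Fin.castLE hk)

/-- The last `min m n - k` columns of `U`, that is, all columns after the first `k`. -/
def Ukplus (D : ThinSVD X) (k : ℕ) : Matrix (Fin m) {i : Fin (min m n) // k ≤ (i : ℕ)} ℝ :=
  D.U.submatrix id Subtype.val

/-- The Moore-Penrose pseudo-inverse `V Σ⁺ Uᵀ` (with `0⁻¹ = 0`); it does not depend on the
decomposition. -/
noncomputable def pinv (D : ThinSVD X) : Matrix (Fin n) (Fin m) ℝ :=
  D.V * Matrix.diagonal (fun i : Fin (min m n) => (sv X ((i : ℕ) + 1))⁻¹) * D.Uᵀ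

end ThinSVD

open Module in
/-- Every real matrix has a thin singular value decomposition. -/
theorem nonempty_thinSVD {m n : ℕ} (X : Matrix (Fin m) (Fin n) ℝ) : Nonempty (ThinSVD X) := by
  set T := Matrix.toEuclideanLin X with hT
  have hn : finrank ℝ (EuclideanSpace ℝ (Fin n)) = n := by simp
  have hm : finrank ℝ (EuclideanSpace ℝ (Fin m)) = m := by simp
  set hs := T.isSymmetric_adjoint_comp_self
  set v := hs.eigenvectorBasis hn with hv
  have hin (i j : Fin n) : inner ℝ (T (v i)) (T (v j)) =
      if i = j then T.singularValues i ^ 2 else 0 := by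
    rw [← LinearMap.adjoint_inner_left, ← LinearMap.comp_apply, hv,
      hs.apply_eigenvectorBasis hn i, inner_smul_left,
      orthonormal_iff_ite.1 (hs.eigenvectorBasis hn).orthonormal i j, T.sq_singularValues_fin hn i]
    simp
  clear_value v
  have hdot {p : ℕ} (x y : EuclideanSpace ℝ (Fin p)) : inner ℝ x y = ∑ a, x a * y a := by
    rw [PiLp.inner_apply]
    exact Finset.sum_congr rfl fun a _ => mul_comm _ _
  have hz (j : Fin n) (hj : T.singularValues j = 0) : T (v j) = 0 := by
    have h := hin j j
    rw [if_pos rfl, hj, zero_pow two_ne_zero] at h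
    exact inner_self_eq_zero.1 h
  let w : Fin m → EuclideanSpace ℝ (Fin m) := fun i =>
    if h : (i : ℕ) < n then (T.singularValues i)⁻¹ • T (v ⟨i, h⟩) else 0
  let s : Set (Fin m) := {i | T.singularValues i ≠ 0}
  have hlt (i : ℕ) (hi : T.singularValues i ≠ 0) : i < n := by
    by_contra h
    exact hi (T.singularValues_of_finrank_le (by rw [hn]; omega))
  have hw : Orthonormal ℝ (s.domRestrict w) := by
    rw [orthonormal_iff_ite]
    rintro ⟨i, hi⟩ ⟨j, hj⟩
    have hi' := hlt _ hi
    have hj' := hlt _ hj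
    have h1 : w i = (T.singularValues i)⁻¹ • T (v ⟨i, hi'⟩) := dif_pos hi'
    have h2 : w j = (T.singularValues j)⁻¹ • T (v ⟨j, hj'⟩) := dif_pos hj'
    change inner ℝ (w i) (w j) = _
    rw [h1, h2, real_inner_smul_left, real_inner_smul_right, hin]
    have hi0 : T.singularValues i ≠ 0 := hi
    by_cases hij : i = j
    · subst hij
      simp only [if_true]
      field_simp
    · have : (i : ℕ) ≠ j := fun h => hij (Fin.ext h)
      simp [hij, this]
  obtain ⟨u, hu⟩ := hw.exists_orthonormalBasis_extension_of_card_eq (by simp)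
  have key (i : ℕ) (hi : i < n) (hi' : i < m) :
      T (v ⟨i, hi⟩) = T.singularValues i • u ⟨i, hi'⟩ := by
    by_cases h : T.singularValues i = 0
    · rw [h, zero_smul]; exact hz ⟨i, hi⟩ h
    · rw [hu ⟨i, hi'⟩ h]
      simp [w, hi, smul_smul, h]
  let cu : Fin (min m n) → Fin m := Fin.castLE (min_le_left m n)
  let cv : Fin (min m n) → Fin n := Fin.castLE (min_le_right m n)
  have hcu : Function.Injective cu := Fin.castLE_injective _
  have hcv : Function.Injective cv := Fin.castLE_injective _
  refine ⟨⟨Matrix.of fun a i => u (cu i) a, Matrix.of fun a i => v (cv i) a, ?_, ?_, ?_⟩⟩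
  · ext i j
    rw [Matrix.mul_apply, Matrix.one_apply,
      ← orthonormal_iff_ite.1 (u.orthonormal.comp cu hcu) i j, hdot]
    rfl
  · ext i j
    rw [Matrix.mul_apply, Matrix.one_apply,
      ← orthonormal_iff_ite.1 (v.orthonormal.comp cv hcv) i j, hdot]
    rfl
  · apply Matrix.toEuclideanLin.injective
    apply v.toBasis.ext
    intro j
    rw [OrthonormalBasis.coe_toBasis]
    have hVj : (Matrix.of fun a i => v (cv i) a : Matrix (Fin n) (Fin (min m n)) ℝ)ᵀ *ᵥ
        (v j).ofLp = fun i => if cv i = j then 1 else 0 := by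
      ext i
      rw [← orthonormal_iff_ite.1 v.orthonormal (cv i) j, hdot]
      rfl
    ext a
    change T (v j) a = ((_ * _ * _) *ᵥ (v j).ofLp) a
    rw [← Matrix.mulVec_mulVec, ← Matrix.mulVec_mulVec, hVj]
    by_cases hj : (j : ℕ) < m
    · rw [key j j.2 hj]
      let j' : Fin (min m n) := ⟨j, lt_min hj j.2⟩
      have he (i : Fin (min m n)) : cv i = j ↔ i = j' := by
        simp [cv, j', Fin.ext_iff]
      simp only [he]
      have hd : (Matrix.diagonal (fun i : Fin (min m n) => sv X ((i : ℕ) + 1))) *ᵥ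
          (fun i => if i = j' then (1 : ℝ) else 0) = Pi.single j' (T.singularValues j) := by
        ext i
        rw [Matrix.mulVec_diagonal]
        by_cases h : i = j'
        · subst h; simp [sv, j', hT]
        · simp [h]
      rw [hd]
      simp [j', cu, mul_comm]
    · have h0 : T.singularValues j = 0 := by
        rw [T.singularValues_eq_zero_iff_le_finrank_range]
        exact (Submodule.finrank_le _).trans (by rw [hm]; omega)
      have he (i : Fin (min m n)) : cv i ≠ j := by
        intro h
        have := congrArg Fin.val h
        have h2 := i.2
        simp [cv] at this
        omega
      rw [hz j h0]
      simp only [he, if_false]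
      simp [← Pi.zero_def]

/-! ### The optimization perspective -/

/-- `x` is the rank-`k` PCR solution for `(A, b)`: it minimizes `‖A x - b‖` over the range of
`V_{A,k}`. -/
def IsPCRSolution {n d k : ℕ} (A : Matrix (Fin n) (Fin d) ℝ) (D : ThinSVD A) (hk : k ≤ min n d)
    (b : Fin n → ℝ) (x : Fin d → ℝ) : Prop :=
  x ∈ LinearMap.range (D.Vk hk).mulVecLin ∧
    ∀ y ∈ LinearMap.range (D.Vk hk).mulVecLin, vecNorm (A *ᵥ x - b) ≤ vecNorm (A *ᵥ y - b)

/-- `btilde` is an `(ε, υ)`-approximate PCP of rank `k` of `b`, where `bk` is the exact PCP. -/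
def IsApproxPCP {n d : ℕ} {A : Matrix (Fin n) (Fin d) ℝ} (D : ThinSVD A) (k : ℕ) (ε υ : ℝ)
    (b bk btilde : Fin n → ℝ) : Prop :=
  |vecNorm (btilde - b) - vecNorm (bk - b)| ≤ ε * vecNorm b ∧
    vecNorm ((D.Ukplus k)ᵀ *ᵥ btilde) ≤ υ * vecNorm b

/-- The matrix `R V_{AR,k} (A R V_{AR,k})⁺`, so that `x_{R,k} = solutionMatrix *ᵥ b`. -/
noncomputable def solutionMatrix {n d s k : ℕ} (A : Matrix (Fin n) (Fin d) ℝ)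
    (R : Matrix (Fin d) (Fin s) ℝ) (hk : k ≤ min n s) (DAR : ThinSVD (A * R))
    (DARV : ThinSVD (A * R * DAR.Vk hk)) : Matrix (Fin d) (Fin n) ℝ :=
  R * DAR.Vk hk * DARV.pinv

/-! ### The statistical perspective -/

/-- The noise model: independent square-integrable entries with mean zero and variance `σ²`. -/
structure IsNoise {n : ℕ} {Ω : Type*} [MeasurableSpace Ω] (P : Measure Ω) (ξ : Fin n → Ω → ℝ)
    (σ : ℝ) : Prop where
  indep : iIndepFun ξ P
  memLp : ∀ i, MemLp (ξ i) 2 P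
  mean_zero : ∀ i, ∫ ω, ξ i ω ∂P = 0
  variance_eq : ∀ i, variance (ξ i) P = σ ^ 2

/-- The expected loss `E[‖A x - b‖² / n]` of a fixed vector `x`, for a random right-hand side. -/
noncomputable def expectedLoss {n d : ℕ} {Ω : Type*} [MeasurableSpace Ω] (P : Measure Ω)
    (A : Matrix (Fin n) (Fin d) ℝ) (b : Ω → Fin n → ℝ) (x : Fin d → ℝ) : ℝ :=
  ∫ ω, vecNorm (A *ᵥ x - b ω) ^ 2 / n ∂P

/-- `xstar` is the minimizer of the expected loss that has minimum norm. -/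
def IsOptimal {n d : ℕ} {Ω : Type*} [MeasurableSpace Ω] (P : Measure Ω)
    (A : Matrix (Fin n) (Fin d) ℝ) (b : Ω → Fin n → ℝ) (xstar : Fin d → ℝ) : Prop :=
  (∀ y, expectedLoss P A b xstar ≤ expectedLoss P A b y) ∧
    ∀ y, (∀ z, expectedLoss P A b y ≤ expectedLoss P A b z) → vecNorm xstar ≤ vecNorm y

/-- The excess risk `E[‖A θ - A xstar‖² / n]` of an estimator `θ`. -/
noncomputable def excessRisk {n d : ℕ} {Ω : Type*} [MeasurableSpace Ω] (P : Measure Ω)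
    (A : Matrix (Fin n) (Fin d) ℝ) (xstar : Fin d → ℝ) (θ : Ω → Fin d → ℝ) : ℝ :=
  ∫ ω, vecNorm (A *ᵥ θ ω - A *ᵥ xstar) ^ 2 / n ∂P

/-! ### Random sketching matrices -/

instance instMeasurableSpaceMatrix {m n : ℕ} : MeasurableSpace (Matrix (Fin m) (Fin n) ℝ) :=
  inferInstanceAs (MeasurableSpace (Fin m → Fin n → ℝ))

/-- A matrix with `m` columns, with any number of rows. For `S : Sketch m`, `S.1` is the number of
rows and `S.2` is the matrix. -/
abbrev Sketch (m : ℕ) : Type := Σ r : ℕ, Matrix (Fin r) (Fin m) ℝ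

/-- The distribution `𝒟` on matrices with `m` columns has the `(ε, δ)`-approximate Gram matrix
property for `X`. -/
def HasApproxGram {m n : ℕ} (𝒟 : Measure (Sketch m)) (X : Matrix (Fin m) (Fin n) ℝ)
    (ε δ : ℝ) : Prop :=
  𝒟 {S | ε * ‖X‖ ^ 2 ≤ ‖Xᵀ * S.2ᵀ * S.2 * X - Xᵀ * X‖} ≤ ENNReal.ofReal δ

/-- The CountSketch distribution with `r` rows and `m` columns: the columns are independent, and
each is a uniformly random standard basis vector times a uniformly random sign. -/
noncomputable def countSketch (r m : ℕ) : Measure (Sketch m) :=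
  (uniformOn (Set.univ : Set (Fin m → Fin r × Bool))).map fun h =>
    ⟨r, Matrix.of fun i j => if (h j).1 = i then (if (h j).2 then 1 else -1) else 0⟩

/-- The subgaussian map with `r` rows and `m` columns: the entries are drawn independently from `ρ`
and multiplied by `1 / √(r v)`, where `v` is the variance of `ρ`. -/
noncomputable def subgaussianMap (ρ : Measure ℝ) (r m : ℕ) : Measure (Sketch m) :=
  (Measure.pi fun _ : Fin r => Measure.pi fun _ : Fin m => ρ).map fun M =>
    ⟨r, (1 / √(r * variance id ρ)) • Matrix.of M⟩

/-! ### Two-sided sketching -/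

/-- `ε₂ = ν / (2 (1 + ν / 2)) · gap_k(A)`. -/
noncomputable def eps2 {n d : ℕ} (A : Matrix (Fin n) (Fin d) ℝ) (k : ℕ) (ν : ℝ) : ℝ :=
  ν / (2 * (1 + ν / 2)) * gap A k

/-- `ε₁ = a / (1 + a) · gap_k(B)` with `a = ν (1 + ν² / 4)^{-1/2} / 2`; used with `B = A Gᵀ`. -/
noncomputable def eps1 {n t : ℕ} (B : Matrix (Fin n) (Fin t) ℝ) (k : ℕ) (ν : ℝ) : ℝ :=
  (ν * (√(1 + ν ^ 2 / 4))⁻¹ / 2) / (1 + ν * (√(1 + ν ^ 2 / 4))⁻¹ / 2) * gap B k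

/-- The matrix `R = Gᵀ V_{S A Gᵀ, k}`. -/
def twoSidedR {n d k : ℕ} {A : Matrix (Fin n) (Fin d) ℝ} (G : Sketch d) (S : Sketch n)
    (hk : k ≤ min S.1 G.1) (D : ThinSVD (S.2 * A * G.2ᵀ)) : Matrix (Fin d) (Fin k) ℝ :=
  G.2ᵀ * D.Vk hk

/-- For the sketches `G` and `S` (with at least `k` rows each, so that `R = Gᵀ V_{S A Gᵀ, k}` is
defined) and for all choices of the singular value decompositions involved, `A x_{R,k}` is a
`(ν, ν)`-approximate PCP of rank `k` of every `b`, and, for every `f`, the excess risk of `x_{R,k}`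
for `b = f + ξ` is at most `ℰ(x_k) + (2 ν + ν²) ‖f‖² / n`. -/
def TwoSidedGuarantee {n d k : ℕ} {Ω : Type*} [MeasurableSpace Ω] (P : Measure Ω)
    (ξ : Fin n → Ω → ℝ) (A : Matrix (Fin n) (Fin d) ℝ) (hk : k ≤ min n d) (ν : ℝ)
    (G : Sketch d) (S : Sketch n) : Prop :=
  ∃ hSG : k ≤ min S.1 G.1,
    ∀ (DA : ThinSVD A) (D : ThinSVD (S.2 * A * G.2ᵀ))
      (DAR : ThinSVD (A * twoSidedR G S hSG D))
      (DARV : ThinSVD (A * twoSidedR G S hSG D *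
        DAR.Vk (le_min (hk.trans (min_le_left n d)) le_rfl)))
      (xk : (Fin n → ℝ) → Fin d → ℝ), (∀ b, IsPCRSolution A DA hk b (xk b)) →
      let xRk : (Fin n → ℝ) → Fin d → ℝ := fun b =>
        solutionMatrix A (twoSidedR G S hSG D)
          (le_min (hk.trans (min_le_left n d)) le_rfl) DAR DARV *ᵥ b
      (∀ b, IsApproxPCP DA k ν ν b (A *ᵥ xk b) (A *ᵥ xRk b)) ∧
      ∀ (f : Fin n → ℝ) (xstar : Fin d → ℝ),
        let b : Ω → Fin n → ℝ := fun ω i => f i + ξ i ω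
        IsOptimal P A b xstar →
        excessRisk P A xstar (fun ω => xRk (b ω)) ≤
          excessRisk P A xstar (fun ω => xk (b ω)) + (2 * ν + ν ^ 2) * vecNorm f ^ 2 / n

end SketchedPCR

open SketchedPCR

/-! Two subspaces of ℝⁿ matter: U, spanned by the first k left singular vectors of A, and W, the
range of AR. The exact fit is P_U b. The sketched fit is P_W b, because R already has k columns and
the last truncation discards nothing (`range_op_mul_Vk`). Everything therefore follows from ‖P_W -
P_U‖ ≤ ν together with the bound on the part of W outside U. For the risk, dim W = dim U makes the
variance terms equal, so only the squared bias changes.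

Closeness of W and U takes two perturbation steps. Put B = AGᵀ. The Gram property of G says that BBᵀ
is near AAᵀ, so a Weyl inequality and a one-sided Davis-Kahan theorem
(`Separates.norm_starProjection_orthogonal_le`) put the left singular space of B within sine ν/2 of
U. The Gram property of S says that (SB)ᵀSB is near BᵀB, so the right singular space of SB is near
that of B. Applying B does not increase the tangent of this second angle, since σ_{k+1} ≤ σ_k. The
image W is thus within ν/2 + ν/2 of U (`map_perturbation`). Equality of dimensions turns this
one-sided closeness into closeness of projections (`norm_starProjection_sub_le`).

For CountSketch, the off-diagonal entries of SᵀS are uncorrelated up to symmetry and have second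
moment at most 1/s. This bounds the mean squared Frobenius error, and Markov's inequality for its
square finishes.

For the subgaussian map, a net would cost the dimension instead of the stable rank. A PAC-Bayes
argument is used: exp(l⟨z, Ez'⟩), with E the Gram error, is integrated over two independent Gaussian
vectors of precision sr(X), truncated to ‖Xz‖ ≤ 4‖X‖. If ‖E‖ is large, recentring the Gaussians at
almost extremal vectors shows that the integral is large (`le_lintegral_exp_bilinear`). Its
expectation is small by Fubini and a moment generating bound for fixed z, z'
(`lintegral_exp_inner_scaledMatrix_le`). -/

namespace SketchedPCR

/-! ### Matrices as operators between Euclidean spaces -/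

section Operators

set_option linter.unusedSectionVars false

variable {l m n : Type*} [Fintype l] [Fintype m] [Fintype n] [DecidableEq l] [DecidableEq m]
  [DecidableEq n]

/-- The linear map between Euclidean spaces given by a matrix. -/
noncomputable abbrev op (X : Matrix m n ℝ) : EuclideanSpace ℝ n →ₗ[ℝ] EuclideanSpace ℝ m :=
  Matrix.toEuclideanLin X

theorem op_mul (X : Matrix l m ℝ) (Y : Matrix m n ℝ) (x : EuclideanSpace ℝ n) :
    op (X * Y) x = op X (op Y x) := by
  simp [op]

theorem op_one (x : EuclideanSpace ℝ n) : op (1 : Matrix n n ℝ) x = x := by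
  simp [op]

theorem inner_op (X : Matrix m n ℝ) (x : EuclideanSpace ℝ n) (y : EuclideanSpace ℝ m) :
    inner ℝ (op X x) y = inner ℝ x (op Xᵀ y) := by
  rw [EuclideanSpace.inner_eq_star_dotProduct, EuclideanSpace.inner_eq_star_dotProduct]
  simp only [star_trivial]
  change y.ofLp ⬝ᵥ (X *ᵥ x.ofLp) = (Xᵀ *ᵥ y.ofLp) ⬝ᵥ x.ofLp
  rw [Matrix.dotProduct_mulVec, Matrix.mulVec_transpose]

theorem norm_op_le (X : Matrix m n ℝ) (x : EuclideanSpace ℝ n) : ‖op X x‖ ≤ ‖X‖ * ‖x‖ :=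
  X.l2_opNorm_mulVec x

theorem opNorm_le_of_forall (X : Matrix m n ℝ) {c : ℝ} (hc : 0 ≤ c)
    (h : ∀ x, ‖op X x‖ ≤ c * ‖x‖) : ‖X‖ ≤ c := by
  rw [Matrix.l2_opNorm_def]
  exact ContinuousLinearMap.opNorm_le_bound _ hc h

theorem norm_op_sq (X : Matrix m n ℝ) (x : EuclideanSpace ℝ n) :
    ‖op X x‖ ^ 2 = inner ℝ x (op (Xᵀ * X) x) := by
  rw [op_mul, ← inner_op, real_inner_self_eq_norm_sq]

theorem norm_op_of_orthonormal {W : Matrix m n ℝ} (hW : Wᵀ * W = 1) (c : EuclideanSpace ℝ n) :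
    ‖op W c‖ = ‖c‖ := by
  have := norm_op_sq W c
  rw [hW, op_one, real_inner_self_eq_norm_sq] at this
  exact (pow_left_inj₀ (norm_nonneg _) (norm_nonneg _) two_ne_zero).1 this

theorem op_transpose_op_of_orthonormal {W : Matrix m n ℝ} (hW : Wᵀ * W = 1)
    (c : EuclideanSpace ℝ n) : op Wᵀ (op W c) = c := by
  rw [← op_mul, hW, op_one]

theorem norm_op_transpose_le_of_orthonormal {W : Matrix m n ℝ} (hW : Wᵀ * W = 1)
    (x : EuclideanSpace ℝ m) : ‖op Wᵀ x‖ ≤ ‖x‖ := by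
  have h : ‖op Wᵀ x‖ ^ 2 ≤ ‖op Wᵀ x‖ * ‖x‖ := by
    rw [← real_inner_self_eq_norm_sq]
    rw [inner_op, Matrix.transpose_transpose]
    calc _ ≤ ‖x‖ * ‖op W (op Wᵀ x)‖ := real_inner_le_norm _ _
      _ = _ := by rw [norm_op_of_orthonormal hW, mul_comm]
  by_contra! hlt
  nlinarith [norm_nonneg x]

end Operators

/-! ### Perturbation of invariant subspaces -/

section Separates

variable {E F G : Type*} [NormedAddCommGroup E] [InnerProductSpace ℝ E]
  [NormedAddCommGroup F] [InnerProductSpace ℝ F] [NormedAddCommGroup G] [InnerProductSpace ℝ G]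

/-- `X` maps `V` to `U` and `Vᗮ` to `Uᗮ`, expands by at least `a` on `V` and by at most `b`
on `Vᗮ`. -/
structure Separates (X : E →ₗ[ℝ] F) (V : Submodule ℝ E) (U : Submodule ℝ F) (a b : ℝ) :
    Prop where
  map_mem : ∀ x ∈ V, X x ∈ U
  map_mem_orthogonal : ∀ x ∈ Vᗮ, X x ∈ Uᗮ
  lower : ∀ x ∈ V, a * ‖x‖ ≤ ‖X x‖
  upper : ∀ x ∈ Vᗮ, ‖X x‖ ≤ b * ‖x‖

theorem Separates.comp {X : E →ₗ[ℝ] F} {Y : F →ₗ[ℝ] G} {V : Submodule ℝ E} {U : Submodule ℝ F}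
    {W : Submodule ℝ G} {a b c e : ℝ} (hY : Separates Y U W c e) (hX : Separates X V U a b)
    (hc : 0 ≤ c) (he : 0 ≤ e) : Separates (Y ∘ₗ X) V W (c * a) (e * b) where
  map_mem x hx := hY.map_mem _ (hX.map_mem x hx)
  map_mem_orthogonal x hx := hY.map_mem_orthogonal _ (hX.map_mem_orthogonal x hx)
  lower x hx := by
    calc c * a * ‖x‖ = c * (a * ‖x‖) := by ring
      _ ≤ c * ‖X x‖ := by gcongr; exact hX.lower x hx
      _ ≤ _ := hY.lower _ (hX.map_mem x hx)
  upper x hx := by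
    calc ‖Y (X x)‖ ≤ e * ‖X x‖ := hY.upper _ (hX.map_mem_orthogonal x hx)
      _ ≤ e * (b * ‖x‖) := by gcongr; exact hX.upper x hx
      _ = _ := by ring

/-- A Weyl type inequality between squared singular values. -/
theorem Separates.sq_le_sq_add [FiniteDimensional ℝ E] {X : E →ₗ[ℝ] F} {Y : E →ₗ[ℝ] G}
    {V V' : Submodule ℝ E} {U : Submodule ℝ F} {U' : Submodule ℝ G} {a b a' b' e : ℝ}
    (hX : Separates X V U a b) (hY : Separates Y V' U' a' b') (ha : 0 ≤ a)
    (hdim : Module.finrank ℝ V' < Module.finrank ℝ V)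
    (h : ∀ x, ‖X x‖ ^ 2 ≤ ‖Y x‖ ^ 2 + e * ‖x‖ ^ 2) : a ^ 2 ≤ b' ^ 2 + e := by
  -- dim V + dim V'ᗮ exceeds dim E, so some nonzero vector is expanded by X and contracted by Y.
  have h1 : V ⊓ V'ᗮ ≠ ⊥ := by
    intro hbot
    have h2 := Submodule.finrank_sup_add_finrank_inf_eq V V'ᗮ
    have h3 := V'.finrank_add_finrank_orthogonal
    have h4 := (V ⊔ V'ᗮ).finrank_le
    rw [hbot, finrank_bot] at h2
    omega
  obtain ⟨x, hx, hx0⟩ := Submodule.exists_mem_ne_zero_of_ne_bot h1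
  have hxp : 0 < ‖x‖ := norm_pos_iff.2 hx0
  have h5 : (a * ‖x‖) ^ 2 ≤ ‖X x‖ ^ 2 := pow_le_pow_left₀ (by positivity) (hX.lower x hx.1) 2
  have h6 : ‖Y x‖ ^ 2 ≤ (b' * ‖x‖) ^ 2 := pow_le_pow_left₀ (norm_nonneg _) (hY.upper x hx.2) 2
  have h7 := h x
  have h8 : a ^ 2 * ‖x‖ ^ 2 ≤ (b' ^ 2 + e) * ‖x‖ ^ 2 := by nlinarith
  exact le_of_mul_le_mul_right h8 (by positivity)

/-- A one-sided sine theorem of Davis-Kahan type. -/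
theorem Separates.norm_starProjection_orthogonal_le [FiniteDimensional ℝ E] {S T : E →ₗ[ℝ] E}
    {V V' : Submodule ℝ E} {a b a' b' e : ℝ}
    (hS : Separates S V V a b) (hT : Separates T V' V' a' b') (hb : 0 ≤ b) (hab : b < a')
    (he : 0 ≤ e) (h : ∀ x, ‖T x - S x‖ ≤ e * ‖x‖) {x : E} (hx : x ∈ V') :
    ‖Vᗮ.starProjection x‖ ≤ e / (a' - b) * ‖x‖ := by
  have ha' : 0 < a' := hb.trans_lt hab
  -- ‖M‖ is the sine to be bounded. Writing y = T z with z in V' gives ‖M‖ ≤ (e + b‖M‖)/a', and b <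
  -- a' allows solving this for ‖M‖.
  set M : E →L[ℝ] E := Vᗮ.starProjection ∘L V'.starProjection with hM
  have key : ∀ y ∈ V', ‖Vᗮ.starProjection y‖ ≤ (e + b * ‖M‖) / a' * ‖y‖ := by
    intro y hy
    let T' : V' →ₗ[ℝ] V' := T.restrict hT.map_mem
    have hinj : Function.Injective T' := by
      rw [← LinearMap.ker_eq_bot, LinearMap.ker_eq_bot']
      intro z hz
      have h1 := hT.lower z z.2
      have h2 : T z = 0 := congrArg Subtype.val hz
      rw [h2, norm_zero] at h1
      have : ‖(z : E)‖ ≤ 0 := by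
        by_contra! hlt
        nlinarith [mul_pos ha' hlt]
      exact Subtype.ext (norm_le_zero_iff.1 this)
    obtain ⟨⟨z, hz⟩, hzy⟩ := (LinearMap.injective_iff_surjective.1 hinj) ⟨y, hy⟩
    have hzy' : T z = y := congrArg Subtype.val hzy
    have hzn : ‖z‖ ≤ ‖y‖ / a' := by
      rw [le_div_iff₀ ha', mul_comm, ← hzy']; exact hT.lower z hz
    -- S preserves both V and Vᗮ, hence commutes with the projection.
    have hSz : Vᗮ.starProjection (S z) = S (Vᗮ.starProjection z) := by
      have hdec := V.starProjection_add_starProjection_orthogonal z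
      have h1 : Vᗮ.starProjection (S (V.starProjection z)) = 0 := by
        rw [Submodule.starProjection_orthogonal_val,
          Submodule.starProjection_eq_self_iff.2 (hS.map_mem _ (V.starProjection_apply_mem z)),
          sub_self]
      have h2 : Vᗮ.starProjection (S (Vᗮ.starProjection z)) = S (Vᗮ.starProjection z) :=
        Submodule.starProjection_eq_self_iff.2
          (hS.map_mem_orthogonal _ (Vᗮ.starProjection_apply_mem z))
      conv_lhs => rw [← hdec]
      rw [map_add, map_add, h1, h2, zero_add]
    have hMz : ‖Vᗮ.starProjection z‖ ≤ ‖M‖ * ‖z‖ := by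
      have := M.le_opNorm z
      rwa [hM, ContinuousLinearMap.comp_apply, Submodule.starProjection_eq_self_iff.2 hz] at this
    calc ‖Vᗮ.starProjection y‖
        = ‖Vᗮ.starProjection (T z - S z) + S (Vᗮ.starProjection z)‖ := by
          rw [← hSz, ← map_add, sub_add_cancel, hzy']
      _ ≤ ‖Vᗮ.starProjection (T z - S z)‖ + ‖S (Vᗮ.starProjection z)‖ := norm_add_le _ _
      _ ≤ e * ‖z‖ + b * (‖M‖ * ‖z‖) := by
          gcongr
          · exact (Vᗮ.norm_starProjection_apply_le _).trans (h z)
          · exact (hS.upper _ (Vᗮ.starProjection_apply_mem z)).trans (by gcongr)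
      _ = (e + b * ‖M‖) * ‖z‖ := by ring
      _ ≤ (e + b * ‖M‖) * (‖y‖ / a') := by gcongr
      _ = _ := by ring
  have hMle : ‖M‖ ≤ (e + b * ‖M‖) / a' := by
    refine M.opNorm_le_bound (by positivity) fun y => ?_
    refine (key _ (V'.starProjection_apply_mem y)).trans ?_
    gcongr
    exact V'.norm_starProjection_apply_le y
  have hMle' : ‖M‖ ≤ e / (a' - b) := by
    rw [le_div_iff₀ ha'] at hMle
    rw [le_div_iff₀ (by linarith)]
    linarith
  have := M.le_opNorm x
  rw [hM, ContinuousLinearMap.comp_apply, Submodule.starProjection_eq_self_iff.2 hx] at this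
  exact this.trans (by gcongr)

/-- If every vector of `W` is close to `V` and the dimensions agree, then the orthogonal projections
are close. -/
theorem norm_starProjection_sub_le [FiniteDimensional ℝ E] {V W : Submodule ℝ E} {θ : ℝ}
    (hdim : Module.finrank ℝ V = Module.finrank ℝ W) (h0 : 0 ≤ θ) (h1 : θ < 1)
    (h : ∀ w ∈ W, ‖Vᗮ.starProjection w‖ ≤ θ * ‖w‖) (y : E) :
    ‖W.starProjection y - V.starProjection y‖ ≤ θ * ‖y‖ := by
  have hpyth : ∀ (U : Submodule ℝ E) (x : E),
      ‖x‖ ^ 2 = ‖U.starProjection x‖ ^ 2 + ‖Uᗮ.starProjection x‖ ^ 2 := fun U x =>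
    Submodule.norm_sq_eq_add_norm_sq_starProjection x U
  have hW : ∀ w ∈ W, (1 - θ ^ 2) * ‖w‖ ^ 2 ≤ ‖V.starProjection w‖ ^ 2 := by
    intro w hw
    have h2 := hpyth V w
    have h3 := pow_le_pow_left₀ (norm_nonneg _) (h w hw) 2
    nlinarith
  have hθ : 0 < 1 - θ ^ 2 := by nlinarith
  let Q : W →ₗ[ℝ] V :=
    (V.starProjection.toLinearMap.comp W.subtype).codRestrict V
      fun w => V.starProjection_apply_mem _
  have hQinj : Function.Injective Q := by
    rw [← LinearMap.ker_eq_bot, LinearMap.ker_eq_bot']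
    intro w hw
    have h2 := hW w w.2
    have h3 : V.starProjection (w : E) = 0 := congrArg Subtype.val hw
    rw [h3, norm_zero] at h2
    have : ‖(w : E)‖ ^ 2 ≤ 0 := by nlinarith [sq_nonneg ‖(w : E)‖]
    exact Subtype.ext (norm_eq_zero.1 (pow_eq_zero_iff two_ne_zero |>.1
      (le_antisymm this (sq_nonneg _))))
  -- This is where equality of dimensions enters: every v in V is the projection of some w in W of
  -- comparable norm, which bounds the angle in the other direction.
  have hQsurj : Function.Surjective Q :=
    (LinearMap.injective_iff_surjective_of_finrank_eq_finrank hdim.symm).1 hQinj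
  have hV : ∀ v ∈ V, ‖Wᗮ.starProjection v‖ ^ 2 ≤ θ ^ 2 * ‖v‖ ^ 2 := by
    intro v hv
    obtain ⟨⟨w, hw⟩, hwv⟩ := hQsurj ⟨v, hv⟩
    have hwv' : V.starProjection w = v := congrArg Subtype.val hwv
    have e1 : ‖v‖ ^ 2 = inner ℝ (W.starProjection v) w := by
      rw [W.inner_starProjection_left_eq_right, Submodule.starProjection_eq_self_iff.2 hw,
        ← real_inner_self_eq_norm_sq]
      nth_rw 2 [← hwv']
      rw [← V.inner_starProjection_left_eq_right, Submodule.starProjection_eq_self_iff.2 hv]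
    have e2 : ‖v‖ ^ 2 ≤ ‖W.starProjection v‖ * ‖w‖ := e1 ▸ real_inner_le_norm _ _
    have e3 := hW w hw
    rw [hwv'] at e3
    have e4 : (1 - θ ^ 2) * ‖v‖ ^ 2 ≤ ‖W.starProjection v‖ ^ 2 := by
      rcases (norm_nonneg v).eq_or_lt with hv0 | hvp
      · rw [← hv0]; simp
      · have e5 : (‖v‖ ^ 2) ^ 2 ≤ ‖W.starProjection v‖ ^ 2 * ‖w‖ ^ 2 := by
          rw [← mul_pow]; exact pow_le_pow_left₀ (by positivity) e2 2
        have e6 : (1 - θ ^ 2) * (‖v‖ ^ 2) ^ 2 ≤ ‖W.starProjection v‖ ^ 2 * ‖v‖ ^ 2 := by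
          nlinarith [mul_le_mul_of_nonneg_left e3 (sq_nonneg ‖W.starProjection v‖)]
        have : (1 - θ ^ 2) * ‖v‖ ^ 2 * ‖v‖ ^ 2 ≤ ‖W.starProjection v‖ ^ 2 * ‖v‖ ^ 2 := by
          linarith
        exact le_of_mul_le_mul_right this (by positivity)
    have e7 := hpyth W v
    linarith
  -- The adjoint of the hypothesis on W.
  have hWV : ∀ x ∈ Vᗮ, ‖W.starProjection x‖ ^ 2 ≤ θ ^ 2 * ‖x‖ ^ 2 := by
    intro x hx
    set w := W.starProjection x with hw
    have hwW : w ∈ W := W.starProjection_apply_mem x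
    have e1 : ‖w‖ ^ 2 ≤ ‖x‖ * ‖Vᗮ.starProjection w‖ := by
      have : ‖w‖ ^ 2 = inner ℝ x (Vᗮ.starProjection w) := by
        rw [← Vᗮ.inner_starProjection_left_eq_right, Submodule.starProjection_eq_self_iff.2 hx,
          ← real_inner_self_eq_norm_sq]
        nth_rw 1 [hw]
        rw [W.inner_starProjection_left_eq_right, Submodule.starProjection_eq_self_iff.2 hwW]
      rw [this]; exact real_inner_le_norm _ _
    have e2 := h w hwW
    rcases (norm_nonneg w).eq_or_lt with hz | hp
    · rw [← hz, zero_pow two_ne_zero]; positivity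
    · have e3 : ‖w‖ * ‖w‖ ≤ (θ * ‖x‖) * ‖w‖ := by
        nlinarith [norm_nonneg x]
      have := le_of_mul_le_mul_right e3 hp
      calc ‖w‖ ^ 2 ≤ (θ * ‖x‖) ^ 2 := pow_le_pow_left₀ hp.le this 2
        _ = _ := by ring
  -- The two terms lie in W and Wᗮ, so Pythagoras applies twice and the constant stays θ rather than
  -- 2θ.
  have hsplit : W.starProjection y - V.starProjection y =
      W.starProjection (Vᗮ.starProjection y) - Wᗮ.starProjection (V.starProjection y) := by
    have h2 := V.starProjection_add_starProjection_orthogonal y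
    conv_lhs => rw [← h2]
    simp only [Submodule.starProjection_orthogonal_val, map_sub, map_add,
      Submodule.starProjection_eq_self_iff.2 (V.starProjection_apply_mem y)]
    abel
  have horth : inner ℝ (W.starProjection (Vᗮ.starProjection y))
      (Wᗮ.starProjection (V.starProjection y)) = 0 :=
    (W.mem_orthogonal _).1 (Wᗮ.starProjection_apply_mem _) _ (W.starProjection_apply_mem _)
  have e1 : ‖W.starProjection y - V.starProjection y‖ ^ 2 ≤ (θ * ‖y‖) ^ 2 := by
    rw [hsplit, @norm_sub_sq_real, horth]
    have e2 := hWV _ (Vᗮ.starProjection_apply_mem y)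
    have e3 := hV _ (V.starProjection_apply_mem y)
    have e4 := hpyth V y
    rw [mul_pow, e4]
    linarith
  exact (sq_le_sq₀ (norm_nonneg _) (by positivity)).1 e1

end Separates

/-! ### Spans of columns and singular decompositions -/

section ColSpan

set_option linter.unusedSectionVars false

variable {ι m n : Type*} [Fintype ι] [Fintype m] [Fintype n] [DecidableEq ι] [DecidableEq m]
  [DecidableEq n]

/-- The span of the columns of `W` whose index lies in `s`. -/
noncomputable def colSpan (W : Matrix m ι ℝ) (s : Set ι) : Submodule ℝ (EuclideanSpace ℝ m) :=
  Submodule.span ℝ ((fun i => op W (EuclideanSpace.single i 1)) '' s)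

theorem op_single_mem_colSpan (W : Matrix m ι ℝ) {s : Set ι} {i : ι} (hi : i ∈ s) :
    op W (EuclideanSpace.single i 1) ∈ colSpan W s :=
  Submodule.subset_span ⟨i, hi, rfl⟩

theorem op_mem_colSpan (W : Matrix m ι ℝ) {s : Set ι} {c : EuclideanSpace ℝ ι}
    (hc : ∀ i ∉ s, c i = 0) : op W c ∈ colSpan W s := by
  have h : c = ∑ i, c i • EuclideanSpace.single i (1 : ℝ) := by
    ext j
    simp [Pi.single_apply]
  rw [h, map_sum]
  refine Submodule.sum_mem _ fun i _ => ?_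
  rw [map_smul]
  by_cases hi : i ∈ s
  · exact Submodule.smul_mem _ _ (op_single_mem_colSpan W hi)
  · rw [hc i hi, zero_smul]; exact Submodule.zero_mem _

theorem exists_eq_op_of_mem_colSpan {W : Matrix m ι ℝ} {s : Set ι} {x : EuclideanSpace ℝ m}
    (hx : x ∈ colSpan W s) : ∃ c : EuclideanSpace ℝ ι, (∀ i ∉ s, c i = 0) ∧ x = op W c := by
  induction hx using Submodule.span_induction with
  | mem x h =>
    obtain ⟨i, hi, rfl⟩ := h
    refine ⟨EuclideanSpace.single i 1, fun j hj => ?_, rfl⟩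
    have : j ≠ i := fun h => hj (h ▸ hi)
    simp [this]
  | zero => exact ⟨0, fun _ _ => rfl, (map_zero _).symm⟩
  | add x y _ _ hx hy =>
    obtain ⟨c, hc, rfl⟩ := hx
    obtain ⟨c', hc', rfl⟩ := hy
    exact ⟨c + c', fun i hi => by simp [hc i hi, hc' i hi], (map_add _ _ _).symm⟩
  | smul a x _ hx =>
    obtain ⟨c, hc, rfl⟩ := hx
    exact ⟨a • c, fun i hi => by simp [hc i hi], (map_smul _ _ _).symm⟩

theorem op_transpose_apply (W : Matrix m ι ℝ) (x : EuclideanSpace ℝ m) (i : ι) :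
    op Wᵀ x i = inner ℝ x (op W (EuclideanSpace.single i 1)) := by
  nth_rw 2 [← Matrix.transpose_transpose W]
  rw [← inner_op, EuclideanSpace.inner_single_right]
  simp

theorem mem_colSpan_orthogonal_iff {W : Matrix m ι ℝ} {s : Set ι} {x : EuclideanSpace ℝ m} :
    x ∈ (colSpan W s)ᗮ ↔ ∀ i ∈ s, op Wᵀ x i = 0 := by
  constructor
  · intro h i hi
    rw [op_transpose_apply, real_inner_comm]
    exact (Submodule.mem_orthogonal _ _).1 h _ (op_single_mem_colSpan W hi)
  · intro h
    rw [Submodule.mem_orthogonal]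
    intro u hu
    obtain ⟨c, hc, rfl⟩ := exists_eq_op_of_mem_colSpan hu
    rw [inner_op, PiLp.inner_apply]
    refine Finset.sum_eq_zero fun i _ => ?_
    by_cases hi : i ∈ s
    · rw [h i hi, inner_zero_right]
    · rw [hc i hi, inner_zero_left]

theorem finrank_colSpan {W : Matrix m ι ℝ} (hW : Wᵀ * W = 1) (s : Finset ι) :
    Module.finrank ℝ (colSpan W (s : Set ι)) = s.card := by
  have hli : LinearIndependent ℝ fun i : s => op W (EuclideanSpace.single (i : ι) 1) := by
    have h1 : LinearIndependent ℝ fun i : ι => (EuclideanSpace.single i (1 : ℝ)) := by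
      have e : (fun i : ι => EuclideanSpace.single i (1 : ℝ)) = EuclideanSpace.basisFun ι ℝ :=
        funext fun i => (EuclideanSpace.basisFun_apply ι ℝ i).symm
      rw [e]
      exact (EuclideanSpace.basisFun ι ℝ).orthonormal.linearIndependent
    have h2 : LinearMap.ker (op W) = ⊥ := by
      rw [LinearMap.ker_eq_bot']
      intro c hc
      rw [← op_transpose_op_of_orthonormal hW c, hc, map_zero]
    exact (h1.map' _ h2).comp _ Subtype.val_injective
  have h := finrank_span_eq_card hli
  have hr : Set.range (fun i : s => op W (EuclideanSpace.single (i : ι) 1)) =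
      (fun i => op W (EuclideanSpace.single i 1)) '' (s : Set ι) := by
    ext x; simp
  rw [hr] at h
  rw [colSpan, h, Fintype.card_coe]

theorem norm_op_diagonal_le {τ : ι → ℝ} {b : ℝ} {c : EuclideanSpace ℝ ι} (hτ : ∀ i, 0 ≤ τ i)
    (h : ∀ i, c i = 0 ∨ τ i ≤ b) : ‖op (Matrix.diagonal τ) c‖ ^ 2 ≤ b ^ 2 * ‖c‖ ^ 2 := by
  rw [EuclideanSpace.norm_sq_eq, EuclideanSpace.norm_sq_eq, Finset.mul_sum]
  refine Finset.sum_le_sum fun i _ => ?_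
  change ‖(Matrix.diagonal τ *ᵥ c.ofLp) i‖ ^ 2 ≤ _
  rw [Matrix.mulVec_diagonal, norm_mul, mul_pow]
  rcases h i with h | h
  · simp [h]
  · gcongr
    rw [Real.norm_of_nonneg (hτ i)]; exact h

theorem le_norm_op_diagonal {τ : ι → ℝ} {a : ℝ} {c : EuclideanSpace ℝ ι} (ha : 0 ≤ a)
    (h : ∀ i, c i = 0 ∨ a ≤ τ i) : a ^ 2 * ‖c‖ ^ 2 ≤ ‖op (Matrix.diagonal τ) c‖ ^ 2 := by
  rw [EuclideanSpace.norm_sq_eq, EuclideanSpace.norm_sq_eq, Finset.mul_sum]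
  refine Finset.sum_le_sum fun i _ => ?_
  change _ ≤ ‖(Matrix.diagonal τ *ᵥ c.ofLp) i‖ ^ 2
  rw [Matrix.mulVec_diagonal, norm_mul, mul_pow]
  rcases h i with h | h
  · simp [h]
  · gcongr
    exact h.trans (le_abs_self _)

/-- In the coordinates given by the columns, X is the diagonal matrix of τ. A vector orthogonal to
the chosen columns of W' may leave the range of W', but X kills that part, so contractivity of W'ᵀ
suffices. The abstract orthonormal pair lets one proof serve a matrix and its transpose. -/
theorem separates_of_decomp {W : Matrix m ι ℝ} {W' : Matrix n ι ℝ} {τ : ι → ℝ} {X : Matrix m n ℝ}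
    (hW : Wᵀ * W = 1) (hW' : W'ᵀ * W' = 1) (hX : X = W * Matrix.diagonal τ * W'ᵀ)
    (hτ : ∀ i, 0 ≤ τ i) {s : Set ι} {a b : ℝ} (ha : 0 ≤ a) (hb : 0 ≤ b) (hs : ∀ i ∈ s, a ≤ τ i)
    (hs' : ∀ i ∉ s, τ i ≤ b) : Separates (op X) (colSpan W' s) (colSpan W s) a b := by
  have hop : ∀ x, op X x = op W (op (Matrix.diagonal τ) (op W'ᵀ x)) := by
    intro x; rw [hX, op_mul, op_mul]
  have hd : ∀ (c : EuclideanSpace ℝ ι) i, op (Matrix.diagonal τ) c i = τ i * c i := by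
    intro c i
    change (Matrix.diagonal τ *ᵥ c.ofLp) i = _
    rw [Matrix.mulVec_diagonal]
  refine ⟨?_, ?_, ?_, ?_⟩
  · intro x hx
    obtain ⟨c, hc, rfl⟩ := exists_eq_op_of_mem_colSpan hx
    rw [hop, op_transpose_op_of_orthonormal hW']
    exact op_mem_colSpan _ fun i hi => by rw [hd, hc i hi, mul_zero]
  · intro x hx
    rw [mem_colSpan_orthogonal_iff] at hx ⊢
    intro i hi
    rw [hop, op_transpose_op_of_orthonormal hW, hd, hx i hi, mul_zero]
  · intro x hx
    obtain ⟨c, hc, rfl⟩ := exists_eq_op_of_mem_colSpan hx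
    rw [hop, op_transpose_op_of_orthonormal hW', norm_op_of_orthonormal hW',
      norm_op_of_orthonormal hW]
    refine (sq_le_sq₀ (by positivity) (norm_nonneg _)).1 ?_
    rw [mul_pow]
    refine le_norm_op_diagonal ha fun i => ?_
    by_cases hi : i ∈ s
    · exact Or.inr (hs i hi)
    · exact Or.inl (hc i hi)
  · intro x hx
    rw [mem_colSpan_orthogonal_iff] at hx
    rw [hop, norm_op_of_orthonormal hW]
    refine le_trans ?_ (mul_le_mul_of_nonneg_left (norm_op_transpose_le_of_orthonormal hW' x) hb)
    refine (sq_le_sq₀ (norm_nonneg _) (by positivity)).1 ?_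
    rw [mul_pow]
    refine norm_op_diagonal_le hτ fun i => ?_
    by_cases hi : i ∈ s
    · exact Or.inl (hx i hi)
    · exact Or.inr (hs' i hi)

end ColSpan

/-! ### Singular values and a Weyl inequality -/

section SingularValues

variable {m n p : ℕ}

theorem sv_nonneg (X : Matrix (Fin m) (Fin n) ℝ) (i : ℕ) : 0 ≤ sv X i :=
  LinearMap.singularValues_nonneg _ _

theorem sv_antitone (X : Matrix (Fin m) (Fin n) ℝ) : Antitone (sv X) := fun _ _ h =>
  LinearMap.singularValues_antitone _ (Nat.sub_le_sub_right h 1)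

/-- Applied to S A Gᵀ, this forces both sketches to have at least k rows, so that R is defined. -/
theorem le_min_of_sv_pos {X : Matrix (Fin m) (Fin n) ℝ} {k : ℕ} (h : 0 < sv X k) :
    k ≤ min m n := by
  have h1 := (LinearMap.singularValues_pos_iff_lt_finrank_range _).1 h
  have h2 := (LinearMap.range (Matrix.toEuclideanLin X)).finrank_le
  have h3 := LinearMap.finrank_range_le (Matrix.toEuclideanLin X)
  rw [finrank_euclideanSpace_fin] at h2 h3
  omega

namespace ThinSVD

variable {X : Matrix (Fin m) (Fin n) ℝ}

/-- The span of the first `k` right singular vectors. -/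
noncomputable def rightSpan (D : ThinSVD X) (k : ℕ) : Submodule ℝ (EuclideanSpace ℝ (Fin n)) :=
  colSpan D.V {i | (i : ℕ) < k}

/-- The span of the first `k` left singular vectors. -/
noncomputable def leftSpan (D : ThinSVD X) (k : ℕ) : Submodule ℝ (EuclideanSpace ℝ (Fin m)) :=
  colSpan D.U {i | (i : ℕ) < k}

/-- Column i, counted from 0, carries the singular value i + 1, so i < k is the same as i + 1 ≤ k.
For k = 0 the value `sv X 0` equals `sv X 1` by truncated subtraction, which is harmless because the
spans are trivial. -/
theorem separates (D : ThinSVD X) (k : ℕ) :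
    Separates (op X) (D.rightSpan k) (D.leftSpan k) (sv X k) (sv X (k + 1)) :=
  separates_of_decomp D.U_orthonormal D.V_orthonormal D.decomp (fun _ => sv_nonneg _ _)
    (sv_nonneg _ _) (sv_nonneg _ _) (fun _ hi => sv_antitone X hi)
    (fun _ hi => sv_antitone X (Nat.succ_le_succ (not_lt.1 hi)))

theorem separates_transpose (D : ThinSVD X) (k : ℕ) :
    Separates (op Xᵀ) (D.leftSpan k) (D.rightSpan k) (sv X k) (sv X (k + 1)) := by
  refine separates_of_decomp D.V_orthonormal D.U_orthonormal ?_ (fun _ => sv_nonneg _ _)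
    (sv_nonneg _ _) (sv_nonneg _ _) (fun _ hi => sv_antitone X hi)
    (fun _ hi => sv_antitone X (Nat.succ_le_succ (not_lt.1 hi)))
  conv_lhs => rw [D.decomp]
  simp only [Matrix.transpose_mul, Matrix.transpose_transpose, Matrix.diagonal_transpose,
    Matrix.mul_assoc]

theorem separates_gram (D : ThinSVD X) (k : ℕ) :
    Separates (op (Xᵀ * X)) (D.rightSpan k) (D.rightSpan k) (sv X k ^ 2) (sv X (k + 1) ^ 2) := by
  have h := (D.separates_transpose k).comp (D.separates k) (sv_nonneg _ _) (sv_nonneg _ _)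
  rw [← sq, ← sq] at h
  convert h using 1
  ext1 x; rw [op_mul]; rfl

theorem separates_gram_transpose (D : ThinSVD X) (k : ℕ) :
    Separates (op (X * Xᵀ)) (D.leftSpan k) (D.leftSpan k) (sv X k ^ 2) (sv X (k + 1) ^ 2) := by
  have h := (D.separates k).comp (D.separates_transpose k) (sv_nonneg _ _) (sv_nonneg _ _)
  rw [← sq, ← sq] at h
  convert h using 1
  ext1 x; rw [op_mul]; rfl

theorem finrank_rightSpan (D : ThinSVD X) (k : ℕ) :
    Module.finrank ℝ (D.rightSpan k) = min k (min m n) := by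
  have h := finrank_colSpan D.V_orthonormal (Finset.univ.filter fun i => (i : ℕ) < k)
  rw [Finset.coe_filter_univ] at h
  rw [rightSpan, h, Fin.card_filter_val_lt, min_comm]

theorem finrank_leftSpan (D : ThinSVD X) (k : ℕ) :
    Module.finrank ℝ (D.leftSpan k) = min k (min m n) := by
  have h := finrank_colSpan D.U_orthonormal (Finset.univ.filter fun i => (i : ℕ) < k)
  rw [Finset.coe_filter_univ] at h
  rw [leftSpan, h, Fin.card_filter_val_lt, min_comm]

end ThinSVD

theorem norm_transpose (X : Matrix (Fin m) (Fin n) ℝ) : ‖Xᵀ‖ = ‖X‖ := by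
  rw [← Matrix.conjTranspose_eq_transpose_of_trivial, Matrix.l2_opNorm_conjTranspose]

theorem sv_one (X : Matrix (Fin m) (Fin n) ℝ) : sv X 1 = ‖X‖ := by
  obtain ⟨D⟩ := nonempty_thinSVD X
  apply le_antisymm
  · by_contra! h
    have hk := le_min_of_sv_pos ((norm_nonneg _).trans_lt h)
    have h1 : D.rightSpan 1 ≠ ⊥ := by
      intro h0
      have := D.finrank_rightSpan 1
      rw [h0, finrank_bot] at this
      omega
    obtain ⟨x, hx, hx0⟩ := Submodule.exists_mem_ne_zero_of_ne_bot h1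
    have h2 := (D.separates 1).lower x hx
    have h3 := norm_op_le X x
    nlinarith [norm_pos_iff.2 hx0]
  -- The span of the first 0 columns is trivial, so the upper bound for its complement holds for
  -- every vector.
  · refine opNorm_le_of_forall X (sv_nonneg _ _) fun x => (D.separates 0).upper x ?_
    rw [ThinSVD.rightSpan, mem_colSpan_orthogonal_iff]
    intro i hi
    exact absurd hi (Nat.not_lt_zero _)

/-- Only Gram matrices are compared: ‖Xx‖² - ‖Yx‖² is the quadratic form of XᵀX - YᵀY, so X and Y
may have different numbers of rows. -/
theorem sv_sq_le_add_of_row {q : ℕ} (X : Matrix (Fin m) (Fin n) ℝ) (Y : Matrix (Fin q) (Fin n) ℝ)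
    {k : ℕ} (hk : 1 ≤ k) : sv X k ^ 2 ≤ sv Y k ^ 2 + ‖Yᵀ * Y - Xᵀ * X‖ := by
  rcases (sv_nonneg X k).eq_or_lt with h0 | hpos
  · rw [← h0, zero_pow two_ne_zero]; positivity
  have hk' := le_min_of_sv_pos hpos
  obtain ⟨D⟩ := nonempty_thinSVD X
  obtain ⟨D'⟩ := nonempty_thinSVD Y
  obtain ⟨j, rfl⟩ := Nat.exists_eq_add_of_le' hk
  -- With k = j + 1, X is at least `sv X k` on a space of dimension k, and Y is at most `sv Y k` off
  -- a space of dimension at most k - 1.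
  refine (D.separates (j + 1)).sq_le_sq_add (D'.separates j) (sv_nonneg _ _) ?_ fun x => ?_
  · rw [D.finrank_rightSpan, D'.finrank_rightSpan]; omega
  · rw [norm_op_sq X, norm_op_sq Y]
    have h1 : inner ℝ x (op (Yᵀ * Y - Xᵀ * X) x) =
        inner ℝ x (op (Yᵀ * Y) x) - inner ℝ x (op (Xᵀ * X) x) := by
      rw [op, map_sub, LinearMap.sub_apply, inner_sub_right]
    have h2 := (abs_le.1 (abs_real_inner_le_norm x (op (Yᵀ * Y - Xᵀ * X) x))).1
    have h3 := mul_le_mul_of_nonneg_left (norm_op_le (Yᵀ * Y - Xᵀ * X) x) (norm_nonneg x)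
    nlinarith

theorem sv_sq_le_add_of_col {q : ℕ} (X : Matrix (Fin n) (Fin m) ℝ) (Y : Matrix (Fin n) (Fin q) ℝ)
    {k : ℕ} (hk : 1 ≤ k) : sv X k ^ 2 ≤ sv Y k ^ 2 + ‖Y * Yᵀ - X * Xᵀ‖ := by
  rcases (sv_nonneg X k).eq_or_lt with h0 | hpos
  · rw [← h0, zero_pow two_ne_zero]; positivity
  have hk' := le_min_of_sv_pos hpos
  obtain ⟨D⟩ := nonempty_thinSVD X
  obtain ⟨D'⟩ := nonempty_thinSVD Y
  obtain ⟨j, rfl⟩ := Nat.exists_eq_add_of_le' hk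
  refine (D.separates_transpose (j + 1)).sq_le_sq_add (D'.separates_transpose j) (sv_nonneg _ _)
    ?_ fun x => ?_
  · rw [D.finrank_leftSpan, D'.finrank_leftSpan]; omega
  · rw [norm_op_sq Xᵀ, norm_op_sq Yᵀ, Matrix.transpose_transpose, Matrix.transpose_transpose]
    have h1 : inner ℝ x (op (Y * Yᵀ - X * Xᵀ) x) =
        inner ℝ x (op (Y * Yᵀ) x) - inner ℝ x (op (X * Xᵀ) x) := by
      rw [op, map_sub, LinearMap.sub_apply, inner_sub_right]
    have h2 := (abs_le.1 (abs_real_inner_le_norm x (op (Y * Yᵀ - X * Xᵀ) x))).1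
    have h3 := mul_le_mul_of_nonneg_left (norm_op_le (Y * Yᵀ - X * Xᵀ) x) (norm_nonneg x)
    nlinarith

end SingularValues

/-! ### From Gram error to closeness of singular subspaces -/

section Deterministic

variable {m n q k : ℕ}

/-- Turns the relative thresholds ε‖X‖² into multiples of the absolute gap. For X = 0 both sides
vanish. -/
theorem gap_mul_norm_sq (X : Matrix (Fin m) (Fin n) ℝ) (hk : 1 ≤ k) :
    gap X k * ‖X‖ ^ 2 = sv X k ^ 2 - sv X (k + 1) ^ 2 := by
  rw [gap, sv_one]
  rcases eq_or_ne ‖X‖ 0 with h | h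
  · have h1 : ∀ i, 1 ≤ i → sv X i = 0 := fun i hi =>
      le_antisymm (((sv_antitone X hi).trans_eq (sv_one X)).trans_eq h) (sv_nonneg _ _)
    rw [h1 k hk, h1 (k + 1) (by omega)]; simp
  · field_simp

theorem sv_sq_sub_nonneg (X : Matrix (Fin m) (Fin n) ℝ) (k : ℕ) :
    0 ≤ sv X k ^ 2 - sv X (k + 1) ^ 2 :=
  sub_nonneg.2 (pow_le_pow_left₀ (sv_nonneg _ _) (sv_antitone X k.le_succ) 2)

theorem gap_nonneg (X : Matrix (Fin m) (Fin n) ℝ) (k : ℕ) : 0 ≤ gap X k :=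
  div_nonneg (sv_sq_sub_nonneg X k) (sq_nonneg _)

theorem gap_le_one (X : Matrix (Fin m) (Fin n) ℝ) (hk : 1 ≤ k) : gap X k ≤ 1 := by
  refine div_le_one_of_le₀ ?_ (sq_nonneg _)
  have := pow_le_pow_left₀ (sv_nonneg _ _) (sv_antitone X hk) 2
  nlinarith [sq_nonneg (sv X (k + 1))]

theorem gap_pos_iff (X : Matrix (Fin m) (Fin n) ℝ) (hk : 1 ≤ k) :
    0 < gap X k ↔ 0 < sv X k ^ 2 - sv X (k + 1) ^ 2 := by
  constructor
  · intro h
    rw [← gap_mul_norm_sq X hk]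
    refine mul_pos h (pow_pos ((norm_nonneg _).lt_of_ne fun h0 => h.ne' ?_) 2)
    rw [gap, sv_one, ← h0]; simp
  · intro h
    rw [← gap_mul_norm_sq X hk] at h
    exact pos_of_mul_pos_left h (sq_nonneg _)

/-- This is the source of the factor a / (1 + a). A perturbation of size e may shrink the gap g to g
- e, and Davis-Kahan then bounds the sine by e / (g - e), which is at most a exactly when e ≤ a / (1
+ a) · g. -/
theorem div_one_add_mul_div_le {a g e c : ℝ} (ha : 0 ≤ a) (hg : 0 < g)
    (he : e ≤ a / (1 + a) * g) (hc : g - e ≤ c) : 0 < c ∧ e / c ≤ a := by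
  have h1 : g / (1 + a) = g - a / (1 + a) * g := by field_simp; ring
  have h2 : 0 < g / (1 + a) := by positivity
  have hc' : g / (1 + a) ≤ c := by linarith
  have hc0 : 0 < c := by linarith
  refine ⟨hc0, ?_⟩
  rw [div_le_iff₀ hc0]
  calc e ≤ a / (1 + a) * g := he
    _ = a * (g / (1 + a)) := by ring
    _ ≤ a * c := by gcongr

/-- Davis-Kahan for XᵀX and YᵀY with the mixed gap σ_k(Y)² - σ_{k+1}(X)². Only σ_k(Y) has to be
compared with X, so the error is subtracted from the gap once. -/
theorem rightSpan_perturbation {X : Matrix (Fin m) (Fin n) ℝ} {Y : Matrix (Fin q) (Fin n) ℝ}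
    (hk : 1 ≤ k) {a : ℝ} (ha : 0 ≤ a) (hg : 0 < sv X k ^ 2 - sv X (k + 1) ^ 2)
    (h : ‖Yᵀ * Y - Xᵀ * X‖ ≤ a / (1 + a) * (sv X k ^ 2 - sv X (k + 1) ^ 2))
    (D : ThinSVD X) (D' : ThinSVD Y) :
    0 < sv Y k ∧ ∀ x ∈ D'.rightSpan k, ‖(D.rightSpan k)ᗮ.starProjection x‖ ≤ a * ‖x‖ := by
  have hw := sv_sq_le_add_of_row X Y hk
  obtain ⟨h1, h2⟩ := div_one_add_mul_div_le (c := sv Y k ^ 2 - sv X (k + 1) ^ 2) ha hg h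
    (by linarith)
  refine ⟨?_, fun x hx => ?_⟩
  · refine (sv_nonneg _ _).lt_of_ne fun h0 => ?_
    rw [← h0] at h1
    nlinarith [sq_nonneg (sv X (k + 1))]
  · refine ((D.separates_gram k).norm_starProjection_orthogonal_le (D'.separates_gram k)
      (sq_nonneg _) (by linarith) (norm_nonneg (Yᵀ * Y - Xᵀ * X)) (fun y => ?_) hx).trans ?_
    · rw [← LinearMap.sub_apply, ← map_sub]
      exact norm_op_le _ _
    · gcongr

theorem leftSpan_perturbation {X : Matrix (Fin n) (Fin m) ℝ} {Y : Matrix (Fin n) (Fin q) ℝ}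
    (hk : 1 ≤ k) {a : ℝ} (ha : 0 ≤ a) (ha1 : a < 1) (hg : 0 < sv X k ^ 2 - sv X (k + 1) ^ 2)
    (h : ‖Y * Yᵀ - X * Xᵀ‖ ≤ a / (1 + a) * (sv X k ^ 2 - sv X (k + 1) ^ 2))
    (D : ThinSVD X) (D' : ThinSVD Y) :
    0 < sv Y k ^ 2 - sv Y (k + 1) ^ 2 ∧
      ∀ x ∈ D'.leftSpan k, ‖(D.leftSpan k)ᗮ.starProjection x‖ ≤ a * ‖x‖ := by
  have hw := sv_sq_le_add_of_col X Y hk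
  have hw' := sv_sq_le_add_of_col Y X (k := k + 1) (by omega)
  rw [norm_sub_rev] at hw'
  obtain ⟨h1, h2⟩ := div_one_add_mul_div_le (c := sv Y k ^ 2 - sv X (k + 1) ^ 2) ha hg h
    (by linarith)
  refine ⟨?_, fun x hx => ?_⟩
  -- The gap of Y itself loses the error twice, at σ_k and at σ_{k+1}. Since a < 1, each loss is
  -- below half the gap.
  · have h3 : a / (1 + a) < 1 / 2 := by
      rw [div_lt_div_iff₀ (by linarith) two_pos]; linarith
    have h4 := mul_lt_mul_of_pos_right h3 hg
    linarith
  · refine ((D.separates_gram_transpose k).norm_starProjection_orthogonal_le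
      (D'.separates_gram_transpose k) (sq_nonneg _) (by linarith)
      (norm_nonneg (Y * Yᵀ - X * Xᵀ)) (fun y => ?_) hx).trans ?_
    · rw [← LinearMap.sub_apply, ← map_sub]
      exact norm_op_le _ _
    · gcongr

/-- A subspace close to the leading right singular space of `B` is mapped by `B` to a subspace
close to the leading left singular space. -/
theorem map_perturbation {B : Matrix (Fin n) (Fin m) ℝ} (D : ThinSVD B) (hB : 0 < sv B k)
    {V : Submodule ℝ (EuclideanSpace ℝ (Fin m))} {U : Submodule ℝ (EuclideanSpace ℝ (Fin n))}
    {a c : ℝ} (hc : 0 ≤ c) (hac : a ^ 2 * (1 + c ^ 2) ≤ c ^ 2)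
    (hV : ∀ z ∈ V, ‖(D.rightSpan k)ᗮ.starProjection z‖ ≤ a * ‖z‖)
    (hU : ∀ x ∈ D.leftSpan k, ‖Uᗮ.starProjection x‖ ≤ c * ‖x‖) :
    Module.finrank ℝ (V.map (op B)) = Module.finrank ℝ V ∧
      ∀ w ∈ V.map (op B), ‖Uᗮ.starProjection w‖ ≤ 2 * c * ‖w‖ := by
  -- The relation between a and c converts the sine bound a into the tangent bound c.
  have key : ∀ z ∈ V, ∃ z₁ ∈ D.rightSpan k, ∃ z₂ ∈ (D.rightSpan k)ᗮ, z = z₁ + z₂ ∧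
      ‖z₂‖ ≤ c * ‖z₁‖ := by
    intro z hz
    refine ⟨_, (D.rightSpan k).starProjection_apply_mem z, _,
      (D.rightSpan k)ᗮ.starProjection_apply_mem z,
      ((D.rightSpan k).starProjection_add_starProjection_orthogonal z).symm, ?_⟩
    have h1 := Submodule.norm_sq_eq_add_norm_sq_starProjection z (D.rightSpan k)
    have h2 := pow_le_pow_left₀ (norm_nonneg _) (hV z hz) 2
    refine (sq_le_sq₀ (norm_nonneg _) (by positivity)).1 ?_
    rw [mul_pow] at h2 ⊢
    have h3 := mul_le_mul_of_nonneg_right hac (sq_nonneg ‖z‖)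
    nlinarith [mul_le_mul_of_nonneg_left h2 (by positivity : 0 ≤ 1 + c ^ 2)]
  have hle : ∀ z₁ ∈ D.rightSpan k, ∀ z₂ ∈ (D.rightSpan k)ᗮ, ‖op B z₁‖ ≤ ‖op B (z₁ + z₂)‖ := by
    intro z₁ h₁ z₂ h₂
    have h := norm_add_sq_eq_norm_sq_add_norm_sq_of_inner_eq_zero (op B z₁) (op B z₂)
      (((D.leftSpan k).mem_orthogonal _).1 ((D.separates k).map_mem_orthogonal _ h₂) _
        ((D.separates k).map_mem _ h₁))
    rw [map_add]
    refine (sq_le_sq₀ (norm_nonneg _) (norm_nonneg _)).1 ?_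
    nlinarith [mul_self_nonneg ‖op B z₂‖]
  constructor
  · have hinj : Function.Injective ((op B).domRestrict V) := by
      rw [← LinearMap.ker_eq_bot, LinearMap.ker_eq_bot']
      rintro ⟨z, hz⟩ h0
      obtain ⟨z₁, h₁, z₂, h₂, rfl, hzz⟩ := key z hz
      have h3 := hle z₁ h₁ z₂ h₂
      have h0' : op B (z₁ + z₂) = 0 := h0
      rw [h0', norm_zero] at h3
      have h4 := (D.separates k).lower z₁ h₁
      have h5 : ‖z₁‖ ≤ 0 := by
        by_contra! hlt
        nlinarith [mul_pos hB hlt]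
      have h6 : z₁ = 0 := norm_le_zero_iff.1 h5
      rw [h6, norm_zero, mul_zero] at hzz
      exact Subtype.ext (by simp [h6, norm_le_zero_iff.1 hzz])
    rw [← LinearMap.finrank_range_of_inj hinj, LinearMap.range_domRestrict]
  · rintro w ⟨z, hz, rfl⟩
    obtain ⟨z₁, h₁, z₂, h₂, rfl, hzz⟩ := key z hz
    -- B stretches z₁ by at least σ_k and z₂ by at most σ_{k+1} ≤ σ_k, so the tangent does not grow.
    -- The final 2c is this c plus the c between the left singular space and U.
    have h3 : ‖op B z₂‖ ≤ c * ‖op B z₁‖ := by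
      calc ‖op B z₂‖ ≤ sv B (k + 1) * ‖z₂‖ := (D.separates k).upper _ h₂
        _ ≤ sv B k * (c * ‖z₁‖) := by
          gcongr
          exact sv_antitone B k.le_succ
        _ = c * (sv B k * ‖z₁‖) := by ring
        _ ≤ _ := by gcongr; exact (D.separates k).lower _ h₁
    calc ‖Uᗮ.starProjection (op B (z₁ + z₂))‖
        = ‖Uᗮ.starProjection (op B z₁) + Uᗮ.starProjection (op B z₂)‖ := by
          rw [map_add, map_add]
      _ ≤ ‖Uᗮ.starProjection (op B z₁)‖ + ‖Uᗮ.starProjection (op B z₂)‖ := norm_add_le _ _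
      _ ≤ c * ‖op B z₁‖ + c * ‖op B z₁‖ :=
          add_le_add (hU _ ((D.separates k).map_mem _ h₁))
            ((Uᗮ.norm_starProjection_apply_le _).trans h3)
      _ = 2 * c * ‖op B z₁‖ := by ring
      _ ≤ _ := by gcongr; exact hle z₁ h₁ z₂ h₂

/-- The left-space perturbation with a = ν / 2, since `eps2` is (ν / 2) / (1 + ν / 2) times the gap.
Positivity of the new gap is what activates the hypothesis on the second sketch. -/
theorem gap_mul_transpose_pos {d t : ℕ} {A : Matrix (Fin n) (Fin d) ℝ}
    {G : Matrix (Fin t) (Fin d) ℝ} (hk : 1 ≤ k) (hgap : sv A (k + 1) < sv A k) {ν : ℝ}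
    (hν : ν ∈ Set.Ioo (0 : ℝ) (1 / 2)) (DA : ThinSVD A) (D : ThinSVD (A * Gᵀ))
    (h : ‖Aᵀᵀ * Gᵀ * G * Aᵀ - Aᵀᵀ * Aᵀ‖ < eps2 A k ν * ‖Aᵀ‖ ^ 2) :
    0 < gap (A * Gᵀ) k ∧
      ∀ x ∈ D.leftSpan k, ‖(DA.leftSpan k)ᗮ.starProjection x‖ ≤ ν / 2 * ‖x‖ := by
  obtain ⟨hν0, hν1⟩ := hν
  have hg : 0 < sv A k ^ 2 - sv A (k + 1) ^ 2 :=
    sub_pos.2 (pow_lt_pow_left₀ hgap (sv_nonneg _ _) two_ne_zero)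
  have h' : ‖A * Gᵀ * (A * Gᵀ)ᵀ - A * Aᵀ‖ ≤
      ν / 2 / (1 + ν / 2) * (sv A k ^ 2 - sv A (k + 1) ^ 2) := by
    rw [norm_transpose, eps2, mul_assoc, gap_mul_norm_sq A hk, ← div_div,
      Matrix.transpose_transpose] at h
    rw [Matrix.transpose_mul, Matrix.transpose_transpose, ← Matrix.mul_assoc]
    exact h.le
  rw [gap_pos_iff _ hk]
  exact leftSpan_perturbation hk (by linarith) (by linarith) hg h' DA D

/-- The range of `A R` is close to the leading left singular space of `A`. -/
theorem map_rightSpan_close {d t s : ℕ} {A : Matrix (Fin n) (Fin d) ℝ}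
    {G : Matrix (Fin t) (Fin d) ℝ} {S : Matrix (Fin s) (Fin n) ℝ} (hk : 1 ≤ k)
    (hgap : sv A (k + 1) < sv A k) {ν : ℝ} (hν : ν ∈ Set.Ioo (0 : ℝ) (1 / 2))
    (DA : ThinSVD A) (D : ThinSVD (S * A * Gᵀ))
    (h2 : ‖Aᵀᵀ * Gᵀ * G * Aᵀ - Aᵀᵀ * Aᵀ‖ < eps2 A k ν * ‖Aᵀ‖ ^ 2)
    (h1 : ‖(A * Gᵀ)ᵀ * Sᵀ * S * (A * Gᵀ) - (A * Gᵀ)ᵀ * (A * Gᵀ)‖ <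
      eps1 (A * Gᵀ) k ν * ‖A * Gᵀ‖ ^ 2) :
    k ≤ min s t ∧ Module.finrank ℝ ((D.rightSpan k).map (op (A * Gᵀ))) = k ∧
      ∀ w ∈ (D.rightSpan k).map (op (A * Gᵀ)),
        ‖(DA.leftSpan k)ᗮ.starProjection w‖ ≤ ν * ‖w‖ := by
  obtain ⟨DB⟩ := nonempty_thinSVD (A * Gᵀ)
  obtain ⟨hBgap, hBU⟩ := gap_mul_transpose_pos hk hgap hν DA DB h2
  obtain ⟨hν0, hν1⟩ := hν
  rw [gap_pos_iff _ hk] at hBgap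
  set a := ν * (√(1 + ν ^ 2 / 4))⁻¹ / 2 with ha
  have ha0 : 0 ≤ a := by positivity
  -- The constant in `eps1` is chosen so that a is the sine of the angle whose tangent is ν / 2.
  have ha2 : a ^ 2 * (1 + (ν / 2) ^ 2) = (ν / 2) ^ 2 := by
    have h3 : √(1 + ν ^ 2 / 4) ^ 2 = 1 + ν ^ 2 / 4 := Real.sq_sqrt (by positivity)
    have h4 : 0 < √(1 + ν ^ 2 / 4) := Real.sqrt_pos.2 (by positivity)
    have h5 : (1 + (ν / 2) ^ 2) = √(1 + ν ^ 2 / 4) ^ 2 := by rw [h3]; ring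
    rw [h5, ha]
    field_simp
  have h1' : ‖(S * A * Gᵀ)ᵀ * (S * A * Gᵀ) - (A * Gᵀ)ᵀ * (A * Gᵀ)‖ ≤
      a / (1 + a) * (sv (A * Gᵀ) k ^ 2 - sv (A * Gᵀ) (k + 1) ^ 2) := by
    rw [eps1, mul_assoc, gap_mul_norm_sq _ hk] at h1
    rw [Matrix.mul_assoc S A, Matrix.transpose_mul S, ← Matrix.mul_assoc]
    exact h1.le
  obtain ⟨hC, hCV⟩ := rightSpan_perturbation hk ha0 hBgap h1' DB D
  have hB : 0 < sv (A * Gᵀ) k := by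
    refine (sv_nonneg _ _).lt_of_ne fun h0 => ?_
    rw [← h0] at hBgap
    nlinarith [sq_nonneg (sv (A * Gᵀ) (k + 1))]
  have hst := le_min_of_sv_pos hC
  obtain ⟨h3, h4⟩ := map_perturbation DB hB (by positivity : 0 ≤ ν / 2) ha2.le hCV hBU
  refine ⟨hst, ?_, fun w hw => (h4 w hw).trans_eq (by ring)⟩
  rw [h3, D.finrank_rightSpan, min_eq_left hst]

end Deterministic

/-! ### Fitted vectors as orthogonal projections -/

section Projections

theorem eq_starProjection_of_norm_sub_le {E : Type*} [NormedAddCommGroup E]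
    [InnerProductSpace ℝ E] [FiniteDimensional ℝ E] {U : Submodule ℝ E} {u b : E} (hu : u ∈ U)
    (h : ‖u - b‖ ≤ ‖U.starProjection b - b‖) : u = U.starProjection b := by
  have h1 : inner ℝ (u - U.starProjection b) (U.starProjection b - b) = 0 := by
    rw [← neg_sub b, inner_neg_right, neg_eq_zero]
    exact (U.mem_orthogonal _).1 (U.sub_starProjection_mem_orthogonal b) _
      (U.sub_mem hu (U.starProjection_apply_mem b))
  have h2 := norm_add_sq_eq_norm_sq_add_norm_sq_of_inner_eq_zero _ _ h1
  rw [sub_add_sub_cancel] at h2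
  have h3 : ‖u - U.starProjection b‖ = 0 := by
    nlinarith [norm_nonneg (u - b), norm_nonneg (u - U.starProjection b)]
  exact sub_eq_zero.1 (norm_eq_zero.1 h3)

theorem eq_starProjection_range_of_forall_norm_sub_le {E F : Type*} [AddCommGroup E] [Module ℝ E]
    [NormedAddCommGroup F] [InnerProductSpace ℝ F] [FiniteDimensional ℝ F] {T : E →ₗ[ℝ] F} {x : E}
    {b : F} (h : ∀ y, ‖T x - b‖ ≤ ‖T y - b‖) :
    T x = (LinearMap.range T).starProjection b := by
  obtain ⟨y, hy⟩ := (LinearMap.range T).starProjection_apply_mem b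
  exact eq_starProjection_of_norm_sub_le ⟨x, rfl⟩ (hy ▸ h y)

theorem trace_starProjection {E : Type*} [NormedAddCommGroup E] [InnerProductSpace ℝ E]
    [FiniteDimensional ℝ E] (U : Submodule ℝ E) :
    LinearMap.trace ℝ E U.starProjection.toLinearMap = Module.finrank ℝ U :=
  LinearMap.IsProj.trace
    ⟨U.starProjection_apply_mem, fun _ hx => Submodule.starProjection_eq_self_iff.2 hx⟩

theorem range_op_eq_colSpan {ι m : Type*} [Fintype ι] [Fintype m] [DecidableEq ι] [DecidableEq m]
    (W : Matrix m ι ℝ) : LinearMap.range (op W) = colSpan W Set.univ := by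
  ext x
  constructor
  · rintro ⟨c, rfl⟩
    exact op_mem_colSpan W fun i hi => absurd (Set.mem_univ i) hi
  · intro hx
    obtain ⟨c, -, rfl⟩ := exists_eq_op_of_mem_colSpan hx
    exact ⟨c, rfl⟩

namespace ThinSVD

variable {m n k : ℕ} {X : Matrix (Fin m) (Fin n) ℝ}

theorem Vk_orthonormal (D : ThinSVD X) (hk : k ≤ min m n) : (D.Vk hk)ᵀ * D.Vk hk = 1 := by
  have h : (D.Vk hk)ᵀ * D.Vk hk = (D.Vᵀ * D.V).submatrix (Fin.castLE hk) (Fin.castLE hk) := by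
    ext i j; rfl
  rw [h, D.V_orthonormal, Matrix.submatrix_one _ (Fin.castLE_injective hk)]

theorem Ukplus_orthonormal (D : ThinSVD X) (k : ℕ) : (D.Ukplus k)ᵀ * D.Ukplus k = 1 := by
  have h : (D.Ukplus k)ᵀ * D.Ukplus k = (D.Uᵀ * D.U).submatrix Subtype.val Subtype.val := by
    ext i j; rfl
  rw [h, D.U_orthonormal, Matrix.submatrix_one _ Subtype.val_injective]

theorem range_op_Vk (D : ThinSVD X) (hk : k ≤ min m n) :
    LinearMap.range (op (D.Vk hk)) = D.rightSpan k := by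
  rw [range_op_eq_colSpan, colSpan, rightSpan, colSpan]
  have hcol : ∀ i : Fin k, op (D.Vk hk) (EuclideanSpace.single i 1) =
      op D.V (EuclideanSpace.single (Fin.castLE hk i) 1) := by
    intro i
    ext a
    simp [op, Vk]
  congr 1
  ext x
  constructor
  · rintro ⟨i, -, rfl⟩
    exact ⟨Fin.castLE hk i, i.2, (hcol i).symm⟩
  · rintro ⟨i, hi, rfl⟩
    exact ⟨⟨i, hi⟩, Set.mem_univ _, hcol ⟨i, hi⟩⟩

/-- The part of y in the left span is orthogonal to the later columns. Equality can fail, since the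
columns of a thin U need not span the whole space. -/
theorem norm_op_Ukplus_transpose_le (D : ThinSVD X) (k : ℕ) (y : EuclideanSpace ℝ (Fin m)) :
    ‖op (D.Ukplus k)ᵀ y‖ ≤ ‖(D.leftSpan k)ᗮ.starProjection y‖ := by
  have h : op (D.Ukplus k)ᵀ y = op (D.Ukplus k)ᵀ ((D.leftSpan k)ᗮ.starProjection y) := by
    rw [← sub_eq_zero, ← map_sub, Submodule.starProjection_orthogonal_val, sub_sub_cancel]
    obtain ⟨c, hc, hy⟩ := exists_eq_op_of_mem_colSpan ((D.leftSpan k).starProjection_apply_mem y)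
    ext i
    change op D.Uᵀ ((D.leftSpan k).starProjection y) i.1 = 0
    rw [hy, op_transpose_op_of_orthonormal D.U_orthonormal]
    exact hc _ (not_lt.2 i.2)
  rw [h]
  exact norm_op_transpose_le_of_orthonormal (D.Ukplus_orthonormal k) _

/-- Inclusion plus a dimension count. That X preserves the dimension is the case a = c = 0 of
`map_perturbation`. -/
theorem map_rightSpan (D : ThinSVD X) (hX : 0 < sv X k) :
    (D.rightSpan k).map (op X) = D.leftSpan k := by
  refine Submodule.eq_of_le_of_finrank_eq ?_ ?_
  · rintro _ ⟨x, hx, rfl⟩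
    exact (D.separates k).map_mem x hx
  · have h : ∀ x ∈ D.leftSpan k, ‖(D.leftSpan k)ᗮ.starProjection x‖ ≤ 0 * ‖x‖ := fun x hx => by
      rw [Submodule.starProjection_orthogonal_val, Submodule.starProjection_eq_self_iff.2 hx,
        sub_self, norm_zero, zero_mul]
    have h' : ∀ x ∈ D.rightSpan k, ‖(D.rightSpan k)ᗮ.starProjection x‖ ≤ 0 * ‖x‖ := fun x hx => by
      rw [Submodule.starProjection_orthogonal_val, Submodule.starProjection_eq_self_iff.2 hx,
        sub_self, norm_zero, zero_mul]
    rw [(map_perturbation D hX le_rfl (by norm_num) h' h).1, D.finrank_rightSpan,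
      D.finrank_leftSpan]

/-- `X X⁺` is the orthogonal projection onto the range of `X`. -/
theorem op_mul_pinv (D : ThinSVD X) {U : Submodule ℝ (EuclideanSpace ℝ (Fin m))}
    (hU : LinearMap.range (op X) = U) (b : EuclideanSpace ℝ (Fin m)) :
    op (X * D.pinv) b = U.starProjection b := by
  subst hU
  have hmem : op (X * D.pinv) b ∈ LinearMap.range (op X) := by
    rw [op_mul]; exact LinearMap.mem_range_self _ _
  refine (Submodule.eq_starProjection_of_mem_of_inner_eq_zero hmem ?_).symm
  rintro _ ⟨x, rfl⟩
  have hXt : Xᵀ = D.V * Matrix.diagonal (fun i : Fin (min m n) => sv X ((i : ℕ) + 1)) * D.Uᵀ := by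
    conv_lhs => rw [D.decomp]
    simp only [Matrix.transpose_mul, Matrix.transpose_transpose, Matrix.diagonal_transpose,
      Matrix.mul_assoc]
  -- This gives Xᵀ X X⁺ = Xᵀ, which says that X X⁺ b - b is orthogonal to the range of X. The
  -- diagonal is kept abstract because the singular values themselves mention X.
  have hgen : ∀ τ : Fin (min m n) → ℝ, D.V * Matrix.diagonal τ * D.Uᵀ *
      (D.U * Matrix.diagonal τ * D.Vᵀ * (D.V * Matrix.diagonal (fun i => (τ i)⁻¹) * D.Uᵀ)) =
      D.V * Matrix.diagonal τ * D.Uᵀ := by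
    intro τ
    have hτ : Matrix.diagonal τ * (Matrix.diagonal τ * Matrix.diagonal fun i => (τ i)⁻¹) =
        Matrix.diagonal τ := by
      rw [Matrix.diagonal_mul_diagonal, Matrix.diagonal_mul_diagonal]
      congr 1
      ext i
      by_cases h : τ i = 0
      · rw [h, zero_mul]
      · field_simp
    calc _ = D.V * (Matrix.diagonal τ * ((D.Uᵀ * D.U) * (Matrix.diagonal τ *
          ((D.Vᵀ * D.V) * Matrix.diagonal fun i => (τ i)⁻¹)))) * D.Uᵀ := by
          simp only [Matrix.mul_assoc]
      _ = _ := by rw [D.U_orthonormal, D.V_orthonormal, Matrix.one_mul, Matrix.one_mul, hτ]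
  have hXX : Xᵀ * (X * D.pinv) = Xᵀ := by
    have h := hgen fun i => sv X ((i : ℕ) + 1)
    rwa [← D.decomp, ← hXt] at h
  rw [real_inner_comm, inner_op, map_sub, ← op_mul, hXX, sub_self, inner_zero_right]

end ThinSVD

variable {n d t k : ℕ}

/-- All d right singular vectors are kept, so `D.Vk hk` is square and hence orthogonal. With B = AR
this reduces x_{R,k} to least squares over the whole range of R. -/
theorem range_op_mul_Vk {B : Matrix (Fin n) (Fin d) ℝ} (D : ThinSVD B) (hk : d ≤ min n d) :
    LinearMap.range (op (B * D.Vk hk)) = LinearMap.range (op B) := by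
  have hV : D.Vk hk * (D.Vk hk)ᵀ = 1 := mul_eq_one_comm.1 (D.Vk_orthonormal hk)
  ext x
  constructor
  · rintro ⟨c, rfl⟩
    exact ⟨op (D.Vk hk) c, (op_mul _ _ _).symm⟩
  · rintro ⟨c, rfl⟩
    refine ⟨op (D.Vk hk)ᵀ c, ?_⟩
    rw [← op_mul, Matrix.mul_assoc, hV, Matrix.mul_one]

theorem op_solutionMatrix {A : Matrix (Fin n) (Fin d) ℝ} {R : Matrix (Fin d) (Fin k) ℝ}
    (hk : k ≤ min n k) (DAR : ThinSVD (A * R)) (DARV : ThinSVD (A * R * DAR.Vk hk))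
    {U : Submodule ℝ (EuclideanSpace ℝ (Fin n))} (hU : LinearMap.range (op (A * R)) = U)
    (b : Fin n → ℝ) :
    WithLp.toLp 2 (A *ᵥ (solutionMatrix A R hk DAR DARV *ᵥ b)) =
      U.starProjection (WithLp.toLp 2 b) := by
  rw [← DARV.op_mul_pinv ((range_op_mul_Vk DAR hk).trans hU), Matrix.mulVec_mulVec, solutionMatrix]
  simp only [← Matrix.mul_assoc]
  rfl

theorem IsPCRSolution.op_eq {A : Matrix (Fin n) (Fin d) ℝ} {D : ThinSVD A} {hk : k ≤ min n d}
    {b : Fin n → ℝ} {x : Fin d → ℝ} (h : IsPCRSolution A D hk b x) (hA : 0 < sv A k) :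
    WithLp.toLp 2 (A *ᵥ x) = (D.leftSpan k).starProjection (WithLp.toLp 2 b) := by
  obtain ⟨⟨c, hc⟩, hmin⟩ := h
  have hx : WithLp.toLp 2 x ∈ D.rightSpan k := by
    rw [← D.range_op_Vk hk]
    exact ⟨WithLp.toLp 2 c, congrArg (WithLp.toLp 2) hc⟩
  refine eq_starProjection_of_norm_sub_le ((D.separates k).map_mem _ hx) ?_
  have h1 := (D.leftSpan k).starProjection_apply_mem (WithLp.toLp 2 b)
  generalize (D.leftSpan k).starProjection (WithLp.toLp 2 b) = p at h1 ⊢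
  rw [← D.map_rightSpan hA, ← D.range_op_Vk hk] at h1
  obtain ⟨_, ⟨c', rfl⟩, rfl⟩ := h1
  exact hmin _ ⟨c'.ofLp, rfl⟩

end Projections

/-! ### Bias and variance under the noise model -/

section Noise

variable {n d : ℕ} {Ω : Type*} [MeasurableSpace Ω] {P : Measure Ω} {ξ : Fin n → Ω → ℝ}
  {σ : ℝ}

theorem IsNoise.integrable_mul (h : IsNoise P ξ σ) (i j : Fin n) :
    Integrable (fun ω => ξ i ω * ξ j ω) P :=
  (h.memLp i).integrable_mul (h.memLp j)

theorem IsNoise.integral_mul (h : IsNoise P ξ σ) (i j : Fin n) :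
    ∫ ω, ξ i ω * ξ j ω ∂P = if i = j then σ ^ 2 else 0 := by
  split_ifs with hij
  · subst hij
    rw [← h.variance_eq i,
      variance_of_integral_eq_zero (h.memLp i).aestronglyMeasurable.aemeasurable (h.mean_zero i)]
    simp only [sq]
  · rw [(h.indep.indepFun hij).integral_fun_mul_eq_mul_integral
      (h.memLp i).aestronglyMeasurable (h.memLp j).aestronglyMeasurable, h.mean_zero, zero_mul]

variable [IsProbabilityMeasure P]

/-- The cross term has mean zero, and the quadratic term has mean σ² times the trace of the
projection. U = ⊤ gives the expected loss, and a general U gives the excess risk. -/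
theorem IsNoise.integral_norm_starProjection_sq (h : IsNoise P ξ σ)
    (U : Submodule ℝ (EuclideanSpace ℝ (Fin n))) (c : EuclideanSpace ℝ (Fin n)) :
    ∫ ω, ‖U.starProjection (WithLp.toLp 2 fun i => ξ i ω) + c‖ ^ 2 ∂P =
      ‖c‖ ^ 2 + σ ^ 2 * Module.finrank ℝ U := by
  set e := EuclideanSpace.basisFun (Fin n) ℝ
  have hX : ∀ ω, (WithLp.toLp 2 fun i => ξ i ω) = ∑ i, ξ i ω • e i := by
    intro ω
    ext j
    simp [e, Pi.single_apply]
  have hexp : ∀ ω, ‖U.starProjection (WithLp.toLp 2 fun i => ξ i ω) + c‖ ^ 2 =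
      ‖c‖ ^ 2 + (∑ i, 2 * inner ℝ (e i) (U.starProjection c) * ξ i ω +
        ∑ i, ∑ j, inner ℝ (e j) (U.starProjection (e i)) * (ξ i ω * ξ j ω)) := by
    intro ω
    rw [norm_add_sq_real, U.inner_starProjection_left_eq_right]
    have h1 : ‖U.starProjection (WithLp.toLp 2 fun i => ξ i ω)‖ ^ 2 =
        inner ℝ (WithLp.toLp 2 fun i => ξ i ω)
          (U.starProjection (WithLp.toLp 2 fun i => ξ i ω)) := by
      rw [← real_inner_self_eq_norm_sq, U.inner_starProjection_left_eq_right,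
        Submodule.starProjection_eq_self_iff.2 (U.starProjection_apply_mem _)]
    rw [h1, hX ω]
    simp only [map_sum, map_smul, sum_inner, inner_sum, real_inner_smul_left,
      real_inner_smul_right, Finset.mul_sum]
    rw [add_comm (_ + _)]
    congr 1
    rw [add_comm]
    congr 1
    · exact Finset.sum_congr rfl fun i _ => by ring
    · exact Finset.sum_congr rfl fun i _ => Finset.sum_congr rfl fun j _ => by ring
  have hi1 : ∀ i, Integrable (ξ i) P := fun i => (h.memLp i).integrable one_le_two
  have hI1 : Integrable (fun ω => ∑ i, 2 * inner ℝ (e i) (U.starProjection c) * ξ i ω) P :=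
    integrable_finsetSum _ fun i _ => (hi1 i).const_mul _
  have hI2 : Integrable (fun ω => ∑ i, ∑ j, inner ℝ (e j) (U.starProjection (e i)) *
      (ξ i ω * ξ j ω)) P :=
    integrable_finsetSum _ fun i _ => integrable_finsetSum _ fun j _ =>
      (h.integrable_mul i j).const_mul _
  simp only [hexp]
  rw [integral_add (integrable_const _) (by exact hI1.add hI2), integral_add hI1 hI2,
    integral_finsetSum _ fun i _ => (hi1 i).const_mul _,
    integral_finsetSum _ fun i _ => integrable_finsetSum _ fun j _ =>
      (h.integrable_mul i j).const_mul _]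
  have h3 : ∀ i, ∫ ω, ∑ j, inner ℝ (e j) (U.starProjection (e i)) * (ξ i ω * ξ j ω) ∂P =
      σ ^ 2 * inner ℝ (e i) (U.starProjection (e i)) := by
    intro i
    rw [integral_finsetSum _ fun j _ => (h.integrable_mul i j).const_mul _]
    simp only [integral_const_mul, h.integral_mul]
    simp [mul_comm]
  simp only [h3, integral_const_mul, h.mean_zero]
  rw [← Finset.mul_sum, ← trace_starProjection U, LinearMap.trace_eq_sum_inner _ e]
  simp

theorem IsNoise.expectedLoss_eq (h : IsNoise P ξ σ) (A : Matrix (Fin n) (Fin d) ℝ)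
    (f : Fin n → ℝ) (x : Fin d → ℝ) :
    expectedLoss P A (fun ω i => f i + ξ i ω) x =
      (‖op A (WithLp.toLp 2 x) - WithLp.toLp 2 f‖ ^ 2 + σ ^ 2 * n) / n := by
  have h1 := h.integral_norm_starProjection_sq ⊤ (WithLp.toLp 2 f - op A (WithLp.toLp 2 x))
  rw [finrank_top, finrank_euclideanSpace_fin, norm_sub_rev] at h1
  rw [expectedLoss, integral_div, ← h1]
  congr 2
  ext ω
  rw [vecNorm, ← norm_neg, Submodule.starProjection_top]
  congr 2
  ext i
  simp [op]
  ring

/-- The expected loss differs from ‖Ax - f‖² / n by a constant, so minimizing it is least squares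
for the noiseless f. -/
theorem IsOptimal.op_eq (h : IsNoise P ξ σ) (hn : 0 < n) {A : Matrix (Fin n) (Fin d) ℝ}
    {f : Fin n → ℝ} {x : Fin d → ℝ} (hx : IsOptimal P A (fun ω i => f i + ξ i ω) x) :
    op A (WithLp.toLp 2 x) = (LinearMap.range (op A)).starProjection (WithLp.toLp 2 f) := by
  refine eq_starProjection_range_of_forall_norm_sub_le fun y => ?_
  have h1 := hx.1 y.ofLp
  have hn' : (0 : ℝ) < n := Nat.cast_pos.2 hn
  rw [h.expectedLoss_eq, h.expectedLoss_eq, div_le_div_iff_of_pos_right hn',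
    add_le_add_iff_right] at h1
  exact (sq_le_sq₀ (norm_nonneg _) (norm_nonneg _)).1 h1

/-- The variance term depends on U only through its dimension, so it cancels when two subspaces of
equal dimension are compared. -/
theorem IsNoise.excessRisk_eq (h : IsNoise P ξ σ) (A : Matrix (Fin n) (Fin d) ℝ)
    (f : Fin n → ℝ) (x : Fin d → ℝ) (U : Submodule ℝ (EuclideanSpace ℝ (Fin n)))
    (θ : (Fin n → ℝ) → Fin d → ℝ)
    (hθ : ∀ b, WithLp.toLp 2 (A *ᵥ θ b) = U.starProjection (WithLp.toLp 2 b)) :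
    excessRisk P A x (fun ω => θ fun i => f i + ξ i ω) =
      (‖U.starProjection (WithLp.toLp 2 f) - op A (WithLp.toLp 2 x)‖ ^ 2 +
        σ ^ 2 * Module.finrank ℝ U) / n := by
  have h1 := h.integral_norm_starProjection_sq U
    (U.starProjection (WithLp.toLp 2 f) - op A (WithLp.toLp 2 x))
  rw [excessRisk, integral_div, ← h1]
  congr 2
  ext ω
  rw [vecNorm, WithLp.toLp_sub, hθ, add_sub, ← map_add]
  congr 4
  ext i
  simp [add_comm]

end Noise

/-! ### The deterministic guarantee -/

section Guarantee

variable {n d k : ℕ} {Ω : Type*} [MeasurableSpace Ω] {P : Measure Ω} [IsProbabilityMeasure P]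
  {ξ : Fin n → Ω → ℝ} {σ : ℝ}

theorem twoSidedGuarantee_of_lt {A : Matrix (Fin n) (Fin d) ℝ} (hk : 1 ≤ k) (hk' : k ≤ min n d)
    (hgap : sv A (k + 1) < sv A k) {ν : ℝ} (hν : ν ∈ Set.Ioo (0 : ℝ) (1 / 2))
    (hξ : IsNoise P ξ σ) (G : Sketch d) (S : Sketch n)
    (h2 : ‖Aᵀᵀ * G.2ᵀ * G.2 * Aᵀ - Aᵀᵀ * Aᵀ‖ < eps2 A k ν * ‖Aᵀ‖ ^ 2)
    (h1 : ‖(A * G.2ᵀ)ᵀ * S.2ᵀ * S.2 * (A * G.2ᵀ) - (A * G.2ᵀ)ᵀ * (A * G.2ᵀ)‖ <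
      eps1 (A * G.2ᵀ) k ν * ‖A * G.2ᵀ‖ ^ 2) :
    TwoSidedGuarantee P ξ A hk' ν G S := by
  -- The number of rows must be settled before the decompositions are quantified, so auxiliary ones
  -- are used here.
  obtain ⟨DA₀⟩ := nonempty_thinSVD A
  obtain ⟨D₀⟩ := nonempty_thinSVD (S.2 * A * G.2ᵀ)
  refine ⟨(map_rightSpan_close hk hgap hν DA₀ D₀ h2 h1).1, ?_⟩
  intro DA D DAR DARV xk hxk xRk
  obtain ⟨hst, hdim, hclose⟩ := map_rightSpan_close hk hgap hν DA D h2 h1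
  set U := DA.leftSpan k with hU
  set W := (D.rightSpan k).map (op (A * G.2ᵀ)) with hW
  have hApos : 0 < sv A k := (sv_nonneg _ _).trans_lt hgap
  have hdimU : Module.finrank ℝ U = k := by rw [hU, DA.finrank_leftSpan, min_eq_left hk']
  have hrange : LinearMap.range (op (A * twoSidedR G S hst D)) = W := by
    rw [hW, ← D.range_op_Vk hst, ← LinearMap.range_comp, twoSidedR, ← Matrix.mul_assoc]
    congr 1
    ext1 x
    rw [op_mul]; rfl
  have hxR : ∀ b, WithLp.toLp 2 (A *ᵥ xRk b) = W.starProjection (WithLp.toLp 2 b) :=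
    fun b => op_solutionMatrix _ DAR DARV hrange b
  have hx : ∀ b, WithLp.toLp 2 (A *ᵥ xk b) = U.starProjection (WithLp.toLp 2 b) :=
    fun b => (hxk b).op_eq hApos
  have hproj : ∀ y, ‖W.starProjection y - U.starProjection y‖ ≤ ν * ‖y‖ :=
    norm_starProjection_sub_le (hdimU.trans hdim.symm) hν.1.le (by linarith [hν.2]) hclose
  constructor
  · intro b
    constructor
    · rw [vecNorm, vecNorm, vecNorm, WithLp.toLp_sub, WithLp.toLp_sub, hx, hxR]
      refine (abs_norm_sub_norm_le _ _).trans ?_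
      rw [sub_sub_sub_cancel_right]
      exact hproj _
    · rw [vecNorm, vecNorm]
      refine (DA.norm_op_Ukplus_transpose_le k (WithLp.toLp 2 (A *ᵥ xRk b))).trans ?_
      rw [hxR]
      refine (hclose _ (W.starProjection_apply_mem _)).trans ?_
      gcongr
      · exact hν.1.le
      · exact W.norm_starProjection_apply_le _
  · intro f xstar b hopt
    have hn : 0 < n := by omega
    have hg := hopt.op_eq hξ hn
    rw [hξ.excessRisk_eq A f xstar W xRk hxR, hξ.excessRisk_eq A f xstar U xk hx, hdimU, hdim, hg,
      ← add_div]
    set F : EuclideanSpace ℝ (Fin n) := WithLp.toLp 2 f with hF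
    have hvec : vecNorm f = ‖F‖ := rfl
    rw [hvec]
    set g := (LinearMap.range (op A)).starProjection F with hgdef
    have hUA : U ≤ LinearMap.range (op A) := by
      rw [hU, ← DA.map_rightSpan hApos]; exact LinearMap.map_le_range
    have e1 : U.starProjection F = U.starProjection g := by
      rw [hgdef, ← ContinuousLinearMap.comp_apply,
        Submodule.starProjection_comp_starProjection_of_le hUA]
    -- As U lies in the range of A, the bias of the exact estimator is, up to sign, the projection
    -- of g to Uᗮ. This ‖F‖, times 2ν‖F‖ from the square, gives the linear term of the bound.
    have e2 : ‖U.starProjection F - g‖ ≤ ‖F‖ := by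
      rw [e1, norm_sub_rev, ← Submodule.starProjection_orthogonal_val]
      exact (Uᗮ.norm_starProjection_apply_le g).trans (Submodule.norm_starProjection_apply_le _ F)
    have e3 : ‖W.starProjection F - g‖ ≤ ‖U.starProjection F - g‖ + ν * ‖F‖ := by
      calc ‖W.starProjection F - g‖
          = ‖(U.starProjection F - g) + (W.starProjection F - U.starProjection F)‖ := by
            congr 1; abel
        _ ≤ _ := (norm_add_le _ _).trans (by gcongr; exact hproj F)
    have hν0 := hν.1
    refine div_le_div_of_nonneg_right ?_ (Nat.cast_nonneg n)
    have e4 := pow_le_pow_left₀ (norm_nonneg _) e3 2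
    have e5 := mul_le_mul_of_nonneg_left e2 (by positivity : 0 ≤ 2 * ν * ‖F‖)
    nlinarith

end Guarantee

/-! ### Measurability of the failure events -/

section Measurability

instance {m n : ℕ} : BorelSpace (Matrix (Fin m) (Fin n) ℝ) :=
  inferInstanceAs (BorelSpace (Fin m → Fin n → ℝ))

instance {m n : ℕ} : SecondCountableTopology (Matrix (Fin m) (Fin n) ℝ) :=
  inferInstanceAs (SecondCountableTopology (Fin m → Fin n → ℝ))

theorem measurableSet_sketch_iff {m : ℕ} {s : Set (Sketch m)} :
    MeasurableSet s ↔ ∀ r, MeasurableSet {M : Matrix (Fin r) (Fin m) ℝ | (⟨r, M⟩ : Sketch m) ∈ s} :=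
  MeasurableSpace.measurableSet_iInf

theorem measurableEmbedding_sketch_mk {m : ℕ} (r : ℕ) :
    MeasurableEmbedding fun M : Matrix (Fin r) (Fin m) ℝ => (⟨r, M⟩ : Sketch m) where
  injective := fun _ _ h => eq_of_heq (Sigma.mk.inj h).2
  measurable := fun _ hs => measurableSet_sketch_iff.1 hs r
  measurableSet_image' := fun s hs => measurableSet_sketch_iff.2 fun q => by
    by_cases h : q = r
    · subst h
      convert hs
      ext M
      simp
    · convert MeasurableSet.empty
      ext M
      refine iff_of_false ?_ (Set.notMem_empty _)
      rintro ⟨N, -, hN⟩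
      exact h (congrArg Sigma.fst hN).symm

/-- A sketch space is a countable disjoint union of matrix spaces, so it suffices to test each pair
of sizes. -/
theorem measurableSet_sketch_prod {l m : ℕ} {s : Set (Sketch l × Sketch m)}
    (h : ∀ q r, MeasurableSet {p : Matrix (Fin q) (Fin l) ℝ × Matrix (Fin r) (Fin m) ℝ |
      ((⟨q, p.1⟩, ⟨r, p.2⟩) : Sketch l × Sketch m) ∈ s}) : MeasurableSet s := by
  have hs : s = ⋃ q, ⋃ r, Prod.map (fun M => (⟨q, M⟩ : Sketch l)) (fun M => (⟨r, M⟩ : Sketch m)) ''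
      {p : Matrix (Fin q) (Fin l) ℝ × Matrix (Fin r) (Fin m) ℝ |
        ((⟨q, p.1⟩, ⟨r, p.2⟩) : Sketch l × Sketch m) ∈ s} := by
    ext ⟨⟨q, G⟩, ⟨r, S⟩⟩
    simp only [Set.mem_iUnion]
    constructor
    · intro hp
      exact ⟨q, r, (G, S), hp, rfl⟩
    · rintro ⟨q', r', ⟨G', S'⟩, hp, he⟩
      rw [← he]; exact hp
  rw [hs]
  exact MeasurableSet.iUnion fun q => MeasurableSet.iUnion fun r =>
    ((measurableEmbedding_sketch_mk q).prodMap (measurableEmbedding_sketch_mk r)).measurableSet_image'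
      (h q r)

/-- The Weyl inequality in both directions bounds the change by ‖YᵀY - XᵀX‖, which tends to 0 as Y
tends to X. -/
theorem continuous_sv_sq {m n k : ℕ} (hk : 1 ≤ k) :
    Continuous fun X : Matrix (Fin m) (Fin n) ℝ => sv X k ^ 2 := by
  rw [continuous_iff_continuousAt]
  intro X
  have h : Filter.Tendsto (fun Y : Matrix (Fin m) (Fin n) ℝ => ‖Yᵀ * Y - Xᵀ * X‖)
      (nhds X) (nhds 0) := by
    have : Continuous fun Y : Matrix (Fin m) (Fin n) ℝ => ‖Yᵀ * Y - Xᵀ * X‖ := by fun_prop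
    simpa using this.tendsto X
  refine tendsto_iff_dist_tendsto_zero.2 (squeeze_zero (fun _ => dist_nonneg) (fun Y => ?_) h)
  rw [Real.dist_eq, abs_le]
  have h1 := sv_sq_le_add_of_row X Y hk
  have h2 := sv_sq_le_add_of_row Y X hk
  rw [norm_sub_rev] at h2
  constructor <;> linarith

theorem measurableSet_sketch_gram {m n : ℕ} (X : Matrix (Fin m) (Fin n) ℝ) (c : ℝ) :
    MeasurableSet {S : Sketch m | c ≤ ‖Xᵀ * S.2ᵀ * S.2 * X - Xᵀ * X‖} := by
  refine measurableSet_sketch_iff.2 fun r => ?_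
  have : Continuous fun S : Matrix (Fin r) (Fin m) ℝ => ‖Xᵀ * Sᵀ * S * X - Xᵀ * X‖ := by fun_prop
  exact measurableSet_le measurable_const this.measurable

theorem measurableSet_twoSided {n d k : ℕ} (A : Matrix (Fin n) (Fin d) ℝ) (hk : 1 ≤ k) (ν : ℝ) :
    MeasurableSet {p : Sketch d × Sketch n | 0 < gap (A * p.1.2ᵀ) k ∧
      eps1 (A * p.1.2ᵀ) k ν * ‖A * p.1.2ᵀ‖ ^ 2 ≤
        ‖(A * p.1.2ᵀ)ᵀ * p.2.2ᵀ * p.2.2 * (A * p.1.2ᵀ) - (A * p.1.2ᵀ)ᵀ * (A * p.1.2ᵀ)‖} := by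
  refine measurableSet_sketch_prod fun q r => ?_
  -- Clearing the denominator of the relative gap leaves only continuous functions.
  simp only [Set.mem_ofPred_eq, gap_pos_iff _ hk, eps1, mul_assoc, gap_mul_norm_sq _ hk]
  have h2 : Continuous fun p : Matrix (Fin q) (Fin d) ℝ × Matrix (Fin r) (Fin n) ℝ =>
      A * p.1ᵀ := by fun_prop
  have h1 : Continuous fun p : Matrix (Fin q) (Fin d) ℝ × Matrix (Fin r) (Fin n) ℝ =>
      sv (A * p.1ᵀ) k ^ 2 - sv (A * p.1ᵀ) (k + 1) ^ 2 :=
    ((continuous_sv_sq hk).comp h2).sub ((continuous_sv_sq (by omega)).comp h2)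
  refine (measurableSet_lt measurable_const h1.measurable).inter
    (measurableSet_le (measurable_const.mul h1.measurable) (Continuous.measurable ?_))
  exact ((((h2.matrix_transpose.matrix_mul continuous_snd.matrix_transpose).matrix_mul
    continuous_snd).matrix_mul h2).sub (h2.matrix_transpose.matrix_mul h2)).norm

end Measurability

/-- A union bound over failure of G and failure of S. The failure set of the guarantee is not shown
to be measurable. It is covered by two measurable sets, B × univ and E. Positivity of the gap is
part of E because κ is controlled only there, and outside B it is automatic. -/
theorem measure_not_twoSidedGuarantee_le {n d k : ℕ} {A : Matrix (Fin n) (Fin d) ℝ} (hk : 1 ≤ k)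
    (hk' : k ≤ min n d) (hgap : sv A (k + 1) < sv A k) {ν δ : ℝ}
    (hν : ν ∈ Set.Ioo (0 : ℝ) (1 / 2)) (hδ : 0 ≤ δ)
    (μ : Measure (Sketch d)) [IsProbabilityMeasure μ]
    (κ : Kernel (Sketch d) (Sketch n)) [IsMarkovKernel κ]
    (hμ : HasApproxGram μ Aᵀ (eps2 A k ν) (δ / 2))
    (hκ : ∀ᵐ G ∂μ, 0 < gap (A * G.2ᵀ) k →
      HasApproxGram (κ G) (A * G.2ᵀ) (eps1 (A * G.2ᵀ) k ν) (δ / 2))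
    {Ω : Type*} [MeasurableSpace Ω] (P : Measure Ω) [IsProbabilityMeasure P]
    {ξ : Fin n → Ω → ℝ} {σ : ℝ} (hξ : IsNoise P ξ σ) :
    (μ ⊗ₘ κ) {p | ¬ TwoSidedGuarantee P ξ A hk' ν p.1 p.2} ≤ ENNReal.ofReal δ := by
  set B := {G : Sketch d | eps2 A k ν * ‖Aᵀ‖ ^ 2 ≤ ‖Aᵀᵀ * G.2ᵀ * G.2 * Aᵀ - Aᵀᵀ * Aᵀ‖} with hB
  set E := {p : Sketch d × Sketch n | 0 < gap (A * p.1.2ᵀ) k ∧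
      eps1 (A * p.1.2ᵀ) k ν * ‖A * p.1.2ᵀ‖ ^ 2 ≤
        ‖(A * p.1.2ᵀ)ᵀ * p.2.2ᵀ * p.2.2 * (A * p.1.2ᵀ) - (A * p.1.2ᵀ)ᵀ * (A * p.1.2ᵀ)‖} with hE
  have hBm : MeasurableSet B := measurableSet_sketch_gram Aᵀ _
  have hEm : MeasurableSet E := measurableSet_twoSided A hk ν
  have hsub : {p : Sketch d × Sketch n | ¬ TwoSidedGuarantee P ξ A hk' ν p.1 p.2} ⊆
      B ×ˢ Set.univ ∪ E := by
    intro p hp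
    by_contra hcon
    rw [Set.mem_union, not_or, Set.mem_prod, not_and_or] at hcon
    obtain ⟨hb, he⟩ := hcon
    have hb' : p.1 ∉ B := hb.resolve_right (not_not.2 (Set.mem_univ _))
    have h2 : ‖Aᵀᵀ * p.1.2ᵀ * p.1.2 * Aᵀ - Aᵀᵀ * Aᵀ‖ < eps2 A k ν * ‖Aᵀ‖ ^ 2 := not_le.1 hb'
    obtain ⟨DA⟩ := nonempty_thinSVD A
    obtain ⟨DB⟩ := nonempty_thinSVD (A * p.1.2ᵀ)
    have hg := (gap_mul_transpose_pos hk hgap hν DA DB h2).1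
    have h1 := not_le.1 fun h => he ⟨hg, h⟩
    exact hp (twoSidedGuarantee_of_lt hk hk' hgap hν hξ p.1 p.2 h2 h1)
  have h1 : (μ ⊗ₘ κ) (B ×ˢ Set.univ) ≤ ENNReal.ofReal (δ / 2) := by
    rw [Measure.compProd_apply_prod hBm MeasurableSet.univ]
    have hμ' : μ B ≤ ENNReal.ofReal (δ / 2) := hμ
    simpa using hμ'
  have h2 : (μ ⊗ₘ κ) E ≤ ENNReal.ofReal (δ / 2) := by
    rw [Measure.compProd_apply hEm]
    have h3 : ∀ᵐ G ∂μ, κ G (Prod.mk G ⁻¹' E) ≤ ENNReal.ofReal (δ / 2) := by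
      filter_upwards [hκ] with G hG
      by_cases hg : 0 < gap (A * G.2ᵀ) k
      · exact (measure_mono fun S hS => hS.2).trans (hG hg)
      · have : Prod.mk G ⁻¹' E = ∅ := by
          ext S
          simp [hE, hg]
        rw [this, measure_empty]; exact zero_le
    calc _ ≤ ∫⁻ _, ENNReal.ofReal (δ / 2) ∂μ := lintegral_mono_ae h3
      _ = _ := by simp
  calc _ ≤ (μ ⊗ₘ κ) (B ×ˢ Set.univ) + (μ ⊗ₘ κ) E :=
        (measure_mono hsub).trans (measure_union_le _ _)
    _ ≤ ENNReal.ofReal (δ / 2) + ENNReal.ofReal (δ / 2) := add_le_add h1 h2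
    _ = _ := by rw [← ENNReal.ofReal_add (by positivity) (by positivity), add_halves]

/-! ### CountSketch by second moments -/

section CountSketch

theorem norm_sq_le_sum_sq {m n : ℕ} (Y : Matrix (Fin m) (Fin n) ℝ) :
    ‖Y‖ ^ 2 ≤ ∑ i, ∑ j, Y i j ^ 2 := by
  have h0 : 0 ≤ ∑ i, ∑ j, Y i j ^ 2 := by positivity
  have h : ‖Y‖ ≤ √(∑ i, ∑ j, Y i j ^ 2) := by
    refine opNorm_le_of_forall Y (Real.sqrt_nonneg _) fun x => ?_
    refine (sq_le_sq₀ (norm_nonneg _) (by positivity)).1 ?_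
    rw [mul_pow, Real.sq_sqrt h0, EuclideanSpace.norm_sq_eq, Finset.sum_mul]
    refine Finset.sum_le_sum fun i _ => ?_
    change ‖∑ j, Y i j * x j‖ ^ 2 ≤ _
    rw [Real.norm_eq_abs, sq_abs, EuclideanSpace.norm_sq_eq]
    simp only [Real.norm_eq_abs, sq_abs]
    exact Finset.sum_mul_sq_le_sq_mul_sq _ _ _
  calc ‖Y‖ ^ 2 ≤ √(∑ i, ∑ j, Y i j ^ 2) ^ 2 := pow_le_pow_left₀ (norm_nonneg _) h 2
    _ = _ := Real.sq_sqrt h0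

variable {s m p : ℕ}

/-- The sign attached to a column of a count sketch. -/
def hashSign (h : Fin m → Fin s × Bool) (j : Fin m) : ℝ := if (h j).2 then 1 else -1

/-- The count sketch matrix of a hash function. -/
def hashMatrix (h : Fin m → Fin s × Bool) : Matrix (Fin s) (Fin m) ℝ :=
  Matrix.of fun i j => if (h j).1 = i then (if (h j).2 then 1 else -1) else 0

/-- The off-diagonal entries of the Gram matrix of a count sketch. -/
def hashGram (h : Fin m → Fin s × Bool) (j l : Fin m) : ℝ :=
  if j ≠ l ∧ (h j).1 = (h l).1 then hashSign h j * hashSign h l else 0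

theorem hashSign_mul_self (h : Fin m → Fin s × Bool) (j : Fin m) :
    hashSign h j * hashSign h j = 1 := by
  unfold hashSign; split_ifs <;> norm_num

theorem hashMatrix_gram (h : Fin m → Fin s × Bool) (j l : Fin m) :
    ((hashMatrix h)ᵀ * hashMatrix h - 1 : Matrix (Fin m) (Fin m) ℝ) j l = hashGram h j l := by
  have h1 : ((hashMatrix h)ᵀ * hashMatrix h) j l =
      if (h j).1 = (h l).1 then hashSign h j * hashSign h l else 0 := by
    rw [Matrix.mul_apply]
    have h2 : ∀ i, (hashMatrix h)ᵀ j i * hashMatrix h i l =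
        if (h j).1 = i then hashSign h j * (if (h l).1 = i then hashSign h l else 0) else 0 := by
      intro i
      change (if (h j).1 = i then hashSign h j else 0) * (if (h l).1 = i then hashSign h l else 0) = _
      rw [ite_mul, zero_mul]
    simp only [h2, Finset.sum_ite_eq, Finset.mem_univ, if_true, mul_ite, mul_zero]
    simp only [eq_comm]
  rw [Matrix.sub_apply, h1, hashGram, Matrix.one_apply]
  by_cases h2 : j = l
  · subst h2; simp [hashSign_mul_self]
  · simp [h2]

/-- Flip the sign of column `i`. -/
def flipSign (i : Fin m) (h : Fin m → Fin s × Bool) : Fin m → Fin s × Bool :=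
  Function.update h i ((h i).1, !(h i).2)

theorem flipSign_involutive (i : Fin m) :
    Function.Involutive (flipSign i : (Fin m → Fin s × Bool) → _) := by
  intro h
  ext1 j
  by_cases hj : j = i
  · subst hj; simp [flipSign]
  · simp [flipSign, hj]

theorem flipSign_fst (i : Fin m) (h : Fin m → Fin s × Bool) (j : Fin m) :
    (flipSign i h j).1 = (h j).1 := by
  by_cases hj : j = i
  · subst hj; simp [flipSign]
  · simp [flipSign, hj]

theorem hashSign_flipSign (i : Fin m) (h : Fin m → Fin s × Bool) (j : Fin m) :
    hashSign (flipSign i h) j = if j = i then -hashSign h j else hashSign h j := by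
  by_cases hj : j = i
  · subst hj
    simp only [hashSign, flipSign, Function.update_self, if_true]
    cases (h j).2 <;> simp
  · simp [hashSign, flipSign, hj]

theorem hashGram_flipSign_of_mem (i : Fin m) (h : Fin m → Fin s × Bool) {j l : Fin m}
    (hi : i = j ∨ i = l) : hashGram (flipSign i h) j l = -hashGram h j l := by
  simp only [hashGram, flipSign_fst, hashSign_flipSign]
  by_cases hjl : j = l
  · simp [hjl]
  · rcases hi with rfl | rfl
    · by_cases hc : (h i).1 = (h l).1 <;> simp [Ne.symm hjl, hjl, hc]
    · by_cases hc : (h j).1 = (h i).1 <;> simp [hjl, hc]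

theorem hashGram_flipSign_of_notMem (i : Fin m) (h : Fin m → Fin s × Bool) {j l : Fin m}
    (hj : j ≠ i) (hl : l ≠ i) : hashGram (flipSign i h) j l = hashGram h j l := by
  simp [hashGram, flipSign_fst, hashSign_flipSign, hj, hl]

/-- Flipping the sign of column i permutes the hash functions and negates the first factor only. -/
theorem sum_hashGram_mul_eq_zero {i j l a b : Fin m} (hi : i = j ∨ i = l) (ha : a ≠ i)
    (hb : b ≠ i) : ∑ h : Fin m → Fin s × Bool, hashGram h j l * hashGram h a b = 0 := by
  have h1 := Equiv.sum_comp (flipSign_involutive (s := s) i).toPerm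
    fun h => hashGram h j l * hashGram h a b
  simp only [Function.Involutive.coe_toPerm, hashGram_flipSign_of_mem i _ hi,
    hashGram_flipSign_of_notMem i _ ha hb, neg_mul, Finset.sum_neg_distrib] at h1
  linarith

/-- With all columns other than j fixed, exactly one of the s buckets for column j collides with
that of l. -/
theorem mul_sum_hash_collision {j l : Fin m} (hjl : j ≠ l) :
    (s : ℝ) * ∑ h : Fin m → Fin s × Bool, (if (h j).1 = (h l).1 then (1 : ℝ) else 0) =
      Fintype.card (Fin m → Fin s × Bool) := by
  have hcard : (Fintype.card (Fin m → Fin s × Bool) : ℝ) =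
      ∑ h : Fin m → Fin s × Bool, (1 : ℝ) := by simp
  have e1 := Equiv.sum_comp (Equiv.funSplitAt j (Fin s × Bool)).symm
    fun h => if (h j).1 = (h l).1 then (1 : ℝ) else 0
  have e2 := Equiv.sum_comp (Equiv.funSplitAt j (Fin s × Bool)).symm fun _ => (1 : ℝ)
  rw [hcard, ← e1, ← e2, Fintype.sum_prod_type_right, Fintype.sum_prod_type_right, Finset.mul_sum]
  refine Finset.sum_congr rfl fun g _ => ?_
  simp only [Equiv.funSplitAt_symm_apply, dite_true, hjl.symm, dite_false]
  rw [Fintype.sum_prod_type_right, Fintype.sum_prod_type_right]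
  simp [mul_comm]

theorem sum_hashGram_sq_le {j l : Fin m} :
    (s : ℝ) * ∑ h : Fin m → Fin s × Bool, hashGram h j l ^ 2 ≤
      Fintype.card (Fin m → Fin s × Bool) := by
  by_cases hjl : j = l
  · simp [hashGram, hjl]
  · rw [← mul_sum_hash_collision hjl]
    refine le_of_eq ?_
    congr 1
    refine Finset.sum_congr rfl fun h _ => ?_
    simp only [hashGram]
    by_cases h1 : (h j).1 = (h l).1
    · rw [if_pos ⟨hjl, h1⟩, if_pos h1, sq, mul_mul_mul_comm, hashSign_mul_self,
        hashSign_mul_self, one_mul]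
    · rw [if_neg (fun h2 => h1 h2.2), if_neg h1]; simp

theorem hashGram_comm (h : Fin m → Fin s × Bool) (j l : Fin m) :
    hashGram h j l = hashGram h l j := by
  simp only [hashGram, ne_comm (a := j), eq_comm (a := (h j).1), mul_comm (hashSign h j)]

theorem abs_sum_hashGram_mul_le (j l a b : Fin m) :
    (s : ℝ) * |∑ h : Fin m → Fin s × Bool, hashGram h j l * hashGram h a b| ≤
      ((if a = j ∧ b = l then 1 else 0) + (if a = l ∧ b = j then 1 else 0)) *
        Fintype.card (Fin m → Fin s × Bool) := by
  have hN : (0 : ℝ) ≤ Fintype.card (Fin m → Fin s × Bool) := Nat.cast_nonneg _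
  have key : ∀ a b, (∀ h : Fin m → Fin s × Bool, hashGram h a b = hashGram h j l) →
      (s : ℝ) * |∑ h : Fin m → Fin s × Bool, hashGram h j l * hashGram h a b| ≤
        Fintype.card (Fin m → Fin s × Bool) := by
    intro a b hab
    simp only [hab, ← sq]
    rw [abs_of_nonneg (Finset.sum_nonneg fun _ _ => sq_nonneg _)]
    exact sum_hashGram_sq_le
  by_cases h1 : a = j ∧ b = l
  · obtain ⟨rfl, rfl⟩ := h1
    refine (key a b fun _ => rfl).trans ?_
    simp only [and_self, if_true]
    split_ifs <;> linarith
  · by_cases h2 : a = l ∧ b = j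
    · obtain ⟨rfl, rfl⟩ := h2
      refine (key a b fun h => hashGram_comm _ _ _).trans ?_
      simp only [and_self, if_true]
      split_ifs <;> linarith
    · have h0 : ∑ h : Fin m → Fin s × Bool, hashGram h j l * hashGram h a b = 0 := by
        by_cases hab : a = b
        · refine Finset.sum_eq_zero fun h _ => ?_
          simp [hashGram, hab]
        by_cases hj : a ≠ j ∧ b ≠ j
        · exact sum_hashGram_mul_eq_zero (Or.inl rfl) hj.1 hj.2
        by_cases hl : a ≠ l ∧ b ≠ l
        · exact sum_hashGram_mul_eq_zero (Or.inr rfl) hl.1 hl.2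
        -- Both j and l occur in {a, b}. If they were distinct, (a, b) would be (j, l) or (l, j),
        -- and both are excluded.
        have hjl : j = l := by grind
        refine Finset.sum_eq_zero fun h _ => ?_
        simp [hashGram, hjl]
      rw [h0, abs_zero, mul_zero, if_neg h1, if_neg h2]
      simp

/-- A Schur test: after expanding the square, s times the correlation matrix is dominated by the
kernel c, whose row and column sums are all 2N. The 2 counts the orders of an index pair. -/
theorem sum_sq_sum_hashGram_le (u : Fin m → Fin m → ℝ) :
    (s : ℝ) * ∑ h : Fin m → Fin s × Bool, (∑ j, ∑ l, u j l * hashGram h j l) ^ 2 ≤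
      2 * Fintype.card (Fin m → Fin s × Bool) * ∑ j, ∑ l, u j l ^ 2 := by
  set N : ℝ := (Fintype.card (Fin m → Fin s × Bool) : ℝ) with hN
  have hN0 : 0 ≤ N := Nat.cast_nonneg _
  have e1 : ∑ h : Fin m → Fin s × Bool, (∑ j, ∑ l, u j l * hashGram h j l) ^ 2 =
      ∑ x : Fin m × Fin m, ∑ y : Fin m × Fin m, u x.1 x.2 * u y.1 y.2 *
        ∑ h : Fin m → Fin s × Bool, hashGram h x.1 x.2 * hashGram h y.1 y.2 := by
    simp only [Finset.mul_sum]
    rw [Finset.sum_congr rfl fun x _ => Finset.sum_comm, Finset.sum_comm]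
    refine Finset.sum_congr rfl fun h _ => ?_
    rw [← Fintype.sum_prod_type', sq, Finset.sum_mul_sum]
    exact Finset.sum_congr rfl fun x _ => Finset.sum_congr rfl fun y _ => by ring
  let c : Fin m × Fin m → Fin m × Fin m → ℝ := fun x y =>
    ((if y.1 = x.1 ∧ y.2 = x.2 then 1 else 0) + (if y.1 = x.2 ∧ y.2 = x.1 then 1 else 0)) * N
  have hI : ∀ x, ∑ y, c x y = 2 * N := by
    intro x
    have h1 : ∀ a b : Fin m, ∑ y : Fin m × Fin m, (if y.1 = a ∧ y.2 = b then (1 : ℝ) else 0) = 1 := by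
      intro a b
      rw [Finset.sum_eq_single (a, b)]
      · simp
      · intro y _ hy
        rw [if_neg fun h => hy (Prod.ext h.1 h.2)]
      · simp
    simp only [c]
    rw [← Finset.sum_mul, Finset.sum_add_distrib, h1, h1]
    norm_num
  have hI' : ∀ y, ∑ x, c x y = 2 * N := by
    intro y
    rw [← hI y]
    refine Finset.sum_congr rfl fun x _ => ?_
    simp only [c, eq_comm (a := y.1), eq_comm (a := y.2), and_comm (a := x.2 = y.1)]
  have hc : ∀ x y : Fin m × Fin m,
      s * |∑ h : Fin m → Fin s × Bool, hashGram h x.1 x.2 * hashGram h y.1 y.2| ≤ c x y :=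
    fun x y => abs_sum_hashGram_mul_le x.1 x.2 y.1 y.2
  clear_value c
  rw [e1, Finset.mul_sum, ← Fintype.sum_prod_type' (f := fun j l => u j l ^ 2)]
  calc _ ≤ ∑ x : Fin m × Fin m, ∑ y : Fin m × Fin m,
        (u x.1 x.2 ^ 2 / 2 + u y.1 y.2 ^ 2 / 2) * c x y := by
        refine Finset.sum_le_sum fun x _ => ?_
        rw [Finset.mul_sum]
        refine Finset.sum_le_sum fun y _ => ?_
        have h1 := hc x y
        set q := ∑ h : Fin m → Fin s × Bool, hashGram h x.1 x.2 * hashGram h y.1 y.2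
        have h2 : |u x.1 x.2 * u y.1 y.2| ≤ u x.1 x.2 ^ 2 / 2 + u y.1 y.2 ^ 2 / 2 := by
          rw [abs_le]
          constructor
          · nlinarith [sq_nonneg (u x.1 x.2 + u y.1 y.2)]
          · nlinarith [sq_nonneg (u x.1 x.2 - u y.1 y.2)]
        calc (s : ℝ) * (u x.1 x.2 * u y.1 y.2 * q) ≤ |u x.1 x.2 * u y.1 y.2| * (s * |q|) := by
              refine (le_abs_self _).trans_eq ?_
              rw [abs_mul, abs_mul _ q, Nat.abs_cast]; ring
          _ ≤ _ := by gcongr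
    _ = ∑ x : Fin m × Fin m, ∑ y : Fin m × Fin m, u x.1 x.2 ^ 2 / 2 * c x y +
        ∑ y : Fin m × Fin m, ∑ x : Fin m × Fin m, u y.1 y.2 ^ 2 / 2 * c x y := by
        simp only [add_mul, Finset.sum_add_distrib]
        congr 1
        exact Finset.sum_comm
    _ = 2 * N * ∑ x : Fin m × Fin m, u x.1 x.2 ^ 2 := by
        simp only [← Finset.mul_sum, hI, hI', ← Finset.sum_mul, ← Finset.sum_div]
        ring

/-- The spectral norm is bounded by the Frobenius norm. Each entry of the error is a combination of
the `hashGram` entries, and the sum of all squared coefficients factors as ‖X‖_F⁴. -/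
theorem sum_norm_hashMatrix_gram_sq_le (X : Matrix (Fin m) (Fin p) ℝ) :
    (s : ℝ) * ∑ h : Fin m → Fin s × Bool,
      ‖Xᵀ * (hashMatrix h)ᵀ * hashMatrix h * X - Xᵀ * X‖ ^ 2 ≤
      2 * Fintype.card (Fin m → Fin s × Bool) * (∑ i, ∑ j, X i j ^ 2) ^ 2 := by
  have hentry : ∀ (h : Fin m → Fin s × Bool) (a b : Fin p),
      (Xᵀ * (hashMatrix h)ᵀ * hashMatrix h * X - Xᵀ * X) a b =
        ∑ j, ∑ l, (X j a * X l b) * hashGram h j l := by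
    intro h a b
    have h1 : Xᵀ * (hashMatrix h)ᵀ * hashMatrix h * X - Xᵀ * X =
        Xᵀ * (((hashMatrix h)ᵀ * hashMatrix h - 1) * X) := by
      rw [Matrix.sub_mul, Matrix.mul_sub, Matrix.one_mul]; simp only [Matrix.mul_assoc]
    rw [h1, Matrix.mul_apply]
    refine Finset.sum_congr rfl fun j _ => ?_
    rw [Matrix.mul_apply, Finset.mul_sum]
    refine Finset.sum_congr rfl fun l _ => ?_
    rw [hashMatrix_gram, Matrix.transpose_apply]; ring
  calc _ ≤ (s : ℝ) * ∑ h : Fin m → Fin s × Bool,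
        ∑ a, ∑ b, (∑ j, ∑ l, (X j a * X l b) * hashGram h j l) ^ 2 := by
        gcongr with h _
        refine (norm_sq_le_sum_sq _).trans_eq ?_
        simp only [hentry]
    _ = ∑ a, ∑ b, (s : ℝ) * ∑ h : Fin m → Fin s × Bool,
        (∑ j, ∑ l, (X j a * X l b) * hashGram h j l) ^ 2 := by
        rw [Finset.sum_comm, Finset.mul_sum]
        refine Finset.sum_congr rfl fun a _ => ?_
        rw [Finset.sum_comm, Finset.mul_sum]
    _ ≤ ∑ a, ∑ b, 2 * Fintype.card (Fin m → Fin s × Bool) * ∑ j, ∑ l, (X j a * X l b) ^ 2 :=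
        Finset.sum_le_sum fun a _ => Finset.sum_le_sum fun b _ =>
          sum_sq_sum_hashGram_le fun j l => X j a * X l b
    _ = _ := by
        have h1 : ∀ a b, ∑ j, ∑ l, (X j a * X l b) ^ 2 = (∑ j, X j a ^ 2) * ∑ l, X l b ^ 2 := by
          intro a b
          rw [Finset.sum_mul_sum]
          exact Finset.sum_congr rfl fun j _ => Finset.sum_congr rfl fun l _ => mul_pow _ _ _
        have h2 : ∑ i, ∑ j, X i j ^ 2 = ∑ j, ∑ i, X i j ^ 2 := Finset.sum_comm
        rw [h2, sq, Finset.sum_mul_sum, Finset.mul_sum]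
        refine Finset.sum_congr rfl fun a _ => ?_
        rw [Finset.mul_sum]
        exact Finset.sum_congr rfl fun b _ => by rw [h1]

theorem hasApproxGram_countSketch (X : Matrix (Fin m) (Fin p) ℝ) {ε δ : ℝ} (hε : 0 < ε)
    (hδ : 0 < δ) (hX : X ≠ 0) (hs : 2 * (stableRank X ^ 2 / (ε ^ 2 * δ)) ≤ s) :
    HasApproxGram (countSketch s m) X ε δ := by
  have hXn : 0 < ‖X‖ := norm_pos_iff.2 hX
  have hF : 0 < ∑ i, ∑ j, X i j ^ 2 := (by positivity : 0 < ‖X‖ ^ 2).trans_le (norm_sq_le_sum_sq X)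
  have hsr : 0 < stableRank X := div_pos hF (by positivity)
  have hs0 : (0 : ℝ) < s := lt_of_lt_of_le (by positivity) hs
  have hsn : 0 < s := Nat.cast_pos.1 hs0
  have : Nonempty (Fin s) := ⟨⟨0, hsn⟩⟩
  set N := Fintype.card (Fin m → Fin s × Bool) with hN
  have hN0 : (0 : ℝ) < N := Nat.cast_pos.2 Fintype.card_pos
  rw [HasApproxGram, countSketch,
    Measure.map_apply (Measurable.of_discrete) (measurableSet_sketch_gram X _)]
  classical
  set B : Finset (Fin m → Fin s × Bool) := Finset.univ.filter fun h =>
    ε * ‖X‖ ^ 2 ≤ ‖Xᵀ * (hashMatrix h)ᵀ * hashMatrix h * X - Xᵀ * X‖ with hB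
  have hset : ((fun h : Fin m → Fin s × Bool => (⟨s, hashMatrix h⟩ : Sketch m)) ⁻¹'
      {S : Sketch m | ε * ‖X‖ ^ 2 ≤ ‖Xᵀ * S.2ᵀ * S.2 * X - Xᵀ * X‖}) = (B : Set _) := by
    ext h
    simp [hB]
  change uniformOn Set.univ ((fun h : Fin m → Fin s × Bool => (⟨s, hashMatrix h⟩ : Sketch m)) ⁻¹'
      {S : Sketch m | ε * ‖X‖ ^ 2 ≤ ‖Xᵀ * S.2ᵀ * S.2 * X - Xᵀ * X‖}) ≤ _
  rw [hset, uniformOn_univ, Measure.count_apply_finset, ← hN]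
  have h1 : (B.card : ℝ) * (ε * ‖X‖ ^ 2) ^ 2 ≤
      ∑ h : Fin m → Fin s × Bool, ‖Xᵀ * (hashMatrix h)ᵀ * hashMatrix h * X - Xᵀ * X‖ ^ 2 := by
    calc (B.card : ℝ) * (ε * ‖X‖ ^ 2) ^ 2 = ∑ h ∈ B, (ε * ‖X‖ ^ 2) ^ 2 := by simp
      _ ≤ ∑ h ∈ B, ‖Xᵀ * (hashMatrix h)ᵀ * hashMatrix h * X - Xᵀ * X‖ ^ 2 :=
        Finset.sum_le_sum fun h hh => pow_le_pow_left₀ (by positivity) (Finset.mem_filter.1 hh).2 2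
      _ ≤ _ := Finset.sum_le_sum_of_subset_of_nonneg (Finset.subset_univ _)
        fun _ _ _ => sq_nonneg _
  have h2 := sum_norm_hashMatrix_gram_sq_le (s := s) X
  rw [← hN] at h2
  have h3 : (B.card : ℝ) / N ≤ δ := by
    rw [div_le_iff₀ hN0]
    have h4 : 2 * (∑ i, ∑ j, X i j ^ 2) ^ 2 ≤ s * δ * (ε * ‖X‖ ^ 2) ^ 2 := by
      have h4 : stableRank X * ‖X‖ ^ 2 = ∑ i, ∑ j, X i j ^ 2 :=
        div_mul_cancel₀ _ (by positivity)
      rw [← h4]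
      rw [← mul_div_assoc, div_le_iff₀ (by positivity)] at hs
      calc 2 * (stableRank X * ‖X‖ ^ 2) ^ 2 = 2 * stableRank X ^ 2 * (‖X‖ ^ 2) ^ 2 := by ring
        _ ≤ s * (ε ^ 2 * δ) * (‖X‖ ^ 2) ^ 2 := by gcongr
        _ = _ := by ring
    have h5 : (s : ℝ) * (B.card * (ε * ‖X‖ ^ 2) ^ 2) ≤ N * (s * δ * (ε * ‖X‖ ^ 2) ^ 2) := by
      calc _ ≤ (s : ℝ) * _ := mul_le_mul_of_nonneg_left h1 hs0.le
        _ ≤ _ := h2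
        _ = N * (2 * (∑ i, ∑ j, X i j ^ 2) ^ 2) := by ring
        _ ≤ _ := by gcongr
    have h6 : 0 < s * (ε * ‖X‖ ^ 2) ^ 2 := by positivity
    refine le_of_mul_le_mul_right ?_ h6
    linarith
  rw [← ENNReal.ofReal_natCast B.card, ← ENNReal.ofReal_natCast N, ← ENNReal.ofReal_div_of_pos hN0]
  exact ENNReal.ofReal_le_ofReal h3

/-- With q = √(1 + ν² / 4), the coefficient is ν / (2q + ν), and 2q + ν ≤ 11/5 + 1/2 < 3. -/
theorem le_eps1 {n t k : ℕ} (B : Matrix (Fin n) (Fin t) ℝ) {ν : ℝ}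
    (hν : ν ∈ Set.Ioo (0 : ℝ) (1 / 2)) : ν / 3 * gap B k ≤ eps1 B k ν := by
  obtain ⟨h0, h1⟩ := hν
  refine mul_le_mul_of_nonneg_right ?_ (gap_nonneg B k)
  have h2 : √(1 + ν ^ 2 / 4) ≤ 11 / 10 := by
    rw [Real.sqrt_le_left (by norm_num)]
    nlinarith
  have h3 : 1 ≤ √(1 + ν ^ 2 / 4) := by
    rw [Real.one_le_sqrt]; nlinarith
  set q := √(1 + ν ^ 2 / 4)
  have h4 : ν * q⁻¹ / 2 / (1 + ν * q⁻¹ / 2) = ν / (2 * q + ν) := by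
    field_simp
  rw [h4]
  gcongr
  linarith

theorem hasApproxGram_countSketch_of_gap {n t k : ℕ} (hk : 1 ≤ k) (B : Matrix (Fin n) (Fin t) ℝ)
    {ν δ : ℝ} (hν : ν ∈ Set.Ioo (0 : ℝ) (1 / 2)) (hδ : 0 < δ) (hB : 0 < gap B k)
    (hs : 36 * (stableRank B ^ 2 / (gap B k ^ 2 * ν ^ 2 * δ)) ≤ s) :
    HasApproxGram (countSketch s n) B (eps1 B k ν) (δ / 2) := by
  have hle := le_eps1 (k := k) B hν
  have hν0 := hν.1
  have hp : 0 < ν / 3 * gap B k := by positivity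
  refine hasApproxGram_countSketch B (hp.trans_le hle) (by positivity) ?_ (le_trans ?_ hs)
  · rintro rfl
    rw [gap_pos_iff _ hk, ← gap_mul_norm_sq _ hk] at hB
    simp at hB
  -- 36 = 2 · 2 · 9: the second moment constant, the halved δ, and the square of ν / 3.
  · calc 2 * (stableRank B ^ 2 / (eps1 B k ν ^ 2 * (δ / 2)))
        ≤ 2 * (stableRank B ^ 2 / ((ν / 3 * gap B k) ^ 2 * (δ / 2))) := by gcongr
      _ = _ := by field_simp; ring

end CountSketch

/-! ### Exponential moments of subgaussian products -/

section MGF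

variable {Ω : Type*} [MeasurableSpace Ω] {μ : Measure Ω} [IsProbabilityMeasure μ]

/-- The total exponent is at most -g² / 4, and the resulting Gaussian integral is √2. -/
theorem lintegral_exp_mul_sq_gaussian_le {a : ℝ} (ha : 4 * a ≤ 1) :
    ∫⁻ g, ENNReal.ofReal (Real.exp (a * g ^ 2)) ∂(gaussianReal 0 1) ≤ 2 := by
  rw [gaussianReal_of_var_ne_zero _ one_ne_zero,
    lintegral_withDensity_eq_lintegral_mul _ (measurable_gaussianPDF 0 1) (by fun_prop)]
  have h1 : ∀ g : ℝ, (gaussianPDF 0 1 * fun g : ℝ => ENNReal.ofReal (Real.exp (a * g ^ 2))) g ≤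
      ENNReal.ofReal ((√(2 * Real.pi))⁻¹ * Real.exp (-(1 / 4) * g ^ 2)) := by
    intro g
    rw [Pi.mul_apply, gaussianPDF, ← ENNReal.ofReal_mul (gaussianPDFReal_nonneg _ _ _),
      gaussianPDFReal, mul_assoc, ← Real.exp_add]
    refine ENNReal.ofReal_le_ofReal ?_
    simp only [NNReal.coe_one, mul_one, sub_zero]
    gcongr
    nlinarith [sq_nonneg g]
  refine (lintegral_mono h1).trans ?_
  rw [← ofReal_integral_eq_lintegral_ofReal
    ((integrable_exp_neg_mul_sq (by norm_num)).const_mul _) (ae_of_all _ fun g => by positivity),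
    integral_const_mul, integral_gaussian]
  rw [show (2 : ℝ≥0∞) = ENNReal.ofReal 2 by simp]
  refine ENNReal.ofReal_le_ofReal ?_
  rw [inv_mul_le_iff₀ (Real.sqrt_pos.2 (by positivity)), ← Real.sqrt_sq (zero_le_two (α := ℝ)),
    ← Real.sqrt_mul (by positivity)]
  refine Real.sqrt_le_sqrt ?_
  rw [Real.sqrt_sq zero_le_two]
  have := Real.pi_pos
  linarith

/-- Linearization of the square: exp(a x²) is the mean of exp(√(2a) g x) over a standard Gaussian g.
After exchanging integrals, the subgaussian bound leaves exp(a c g²). -/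
theorem lintegral_exp_mul_sq_le {X : Ω → ℝ} {c : ℝ≥0} (hX : HasSubgaussianMGF X c μ) {a : ℝ}
    (ha : 0 ≤ a) (hac : 4 * (a * c) ≤ 1) :
    ∫⁻ ω, ENNReal.ofReal (Real.exp (a * X ω ^ 2)) ∂μ ≤ 2 := by
  have hs : √(2 * a) ^ 2 = 2 * a := Real.sq_sqrt (by positivity)
  have h1 : ∀ x : ℝ, ENNReal.ofReal (Real.exp (a * x ^ 2)) =
      ∫⁻ g, ENNReal.ofReal (Real.exp (√(2 * a) * g * x)) ∂(gaussianReal 0 1) := by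
    intro x
    have h2 := congrFun (mgf_id_gaussianReal (μ := 0) (v := 1)) (√(2 * a) * x)
    have h3 := integrable_exp_mul_gaussianReal (μ := 0) (v := 1) (√(2 * a) * x)
    simp only [mgf, id] at h2
    have h4 : ∀ g : ℝ, √(2 * a) * g * x = √(2 * a) * x * g := fun g => by ring
    simp only [h4]
    rw [← ofReal_integral_eq_lintegral_ofReal h3 (ae_of_all _ fun g => (Real.exp_pos _).le), h2,
      NNReal.coe_one, zero_mul, zero_add, one_mul, mul_pow, hs]
    congr 2; ring
  simp only [h1]
  have hm : AEMeasurable (Function.uncurry fun ω g => ENNReal.ofReal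
      (Real.exp (√(2 * a) * g * X ω))) (μ.prod (gaussianReal 0 1)) := by
    have hXm : AEMeasurable (fun p : Ω × ℝ => X p.1) (μ.prod (gaussianReal 0 1)) :=
      hX.aemeasurable.comp_fst
    exact (Real.measurable_exp.comp_aemeasurable
      ((measurable_snd.aemeasurable.const_mul _).mul hXm)).ennreal_ofReal
  rw [lintegral_lintegral_swap hm]
  refine le_trans (lintegral_mono fun g => ?_) (lintegral_exp_mul_sq_gaussian_le hac)
  rw [← ofReal_integral_eq_lintegral_ofReal (hX.integrable_exp_mul _)
    (ae_of_all _ fun g => (Real.exp_pos _).le)]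
  refine ENNReal.ofReal_le_ofReal ((hX.mgf_le _).trans_eq ?_)
  rw [mul_pow, hs]
  congr 1; ring

theorem exp_le_one_add_add_sq_mul_exp_abs (x : ℝ) :
    Real.exp x ≤ 1 + x + x ^ 2 * Real.exp |x| := by
  have h1 := Real.add_one_le_exp (-x)
  have h2 : Real.exp x * Real.exp (-x) = 1 := by rw [← Real.exp_add, add_neg_cancel, Real.exp_zero]
  have h3 := Real.exp_pos x
  have h4 : Real.exp x - 1 ≤ x * Real.exp x := by nlinarith
  have h5 := Real.add_one_le_exp x
  rcases le_total 0 x with hx | hx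
  · rw [abs_of_nonneg hx]
    nlinarith
  · have h6 : 1 ≤ Real.exp |x| := Real.one_le_exp (abs_nonneg x)
    nlinarith [sq_nonneg x]

/-- Half of exp(2τ|w|) absorbs (τw)² and the other half absorbs exp|sw|. The remainder is then s²
times a function not depending on s. -/
theorem exp_mul_le_of_abs_le {s τ w : ℝ} (hτ : 0 < τ) (hs : |s| ≤ τ) :
    Real.exp (s * w) ≤ 1 + s * w + 2 * s ^ 2 / τ ^ 2 * Real.exp (2 * τ * |w|) := by
  refine (exp_le_one_add_add_sq_mul_exp_abs (s * w)).trans ?_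
  have h1 := Real.quadratic_le_exp_of_nonneg (x := τ * |w|) (by positivity)
  have h2 : (τ * w) ^ 2 ≤ 2 * Real.exp (τ * |w|) := by
    have : (τ * w) ^ 2 = (τ * |w|) ^ 2 := by rw [mul_pow, mul_pow, sq_abs]
    rw [this]
    nlinarith [mul_nonneg hτ.le (abs_nonneg w)]
  have h3 : Real.exp |s * w| ≤ Real.exp (τ * |w|) := by
    rw [abs_mul]; gcongr
  have h4 : Real.exp (2 * τ * |w|) = Real.exp (τ * |w|) * Real.exp (τ * |w|) := by
    rw [← Real.exp_add]; congr 1; ring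
  have h5 : (s * w) ^ 2 = s ^ 2 / τ ^ 2 * (τ * w) ^ 2 := by field_simp
  rw [h4, h5]
  gcongr 1 + s * w + ?_
  calc s ^ 2 / τ ^ 2 * (τ * w) ^ 2 * Real.exp |s * w|
      ≤ s ^ 2 / τ ^ 2 * (2 * Real.exp (τ * |w|)) * Real.exp (τ * |w|) := by gcongr
    _ = _ := by ring

theorem integral_exp_mul_le {W : Ω → ℝ} (hW : AEMeasurable W μ) {τ s M : ℝ} (hτ : 0 < τ)
    (hs : |s| ≤ τ) (hM : ∫⁻ ω, ENNReal.ofReal (Real.exp (2 * τ * |W ω|)) ∂μ ≤ ENNReal.ofReal M)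
    (hM0 : 0 ≤ M) :
    Integrable (fun ω => Real.exp (s * W ω)) μ ∧
      ∫ ω, Real.exp (s * W ω) ∂μ ≤ Real.exp (s * ∫ ω, W ω ∂μ + 2 * s ^ 2 / τ ^ 2 * M) := by
  have hm : AEStronglyMeasurable (fun ω => Real.exp (2 * τ * |W ω|)) μ :=
    (Real.measurable_exp.comp_aemeasurable (hW.abs.const_mul _)).aestronglyMeasurable
  have hI : Integrable (fun ω => Real.exp (2 * τ * |W ω|)) μ := by
    refine ⟨hm, ?_⟩
    rw [hasFiniteIntegral_iff_ofReal (ae_of_all _ fun _ => (Real.exp_pos _).le)]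
    exact hM.trans_lt ENNReal.ofReal_lt_top
  have hIM : ∫ ω, Real.exp (2 * τ * |W ω|) ∂μ ≤ M := by
    rw [← ENNReal.ofReal_le_ofReal_iff hM0,
      ofReal_integral_eq_lintegral_ofReal hI (ae_of_all _ fun _ => (Real.exp_pos _).le)]
    exact hM
  have hWI : Integrable W μ := by
    refine (hI.const_mul (2 * τ)⁻¹).mono' hW.aestronglyMeasurable (ae_of_all _ fun ω => ?_)
    rw [Real.norm_eq_abs, le_inv_mul_iff₀ (by positivity)]
    linarith [Real.add_one_le_exp (2 * τ * |W ω|)]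
  have hE : Integrable (fun ω => Real.exp (s * W ω)) μ := by
    refine hI.mono' (Real.measurable_exp.comp_aemeasurable (hW.const_mul _)).aestronglyMeasurable
      (ae_of_all _ fun ω => ?_)
    rw [Real.norm_of_nonneg (Real.exp_pos _).le]
    refine Real.exp_le_exp.2 ((le_abs_self _).trans ?_)
    rw [abs_mul]
    gcongr
    linarith
  refine ⟨hE, ?_⟩
  calc ∫ ω, Real.exp (s * W ω) ∂μ
      ≤ ∫ ω, (1 + s * W ω + 2 * s ^ 2 / τ ^ 2 * Real.exp (2 * τ * |W ω|)) ∂μ :=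
        integral_mono hE (((integrable_const _).add (hWI.const_mul _)).add (hI.const_mul _))
          fun ω => exp_mul_le_of_abs_le hτ hs
    _ = 1 + s * ∫ ω, W ω ∂μ + 2 * s ^ 2 / τ ^ 2 * ∫ ω, Real.exp (2 * τ * |W ω|) ∂μ := by
        rw [integral_add (by exact (integrable_const _).add (hWI.const_mul _)) (hI.const_mul _),
          integral_add (integrable_const _) (hWI.const_mul _), integral_const_mul,
          integral_const_mul]
        simp
    _ ≤ 1 + s * ∫ ω, W ω ∂μ + 2 * s ^ 2 / τ ^ 2 * M := by gcongr
    _ ≤ _ := by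
        rw [add_assoc, add_comm]
        exact Real.add_one_le_exp _

/-- By 2|pq| ≤ p² + q² and the AM-GM inequality, exp(2τ|pq|) is at most the average of exp(2τp²) and
exp(2τq²). Each has mean at most 2 when 4 · 2τ · c ≤ 1, and likewise for c'. -/
theorem integral_exp_mul_mul_le {p q : Ω → ℝ} {c c' : ℝ≥0} (hp : HasSubgaussianMGF p c μ)
    (hq : HasSubgaussianMGF q c' μ) {τ s : ℝ} (hτ : 0 < τ) (hs : |s| ≤ τ) (hc : 8 * (τ * c) ≤ 1)
    (hc' : 8 * (τ * c') ≤ 1) :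
    Integrable (fun ω => Real.exp (s * (p ω * q ω))) μ ∧
      ∫ ω, Real.exp (s * (p ω * q ω)) ∂μ ≤
        Real.exp (s * ∫ ω, p ω * q ω ∂μ + 4 * s ^ 2 / τ ^ 2) := by
  have h := integral_exp_mul_le (hp.aemeasurable.mul hq.aemeasurable) hτ hs (M := 2) ?_ zero_le_two
  · refine ⟨h.1, h.2.trans_eq ?_⟩
    simp only [Pi.mul_apply]
    congr 2; ring
  · have h1 : ∀ ω, ENNReal.ofReal (Real.exp (2 * τ * |(p * q) ω|)) ≤
        2⁻¹ * (ENNReal.ofReal (Real.exp (2 * τ * p ω ^ 2)) +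
          ENNReal.ofReal (Real.exp (2 * τ * q ω ^ 2))) := by
      intro ω
      rw [← ENNReal.ofReal_add (Real.exp_pos _).le (Real.exp_pos _).le,
        show (2⁻¹ : ℝ≥0∞) = ENNReal.ofReal 2⁻¹ by
          rw [ENNReal.ofReal_inv_of_pos two_pos, ENNReal.ofReal_ofNat],
        ← ENNReal.ofReal_mul (by norm_num)]
      refine ENNReal.ofReal_le_ofReal ?_
      have e1 : Real.exp (2 * τ * p ω ^ 2) = Real.exp (τ * p ω ^ 2) ^ 2 := by
        rw [← Real.exp_nat_mul]; congr 1; push_cast; ring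
      have e2 : Real.exp (2 * τ * q ω ^ 2) = Real.exp (τ * q ω ^ 2) ^ 2 := by
        rw [← Real.exp_nat_mul]; congr 1; push_cast; ring
      have e3 : Real.exp (2 * τ * |(p * q) ω|) ≤
          Real.exp (τ * p ω ^ 2) * Real.exp (τ * q ω ^ 2) := by
        rw [← Real.exp_add, ← mul_add, Pi.mul_apply, abs_mul]
        refine Real.exp_le_exp.2 ?_
        have : 2 * (|p ω| * |q ω|) ≤ p ω ^ 2 + q ω ^ 2 := by
          nlinarith [sq_nonneg (|p ω| - |q ω|), sq_abs (p ω), sq_abs (q ω)]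
        nlinarith
      rw [e1, e2]
      nlinarith [sq_nonneg (Real.exp (τ * p ω ^ 2) - Real.exp (τ * q ω ^ 2))]
    refine (lintegral_mono h1).trans ?_
    have hmp : AEMeasurable (fun ω => ENNReal.ofReal (Real.exp (2 * τ * p ω ^ 2))) μ :=
      (Real.measurable_exp.comp_aemeasurable
        ((hp.aemeasurable.pow_const 2).const_mul _)).ennreal_ofReal
    rw [lintegral_const_mul' _ _ (by simp), lintegral_add_left' hmp, ENNReal.ofReal_ofNat]
    calc _ ≤ (2⁻¹ : ℝ≥0∞) * (2 + 2) := by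
          gcongr
          · exact lintegral_exp_mul_sq_le hp (by positivity) (by linarith)
          · exact lintegral_exp_mul_sq_le hq (by positivity) (by linarith)
      _ = 2 := by
          rw [← two_mul, ← mul_assoc, ENNReal.inv_mul_cancel (by simp) (by simp), one_mul]

theorem integral_eq_zero_of_hasSubgaussianMGF {X : Ω → ℝ} {c : ℝ≥0}
    (hX : HasSubgaussianMGF X c μ) : ∫ ω, X ω ∂μ = 0 := by
  have h1 : ∀ t : ℝ, t * ∫ ω, X ω ∂μ ≤ c * t ^ 2 / 2 := by
    intro t
    have h2 := convexOn_exp.map_integral_le (μ := μ) (f := fun ω => t * X ω)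
      Real.continuous_exp.continuousOn isClosed_univ (ae_of_all _ fun _ => Set.mem_univ _)
      (hX.integrable.const_mul t) (hX.integrable_exp_mul t)
    rw [integral_const_mul] at h2
    exact Real.exp_le_exp.1 (h2.trans (hX.mgf_le t))
  set m := ∫ ω, X ω ∂μ
  by_contra hm
  have hc : (0 : ℝ) ≤ c := c.2
  -- Jensen gives t m ≤ c t² / 2 for every t, which fails for small t of the sign of m. The added 1
  -- covers c = 0.
  have h3 := h1 (m / (c + 1))
  have h4 : 0 < m ^ 2 := by positivity
  have h5 : m / (c + 1) * m = m ^ 2 / (c + 1) := by ring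
  have h6 : (c : ℝ) * (m / (c + 1)) ^ 2 / 2 = m ^ 2 / (c + 1) * (c / (c + 1) / 2) := by
    field_simp
  have h7 : (c : ℝ) / (c + 1) / 2 < 1 := by
    rw [div_div, div_lt_one (by positivity)]; linarith
  have h8 : 0 < m ^ 2 / (c + 1) := by positivity
  rw [h5, h6] at h3
  nlinarith

theorem hasSubgaussianMGF_mono {Ω : Type*} [MeasurableSpace Ω] {μ : Measure Ω} {X : Ω → ℝ}
    {c c' : ℝ≥0} (h : HasSubgaussianMGF X c μ)
    (hc : c ≤ c') : HasSubgaussianMGF X c' μ :=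
  ⟨h.integrable_exp_mul, fun t => (h.mgf_le t).trans (by gcongr)⟩

end MGF

/-! ### Rows of the subgaussian map -/

section Rows

variable {ρ : Measure ℝ} [IsProbabilityMeasure ρ] {c v : ℝ≥0} {d t : ℕ}

/-- A row of the random matrix is noise of level √v, so its mixed second moments come from
`IsNoise.integral_mul`. -/
theorem isNoise_pi (hv : variance id ρ = v) (hρ : HasSubgaussianMGF id c ρ) :
    IsNoise (Measure.pi fun _ : Fin d => ρ) (fun i g => g i) √v where
  indep := iIndepFun_pi (X := fun _ => id) fun _ => aemeasurable_id
  memLp i := (hρ.memLp 2).comp_measurePreserving (measurePreserving_eval (fun _ => ρ) i)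
  mean_zero i := by
    have h := integral_comp_eval (μ := fun _ : Fin d => ρ) (i := i) (f := fun x : ℝ => x)
      aestronglyMeasurable_id
    rw [h]
    exact integral_eq_zero_of_hasSubgaussianMGF hρ
  variance_eq i := by
    have h := (measurePreserving_eval (fun _ : Fin d => ρ) i)
    have h2 := variance_map (X := id) (μ := Measure.pi fun _ : Fin d => ρ)
      (Y := fun g => g i) aemeasurable_id (measurable_pi_apply i).aemeasurable
    rw [Real.sq_sqrt v.coe_nonneg]
    calc _ = variance id ((Measure.pi fun _ : Fin d => ρ).map (Function.eval i)) := h2.symm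
      _ = v := by rw [h.map_eq, hv]

theorem hasSubgaussianMGF_sum_pi (hρ : HasSubgaussianMGF id c ρ) (x : EuclideanSpace ℝ (Fin d)) :
    HasSubgaussianMGF (fun g : Fin d → ℝ => ∑ j, x j * g j) (‖x‖₊ ^ 2 * c)
      (Measure.pi fun _ => ρ) := by
  have h1 : iIndepFun (fun (j : Fin d) (g : Fin d → ℝ) => x j * g j) (Measure.pi fun _ => ρ) :=
    iIndepFun_pi (X := fun j a => x j * a) fun j => by fun_prop
  have h2 : ∀ j : Fin d, HasSubgaussianMGF (fun g : Fin d → ℝ => x j * g j)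
      (‖x j‖₊ ^ 2 * c) (Measure.pi fun _ => ρ) := by
    intro j
    have hc : ‖x j‖₊ ^ 2 * c = ⟨x j ^ 2, sq_nonneg _⟩ * c := by
      congr 1
      ext
      simp only [NNReal.coe_pow, coe_nnnorm, Real.norm_eq_abs, sq_abs]
      rfl
    rw [hc]
    refine HasSubgaussianMGF.const_mul ?_ (x j)
    refine HasSubgaussianMGF.of_map (Y := fun g : Fin d → ℝ => g j) (X := id)
      (measurable_pi_apply j).aemeasurable ?_
    rwa [(measurePreserving_eval (fun _ : Fin d => ρ) j).map_eq]
  have h3 := HasSubgaussianMGF.sum_of_iIndepFun h1 (s := Finset.univ) fun j _ => h2 j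
  convert h3 using 1
  rw [← Finset.sum_mul]
  congr 1
  ext
  simp [EuclideanSpace.norm_sq_eq]

theorem integral_sum_mul_sum_pi (hv : variance id ρ = v) (hρ : HasSubgaussianMGF id c ρ)
    (x y : EuclideanSpace ℝ (Fin d)) :
    ∫ g : Fin d → ℝ, (∑ j, x j * g j) * (∑ j, y j * g j) ∂(Measure.pi fun _ => ρ) =
      v * inner ℝ x y := by
  have hN := isNoise_pi (d := d) hv hρ
  have h1 : ∀ g : Fin d → ℝ, (∑ j, x j * g j) * (∑ j, y j * g j) =
      ∑ i, ∑ j, x i * y j * (g i * g j) := by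
    intro g
    rw [Finset.sum_mul_sum]
    exact Finset.sum_congr rfl fun i _ => Finset.sum_congr rfl fun j _ => by ring
  simp only [h1]
  rw [integral_finsetSum _ fun i _ => integrable_finsetSum _ fun j _ =>
    (hN.integrable_mul i j).const_mul _]
  have h2 : ∀ i, ∫ g : Fin d → ℝ, ∑ j, x i * y j * (g i * g j) ∂(Measure.pi fun _ => ρ) =
      v * (x i * y i) := by
    intro i
    rw [integral_finsetSum _ fun j _ => (hN.integrable_mul i j).const_mul _]
    simp only [integral_const_mul, hN.integral_mul, Real.sq_sqrt v.coe_nonneg]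
    simp [mul_comm]
  simp only [h2]
  rw [← Finset.mul_sum, PiLp.inner_apply]
  simp [mul_comm]

/-- The rescaled matrix with rows `M`. -/
noncomputable def scaledMatrix (v : ℝ) (M : Fin t → Fin d → ℝ) : Matrix (Fin t) (Fin d) ℝ :=
  (1 / √(t * v)) • Matrix.of M

theorem inner_op_scaledMatrix {v : ℝ} (hv : 0 ≤ v) (M : Fin t → Fin d → ℝ)
    (x y : EuclideanSpace ℝ (Fin d)) :
    inner ℝ (op (scaledMatrix v M) x) (op (scaledMatrix v M) y) =
      ∑ i, (t * v)⁻¹ * ((∑ j, x j * M i j) * (∑ j, y j * M i j)) := by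
  rw [PiLp.inner_apply]
  refine Finset.sum_congr rfl fun i _ => ?_
  have h : ∀ x : EuclideanSpace ℝ (Fin d),
      op (scaledMatrix v M) x i = (√(t * v))⁻¹ * ∑ j, x j * M i j := by
    intro x
    change ∑ j, (1 / √(t * v)) * M i j * x j = _
    rw [Finset.mul_sum]
    exact Finset.sum_congr rfl fun j _ => by ring
  have hs : (√(t * v))⁻¹ * (√(t * v))⁻¹ = (t * v)⁻¹ := by
    rw [← mul_inv, Real.mul_self_sqrt (by positivity)]
  rw [h, h, ← hs]
  simp only [RCLike.inner_apply, conj_trivial]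
  ring

/-- The inner product is a sum over t independent rows of scaled products of subgaussian forms, so
the integral is a t-th power. The linear terms cancel. With s = l / (tv) and τ = 1 / (8Kvr²), the
exponent left is 4 t s² / τ² = 256 l² K² r⁴ / t. -/
theorem lintegral_exp_inner_scaledMatrix_le {K : ℝ≥0} (hv0 : 0 < v) (hv : variance id ρ = v)
    (hK : 0 < K) (hρ : HasSubgaussianMGF id (K * v) ρ) (ht : 0 < t) {l r : ℝ} (hr : 0 < r)
    (hl : 0 ≤ l) (hlt : l ≤ t / (8 * K * r ^ 2)) {x y : EuclideanSpace ℝ (Fin d)} (hx : ‖x‖ ≤ r)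
    (hy : ‖y‖ ≤ r) :
    ∫⁻ M : Fin t → Fin d → ℝ, ENNReal.ofReal (Real.exp (l *
      (inner ℝ (op (scaledMatrix v M) x) (op (scaledMatrix v M) y) - inner ℝ x y)))
      ∂(Measure.pi fun _ => Measure.pi fun _ => ρ) ≤
      ENNReal.ofReal (Real.exp (256 * l ^ 2 * K ^ 2 * r ^ 4 / t)) := by
  have hv' : (0 : ℝ) < v := hv0
  have hK' : (0 : ℝ) < K := hK
  have ht' : (0 : ℝ) < t := Nat.cast_pos.2 ht
  set τ : ℝ := 1 / (8 * (K * v * r ^ 2)) with hτ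
  have hτ0 : 0 < τ := by positivity
  have hbound : ∀ z : EuclideanSpace ℝ (Fin d), ‖z‖ ≤ r →
      8 * (τ * ((‖z‖₊ ^ 2 * (K * v) : ℝ≥0) : ℝ)) ≤ 1 := by
    intro z hz
    push_cast
    rw [hτ]
    have h1 : ‖z‖ ^ 2 ≤ r ^ 2 := pow_le_pow_left₀ (norm_nonneg _) hz 2
    calc 8 * (1 / (8 * (K * v * r ^ 2)) * (‖z‖ ^ 2 * (K * v))) = ‖z‖ ^ 2 / r ^ 2 := by field_simp
      _ ≤ 1 := div_le_one_of_le₀ h1 (by positivity)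
  set s := l * (t * v : ℝ)⁻¹ with hs
  have hsτ : |s| ≤ τ := by
    rw [abs_of_nonneg (by positivity), hs, hτ]
    calc l * (t * v : ℝ)⁻¹ ≤ t / (8 * K * r ^ 2) * (t * v : ℝ)⁻¹ := by gcongr
      _ = _ := by field_simp
  obtain ⟨hI, hle⟩ := integral_exp_mul_mul_le (hasSubgaussianMGF_sum_pi hρ x)
    (hasSubgaussianMGF_sum_pi hρ y) hτ0 hsτ (hbound x hx) (hbound y hy)
  rw [integral_sum_mul_sum_pi hv hρ] at hle
  have hprod : ∀ M : Fin t → Fin d → ℝ, Real.exp (l *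
      (inner ℝ (op (scaledMatrix v M) x) (op (scaledMatrix v M) y) - inner ℝ x y)) =
      Real.exp (-(l * inner ℝ x y)) *
        ∏ i, Real.exp (s * ((∑ j, x j * M i j) * (∑ j, y j * M i j))) := by
    intro M
    rw [← Real.exp_sum, ← Real.exp_add, inner_op_scaledMatrix hv'.le, ← Finset.mul_sum,
      ← Finset.mul_sum]
    congr 1; rw [hs]; ring
  simp only [hprod]
  rw [← ofReal_integral_eq_lintegral_ofReal ((Integrable.fintype_prod fun _ => hI).const_mul _)
    (ae_of_all _ fun M => by positivity), integral_const_mul,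
    integral_fintype_prod_eq_pow (fun g : Fin d → ℝ =>
      Real.exp (s * ((∑ j, x j * g j) * (∑ j, y j * g j)))), Fintype.card_fin]
  refine ENNReal.ofReal_le_ofReal ?_
  calc _ ≤ Real.exp (-(l * inner ℝ x y)) *
        Real.exp (s * (v * inner ℝ x y) + 4 * s ^ 2 / τ ^ 2) ^ t := by
        gcongr
    _ = _ := by
        rw [← Real.exp_nat_mul, ← Real.exp_add]
        congr 1
        rw [hs, hτ]
        field_simp
        ring

end Rows

/-! ### The Gaussian prior -/

section GaussianWeight

variable {E : Type*} [NormedAddCommGroup E] [InnerProductSpace ℝ E] [FiniteDimensional ℝ E]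
  [MeasurableSpace E] [BorelSpace E]

variable (E) in
/-- The measure with density `exp (-β ‖z‖² / 2)`. -/
noncomputable def gaussianWeight (β : ℝ) : Measure E :=
  volume.withDensity fun z => ENNReal.ofReal (Real.exp (-(β / 2) * ‖z‖ ^ 2))

variable (E) in
/-- The centered Gaussian distribution with covariance `β⁻¹`. -/
noncomputable def gaussianPrior (β : ℝ) : Measure E :=
  (gaussianWeight E β Set.univ)⁻¹ • gaussianWeight E β

theorem isProbabilityMeasure_gaussianPrior {β : ℝ} (hβ : 0 < β) :
    IsProbabilityMeasure (gaussianPrior E β) := by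
  have h : ∫ z : E, Real.exp (-(β / 2) * ‖z‖ ^ 2) ≠ 0 := by
    rw [GaussianFourier.integral_rexp_neg_mul_sq_norm (by positivity)]
    positivity
  have hI : Integrable fun z : E => Real.exp (-(β / 2) * ‖z‖ ^ 2) :=
    Integrable.of_integral_ne_zero h
  have h1 : gaussianWeight E β Set.univ = ENNReal.ofReal (∫ z : E, Real.exp (-(β / 2) * ‖z‖ ^ 2)) := by
    rw [gaussianWeight, withDensity_apply _ MeasurableSet.univ, setLIntegral_univ,
      ofReal_integral_eq_lintegral_ofReal hI (ae_of_all _ fun _ => (Real.exp_pos _).le)]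
  refine ⟨?_⟩
  rw [gaussianPrior, Measure.smul_apply, smul_eq_mul]
  refine ENNReal.inv_mul_cancel ?_ ?_
  · rw [h1]
    have h2 : 0 ≤ ∫ z : E, Real.exp (-(β / 2) * ‖z‖ ^ 2) :=
      integral_nonneg fun _ => (Real.exp_pos _).le
    exact (ENNReal.ofReal_pos.2 (h2.lt_of_ne h.symm)).ne'
  · rw [h1]; exact ENNReal.ofReal_ne_top

theorem lintegral_gaussianPrior (β : ℝ) {f : E → ℝ≥0∞} (hf : Measurable f) :
    ∫⁻ z, f z ∂(gaussianPrior E β) = (gaussianWeight E β Set.univ)⁻¹ *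
      ∫⁻ z, ENNReal.ofReal (Real.exp (-(β / 2) * ‖z‖ ^ 2)) * f z := by
  rw [gaussianPrior, lintegral_smul_measure, gaussianWeight,
    lintegral_withDensity_eq_lintegral_mul _ (by fun_prop) hf]
  rfl

/-- Translation invariance of Lebesgue measure; the factor is the ratio of the densities at z + u
and z. -/
theorem lintegral_gaussianPrior_shift (β : ℝ) {f : E → ℝ≥0∞} (hf : Measurable f) (u : E) :
    ∫⁻ z, f z ∂(gaussianPrior E β) =
      ∫⁻ z, f (z + u) * ENNReal.ofReal (Real.exp (-β * inner ℝ z u - β / 2 * ‖u‖ ^ 2))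
        ∂(gaussianPrior E β) := by
  rw [lintegral_gaussianPrior β hf, lintegral_gaussianPrior β (by fun_prop),
    ← lintegral_add_right_eq_self _ u]
  congr 1
  refine lintegral_congr fun z => ?_
  rw [mul_left_comm, ← ENNReal.ofReal_mul (Real.exp_pos _).le, ← Real.exp_add, mul_comm,
    norm_add_sq_real]
  congr 3; ring

theorem lintegral_gaussianPrior_neg (β : ℝ) {f : E → ℝ≥0∞} (hf : Measurable f) :
    ∫⁻ z, f (-z) ∂(gaussianPrior E β) = ∫⁻ z, f z ∂(gaussianPrior E β) := by
  rw [lintegral_gaussianPrior β hf, lintegral_gaussianPrior β (by fun_prop),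
    ← lintegral_neg_eq_self (fun z => ENNReal.ofReal (Real.exp (-(β / 2) * ‖z‖ ^ 2)) * f z)]
  simp only [norm_neg]

/-- Average over z and -z and use exp m + exp(-m) ≥ 2. This replaces Jensen's inequality without
integrability conditions. -/
theorem measure_le_setLIntegral_exp_of_odd {β : ℝ} {D : Set E} (hD : MeasurableSet D)
    (hneg : ∀ z, -z ∈ D ↔ z ∈ D) {m : E → ℝ} (hm : Measurable m) (hodd : ∀ z, m (-z) = -m z) :
    gaussianPrior E β D ≤ ∫⁻ z in D, ENNReal.ofReal (Real.exp (m z)) ∂(gaussianPrior E β) := by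
  have h1 : ∫⁻ z in D, ENNReal.ofReal (Real.exp (-m z)) ∂(gaussianPrior E β) =
      ∫⁻ z in D, ENNReal.ofReal (Real.exp (m z)) ∂(gaussianPrior E β) := by
    rw [← lintegral_indicator hD, ← lintegral_indicator hD, ← lintegral_gaussianPrior_neg β
      ((by fun_prop : Measurable fun z => ENNReal.ofReal (Real.exp (m z))).indicator hD)]
    refine lintegral_congr fun z => ?_
    by_cases hz : z ∈ D
    · rw [Set.indicator_of_mem hz, Set.indicator_of_mem ((hneg z).2 hz), hodd]
    · rw [Set.indicator_of_notMem hz, Set.indicator_of_notMem fun h => hz ((hneg z).1 h)]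
  have h2 : 2 * gaussianPrior E β D ≤
      2 * ∫⁻ z in D, ENNReal.ofReal (Real.exp (m z)) ∂(gaussianPrior E β) := by
    conv_rhs => rw [two_mul]
    nth_rw 2 [← h1]
    rw [← lintegral_add_left (by fun_prop), ← setLIntegral_const]
    refine lintegral_mono fun z => ?_
    rw [← ENNReal.ofReal_add (Real.exp_pos _).le (Real.exp_pos _).le, ← ENNReal.ofReal_ofNat]
    refine ENNReal.ofReal_le_ofReal ?_
    linarith [Real.add_one_le_exp (m z), Real.add_one_le_exp (-m z)]
  exact (ENNReal.mul_le_mul_iff_right two_ne_zero ENNReal.ofNat_ne_top).1 h2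

/-- Shifting by a / β completes the square and makes the integrand constant. -/
theorem lintegral_exp_inner_gaussianPrior {β : ℝ} (hβ : 0 < β) (a : E) :
    ∫⁻ z, ENNReal.ofReal (Real.exp (inner ℝ z a)) ∂(gaussianPrior E β) =
      ENNReal.ofReal (Real.exp (‖a‖ ^ 2 / (2 * β))) := by
  have := isProbabilityMeasure_gaussianPrior (E := E) hβ
  rw [lintegral_gaussianPrior_shift β (by fun_prop) (β⁻¹ • a)]
  have h : ∀ z : E, ENNReal.ofReal (Real.exp (inner ℝ (z + β⁻¹ • a) a)) *
      ENNReal.ofReal (Real.exp (-β * inner ℝ z (β⁻¹ • a) - β / 2 * ‖β⁻¹ • a‖ ^ 2)) =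
      ENNReal.ofReal (Real.exp (‖a‖ ^ 2 / (2 * β))) := by
    intro z
    rw [← ENNReal.ofReal_mul (Real.exp_pos _).le, ← Real.exp_add, inner_add_left,
      real_inner_smul_left, real_inner_smul_right, norm_smul, real_inner_self_eq_norm_sq,
      Real.norm_of_nonneg (by positivity)]
    congr 2
    field_simp
    ring
  simp only [h, lintegral_const, measure_univ, mul_one]

/-- After scaling to ‖a‖² = β, use y² + 4 ≤ 2(exp y + exp(-y)), whose right side has mean 4√e < 7.
The sharp constant is 1, but 3 is enough. -/
theorem lintegral_inner_sq_gaussianPrior_le {β : ℝ} (hβ : 0 < β) (a : E) :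
    ∫⁻ z, ENNReal.ofReal (inner ℝ z a ^ 2) ∂(gaussianPrior E β) ≤
      ENNReal.ofReal (3 * ‖a‖ ^ 2 / β) := by
  have := isProbabilityMeasure_gaussianPrior (E := E) hβ
  have hunit : ∀ a : E, ‖a‖ ^ 2 = β →
      ∫⁻ z, ENNReal.ofReal (inner ℝ z a ^ 2) ∂(gaussianPrior E β) ≤ 3 := by
    intro a ha
    have h1 : ∀ z : E, ENNReal.ofReal (inner ℝ z a ^ 2) + 4 ≤
        2 * (ENNReal.ofReal (Real.exp (inner ℝ z a)) +
          ENNReal.ofReal (Real.exp (inner ℝ z (-a)))) := by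
      intro z
      rw [show (4 : ℝ≥0∞) = ENNReal.ofReal 4 by simp, show (2 : ℝ≥0∞) = ENNReal.ofReal 2 by simp,
        ← ENNReal.ofReal_add (sq_nonneg _) (by norm_num),
        ← ENNReal.ofReal_add (Real.exp_pos _).le (Real.exp_pos _).le,
        ← ENNReal.ofReal_mul zero_le_two, inner_neg_right]
      refine ENNReal.ofReal_le_ofReal ?_
      set y := inner ℝ z a
      rcases le_total 0 y with hy | hy
      · nlinarith [Real.quadratic_le_exp_of_nonneg hy, Real.add_one_le_exp (-y)]
      · nlinarith [Real.quadratic_le_exp_of_nonneg (neg_nonneg.2 hy), Real.add_one_le_exp y]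
    have h2 : ∫⁻ z, ENNReal.ofReal (inner ℝ z a ^ 2) ∂(gaussianPrior E β) + 4 ≤ 3 + 4 := by
      calc _ = ∫⁻ z, (ENNReal.ofReal (inner ℝ z a ^ 2) + 4) ∂(gaussianPrior E β) := by
            rw [lintegral_add_right _ measurable_const, lintegral_const, measure_univ, mul_one]
        _ ≤ _ := lintegral_mono h1
        _ = 2 * (ENNReal.ofReal (Real.exp (1 / 2)) + ENNReal.ofReal (Real.exp (1 / 2))) := by
            rw [lintegral_const_mul _ (by fun_prop), lintegral_add_left (by fun_prop),
              lintegral_exp_inner_gaussianPrior hβ, lintegral_exp_inner_gaussianPrior hβ,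
              norm_neg, ha, show β / (2 * β) = 1 / 2 by field_simp]
        _ = ENNReal.ofReal (2 * (Real.exp (1 / 2) + Real.exp (1 / 2))) := by
            rw [ENNReal.ofReal_mul zero_le_two, ENNReal.ofReal_ofNat,
              ENNReal.ofReal_add (Real.exp_pos _).le (Real.exp_pos _).le]
        _ ≤ ENNReal.ofReal 7 := by
            refine ENNReal.ofReal_le_ofReal ?_
            have h3 : Real.exp (1 / 2) * Real.exp (1 / 2) = Real.exp 1 := by
              rw [← Real.exp_add]; norm_num
            nlinarith [Real.exp_one_lt_d9, Real.exp_pos (1 / 2)]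
        _ = _ := by rw [ENNReal.ofReal_ofNat]; norm_num
    exact (ENNReal.add_le_add_iff_right (by simp)).1 h2
  rcases eq_or_ne a 0 with rfl | ha
  · simp
  have han : 0 < ‖a‖ := norm_pos_iff.2 ha
  have hsβ : 0 < √β := Real.sqrt_pos.2 hβ
  have h1 := hunit ((√β / ‖a‖) • a) (by
    rw [norm_smul, Real.norm_of_nonneg (by positivity), div_mul_cancel₀ _ han.ne',
      Real.sq_sqrt hβ.le])
  have h2 : ∀ z : E, ENNReal.ofReal (inner ℝ z a ^ 2) =
      ENNReal.ofReal (‖a‖ ^ 2 / β) * ENNReal.ofReal (inner ℝ z ((√β / ‖a‖) • a) ^ 2) := by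
    intro z
    rw [← ENNReal.ofReal_mul (by positivity), real_inner_smul_right, mul_pow, div_pow,
      Real.sq_sqrt hβ.le]
    congr 1
    field_simp
  simp only [h2]
  rw [lintegral_const_mul _ (by fun_prop), mul_div_assoc, ENNReal.ofReal_mul (by norm_num),
    mul_comm (ENNReal.ofReal 3), ENNReal.ofReal_ofNat]
  gcongr

end GaussianWeight

/-! ### Lower bound for the Gaussian bilinear integral -/

section VariationalBound

variable {d n : ℕ}

local notation "𝔼" n => EuclideanSpace ℝ (Fin n)

theorem lintegral_norm_op_sq_gaussianPrior_le {β : ℝ} (hβ : 0 < β) (X : Matrix (Fin d) (Fin n) ℝ) :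
    ∫⁻ z, ENNReal.ofReal (‖op X z‖ ^ 2) ∂(gaussianPrior (𝔼 n) β) ≤
      ENNReal.ofReal (3 * (∑ i, ∑ j, X i j ^ 2) / β) := by
  have h1 : ∀ z : 𝔼 n, ENNReal.ofReal (‖op X z‖ ^ 2) =
      ∑ i, ENNReal.ofReal (inner ℝ z (WithLp.toLp 2 (X i)) ^ 2) := by
    intro z
    rw [← ENNReal.ofReal_sum_of_nonneg fun _ _ => sq_nonneg _, EuclideanSpace.norm_sq_eq]
    congr 1
    refine Finset.sum_congr rfl fun i _ => ?_
    rw [Real.norm_eq_abs, sq_abs]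
    congr 1
  simp only [h1]
  rw [lintegral_finsetSum _ fun i _ => by fun_prop, Finset.mul_sum, Finset.sum_div,
    ENNReal.ofReal_sum_of_nonneg fun i _ => by positivity]
  refine Finset.sum_le_sum fun i _ => (lintegral_inner_sq_gaussianPrior_le hβ _).trans_eq ?_
  rw [EuclideanSpace.norm_sq_eq]
  simp

theorem measurableSet_norm_op_le (X : Matrix (Fin d) (Fin n) ℝ) (c : ℝ) :
    MeasurableSet {z : 𝔼 n | ‖op X z‖ ≤ c} := by
  have : Continuous fun z : 𝔼 n => op X z := LinearMap.continuous_of_finiteDimensional _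
  exact measurableSet_le this.norm.measurable measurable_const

/-- Precision β = sr(X) makes the mean of ‖Xz‖² at most 3‖X‖_F² / β = 3‖X‖², so Markov at level
9‖X‖² leaves at most 1/3 outside. -/
theorem half_le_gaussianPrior_norm_op_le {X : Matrix (Fin d) (Fin n) ℝ} (hX : X ≠ 0) :
    2⁻¹ ≤ gaussianPrior (𝔼 n) (stableRank X) {z | ‖op X z‖ ≤ 3 * ‖X‖} := by
  have hXn : 0 < ‖X‖ := norm_pos_iff.2 hX
  have hF : 0 < ∑ i, ∑ j, X i j ^ 2 := (by positivity : 0 < ‖X‖ ^ 2).trans_le (norm_sq_le_sum_sq X)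
  have hβ : 0 < stableRank X := div_pos hF (by positivity)
  have := isProbabilityMeasure_gaussianPrior (E := 𝔼 n) hβ
  have hcont : Continuous fun z : 𝔼 n => op X z := LinearMap.continuous_of_finiteDimensional _
  have h1 : gaussianPrior (𝔼 n) (stableRank X) {z | ‖op X z‖ ≤ 3 * ‖X‖}ᶜ ≤ 2⁻¹ := by
    have h2 := mul_meas_ge_le_lintegral₀ (μ := gaussianPrior (𝔼 n) (stableRank X))
      (f := fun z => ENNReal.ofReal (‖op X z‖ ^ 2)) (by fun_prop) (ENNReal.ofReal (9 * ‖X‖ ^ 2))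
    have h3 := h2.trans (lintegral_norm_op_sq_gaussianPrior_le hβ X)
    have h4 : 3 * (∑ i, ∑ j, X i j ^ 2) / stableRank X = 9 * ‖X‖ ^ 2 * 3⁻¹ := by
      rw [stableRank]; field_simp; norm_num
    rw [h4, ENNReal.ofReal_mul (p := 9 * ‖X‖ ^ 2) (by positivity),
      ENNReal.mul_le_mul_iff_right (ENNReal.ofReal_pos.2 (by positivity)).ne'
        ENNReal.ofReal_ne_top] at h3
    calc _ ≤ _ := measure_mono fun z hz => by
          have hz' : 3 * ‖X‖ < ‖op X z‖ := not_le.1 hz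
          refine ENNReal.ofReal_le_ofReal ?_
          nlinarith
      _ ≤ _ := h3
      _ ≤ 2⁻¹ := by
          rw [ENNReal.ofReal_inv_of_pos (by norm_num), ENNReal.ofReal_ofNat]
          exact ENNReal.inv_le_inv.2 (by norm_num)
  have h5 := prob_add_prob_compl (μ := gaussianPrior (𝔼 n) (stableRank X))
    (measurableSet_norm_op_le X (3 * ‖X‖))
  by_contra! hlt
  have h6 := ENNReal.add_lt_add_of_lt_of_le (by finiteness) hlt h1
  rw [h5, ENNReal.inv_two_add_inv_two] at h6
  exact lt_irrefl _ h6

/-- Recentre the prior at u. The smaller region moves into the larger one, the exponent splits into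
f u - β‖u‖² / 2 and an odd function of z, and the odd part cannot lower the integral. -/
theorem le_setLIntegral_exp_linear {X : Matrix (Fin d) (Fin n) ℝ} {β c c' : ℝ} (hβ : 0 ≤ β)
    (hc : c + ‖X‖ ≤ c') {u : 𝔼 n} (hu : ‖u‖ ≤ 1) (f : (𝔼 n) →ₗ[ℝ] ℝ) :
    gaussianPrior (𝔼 n) β {z | ‖op X z‖ ≤ c} * ENNReal.ofReal (Real.exp (f u - β / 2)) ≤
      ∫⁻ z in {z | ‖op X z‖ ≤ c'}, ENNReal.ofReal (Real.exp (f z)) ∂(gaussianPrior (𝔼 n) β) := by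
  have hD := measurableSet_norm_op_le X c
  have hD' := measurableSet_norm_op_le X c'
  have hf : Measurable f := f.continuous_of_finiteDimensional.measurable
  have hmeas : Measurable fun z => ENNReal.ofReal (Real.exp (f z)) := by fun_prop
  rw [← lintegral_indicator hD', lintegral_gaussianPrior_shift β (hmeas.indicator hD') u]
  have hodd := measure_le_setLIntegral_exp_of_odd (β := β) hD (fun z => by simp)
    (m := fun z => f z - β * inner ℝ z u) (by fun_prop) (fun z => by simp; ring)
  refine (mul_le_mul_left hodd _).trans ?_
  rw [← lintegral_mul_const _ (by fun_prop), ← lintegral_indicator hD]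
  refine lintegral_mono fun z => ?_
  by_cases hz : ‖op X z‖ ≤ c
  · have hz' : ‖op X (z + u)‖ ≤ c' := by
      rw [map_add]
      refine (norm_add_le _ _).trans (le_trans (add_le_add hz ?_) hc)
      exact (norm_op_le X u).trans (mul_le_of_le_one_right (norm_nonneg _) hu)
    rw [Set.indicator_of_mem (show z ∈ {z | ‖op X z‖ ≤ c} from hz),
      Set.indicator_of_mem (show z + u ∈ {z | ‖op X z‖ ≤ c'} from hz'),
      ← ENNReal.ofReal_mul (Real.exp_pos _).le, ← ENNReal.ofReal_mul (Real.exp_pos _).le,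
      ← Real.exp_add, ← Real.exp_add, map_add]
    refine ENNReal.ofReal_le_ofReal (Real.exp_le_exp.2 ?_)
    have : ‖u‖ ^ 2 ≤ 1 := pow_le_one₀ (norm_nonneg _) hu
    nlinarith
  · rw [Set.indicator_of_notMem (show z ∉ {z | ‖op X z‖ ≤ c} from hz)]
    exact zero_le

/-- Losing a factor 2 avoids having to attain the operator norm. -/
theorem exists_inner_op_ge {M : Matrix (Fin n) (Fin n) ℝ} {κ : ℝ} (hκ : 0 < κ) (h : κ ≤ ‖M‖) :
    ∃ u u' : 𝔼 n, ‖u‖ ≤ 1 ∧ ‖u'‖ ≤ 1 ∧ κ / 2 ≤ inner ℝ u (op M u') := by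
  have h1 : ∃ x, κ / 2 * ‖x‖ < ‖op M x‖ := by
    by_contra! hcon
    linarith [opNorm_le_of_forall M (by positivity) hcon]
  obtain ⟨x, hx⟩ := h1
  have hx0 : 0 < ‖x‖ := by
    refine (norm_nonneg x).lt_of_ne fun h0 => ?_
    have : x = 0 := norm_eq_zero.1 h0.symm
    rw [this, map_zero, norm_zero, mul_zero] at hx
    exact lt_irrefl _ hx
  have hw0 : 0 < ‖op M x‖ := lt_of_le_of_lt (by positivity) hx
  refine ⟨‖op M x‖⁻¹ • op M x, ‖x‖⁻¹ • x, ?_, ?_, ?_⟩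
  · rw [norm_smul, norm_inv, norm_norm, inv_mul_cancel₀ hw0.ne']
  · rw [norm_smul, norm_inv, norm_norm, inv_mul_cancel₀ hx0.ne']
  · rw [map_smul, real_inner_smul_left, real_inner_smul_right, real_inner_self_eq_norm_sq,
      ← sub_nonneg]
    have : ‖op M x‖⁻¹ * (‖x‖⁻¹ * ‖op M x‖ ^ 2) - κ / 2 = (‖op M x‖ - κ / 2 * ‖x‖) / ‖x‖ := by
      field_simp
    rw [this]
    exact div_nonneg (by linarith) hx0.le

/-- Recentre z' at u' and then z at u. Each shift costs exp(-β / 2) and a mass of at least 1/2. -/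
theorem le_lintegral_exp_bilinear {X : Matrix (Fin d) (Fin n) ℝ} (hX : X ≠ 0) {l κ : ℝ}
    (hl : 0 ≤ l) (hκ : 0 < κ) {M : Matrix (Fin n) (Fin n) ℝ} (hM : κ ≤ ‖M‖) :
    ENNReal.ofReal (Real.exp (l * κ / 2 - stableRank X) / 4) ≤
      ∫⁻ z in {z | ‖op X z‖ ≤ 4 * ‖X‖}, ∫⁻ z' in {z | ‖op X z‖ ≤ 4 * ‖X‖},
        ENNReal.ofReal (Real.exp (l * inner ℝ z (op M z'))) ∂(gaussianPrior (𝔼 n) (stableRank X))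
        ∂(gaussianPrior (𝔼 n) (stableRank X)) := by
  obtain ⟨u, u', hu, hu', huu⟩ := exists_inner_op_ge hκ hM
  set β := stableRank X with hβ
  have hβ0 : 0 ≤ β := div_nonneg (by positivity) (by positivity)
  have hhalf := half_le_gaussianPrior_norm_op_le hX
  set D := gaussianPrior (𝔼 n) β {z | ‖op X z‖ ≤ 3 * ‖X‖}
  have h1 : ∀ z, D * ENNReal.ofReal (Real.exp (l * inner ℝ z (op M u') - β / 2)) ≤
      ∫⁻ z' in {z | ‖op X z‖ ≤ 4 * ‖X‖},
        ENNReal.ofReal (Real.exp (l * inner ℝ z (op M z'))) ∂(gaussianPrior (𝔼 n) β) := fun z =>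
    le_setLIntegral_exp_linear (X := X) (c := 3 * ‖X‖) (c' := 4 * ‖X‖) hβ0 (by linarith) hu'
      (l • (innerₛₗ ℝ z ∘ₗ op M))
  refine le_trans ?_ (lintegral_mono h1)
  have h2 := le_setLIntegral_exp_linear (X := X) (c := 3 * ‖X‖) (c' := 4 * ‖X‖) hβ0 (by linarith)
    hu (l • innerₛₗ ℝ (op M u'))
  simp only [LinearMap.smul_apply, innerₛₗ_apply_apply, smul_eq_mul] at h2
  have h3 : ∀ z : 𝔼 n, D * ENNReal.ofReal (Real.exp (l * inner ℝ z (op M u') - β / 2)) =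
      D * ENNReal.ofReal (Real.exp (-(β / 2))) *
        ENNReal.ofReal (Real.exp (l * inner ℝ (op M u') z)) := by
    intro z
    rw [mul_assoc, ← ENNReal.ofReal_mul (Real.exp_pos _).le, ← Real.exp_add, real_inner_comm]
    congr 3; ring
  simp only [h3]
  rw [lintegral_const_mul _ (by fun_prop)]
  refine le_trans ?_ (mul_le_mul_right h2 _)
  rw [real_inner_comm]
  calc ENNReal.ofReal (Real.exp (l * κ / 2 - β) / 4)
      ≤ ENNReal.ofReal (2⁻¹ * Real.exp (-(β / 2)) *
          (2⁻¹ * Real.exp (l * inner ℝ u (op M u') - β / 2))) := by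
        refine ENNReal.ofReal_le_ofReal ?_
        have : 2⁻¹ * Real.exp (-(β / 2)) * (2⁻¹ * Real.exp (l * inner ℝ u (op M u') - β / 2)) =
            Real.exp (l * inner ℝ u (op M u') - β) / 4 := by
          have e : l * inner ℝ u (op M u') - β =
            -(β / 2) + (l * inner ℝ u (op M u') - β / 2) := by ring
          rw [e, Real.exp_add]; ring
        rw [this]
        have : l * κ / 2 ≤ l * inner ℝ u (op M u') := by nlinarith
        gcongr
    _ = 2⁻¹ * ENNReal.ofReal (Real.exp (-(β / 2))) *
          (2⁻¹ * ENNReal.ofReal (Real.exp (l * inner ℝ u (op M u') - β / 2))) := by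
        rw [ENNReal.ofReal_mul (by positivity), ENNReal.ofReal_mul (by positivity),
          ENNReal.ofReal_mul (by positivity), ENNReal.ofReal_inv_of_pos two_pos,
          ENNReal.ofReal_ofNat]
    _ ≤ _ := by gcongr

end VariationalBound

/-! ### Tail bound and size of the subgaussian map -/

section SubgaussianMap

variable {ρ : Measure ℝ} [IsProbabilityMeasure ρ] {v : ℝ≥0} {d n t : ℕ}

theorem inner_op_gram_sub (X : Matrix (Fin d) (Fin n) ℝ) (G : Matrix (Fin t) (Fin d) ℝ)
    (z z' : EuclideanSpace ℝ (Fin n)) :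
    inner ℝ z (op (Xᵀ * Gᵀ * G * X - Xᵀ * X) z') =
      inner ℝ (op G (op X z)) (op G (op X z')) - inner ℝ (op X z) (op X z') := by
  have h : op (Xᵀ * Gᵀ * G * X - Xᵀ * X) z' =
      op Xᵀ (op Gᵀ (op G (op X z'))) - op Xᵀ (op X z') := by
    simp only [← op_mul, op, map_sub, LinearMap.sub_apply, Matrix.mul_assoc]
  rw [h, inner_sub_right, inner_op, inner_op, inner_op]

theorem measurable_exp_inner_op_scaledMatrix {α : Type*} [MeasurableSpace α] (v : ℝ≥0) (l : ℝ)
    {M : α → Fin t → Fin d → ℝ} {x y : α → EuclideanSpace ℝ (Fin d)} (hM : Measurable M)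
    (hx : Measurable x) (hy : Measurable y) :
    Measurable fun a => ENNReal.ofReal (Real.exp (l * (inner ℝ (op (scaledMatrix v (M a)) (x a))
      (op (scaledMatrix v (M a)) (y a)) - inner ℝ (x a) (y a)))) := by
  simp only [inner_op_scaledMatrix v.coe_nonneg]
  fun_prop

/-- Markov's inequality for the double Gaussian integral. Truncation keeps ‖Xz‖ and ‖Xz'‖ below r =
4‖X‖, so the moment bound holds uniformly; this turns 8 and 256 into 128 = 8 · 4² and 65536 = 256 ·
4⁴. -/
theorem measure_gram_scaledMatrix_le {K : ℝ≥0} (hv0 : 0 < v) (hv : variance id ρ = v)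
    (hK : 0 < K) (hρ : HasSubgaussianMGF id (K * v) ρ) (ht : 0 < t)
    {X : Matrix (Fin d) (Fin n) ℝ} (hX : X ≠ 0) {l κ : ℝ} (hl : 0 ≤ l)
    (hlt : l ≤ t / (128 * K * ‖X‖ ^ 2)) (hκ : 0 < κ) :
    (Measure.pi fun _ : Fin t => Measure.pi fun _ : Fin d => ρ)
      {M | κ ≤ ‖Xᵀ * (scaledMatrix v M)ᵀ * scaledMatrix v M * X - Xᵀ * X‖} ≤
      ENNReal.ofReal (4 * Real.exp (65536 * l ^ 2 * K ^ 2 * ‖X‖ ^ 4 / t -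
        (l * κ / 2 - stableRank X))) := by
  have hXn : 0 < ‖X‖ := norm_pos_iff.2 hX
  have hF : 0 < ∑ i, ∑ j, X i j ^ 2 := (by positivity : 0 < ‖X‖ ^ 2).trans_le (norm_sq_le_sum_sq X)
  have hβ : 0 < stableRank X := div_pos hF (by positivity)
  have := isProbabilityMeasure_gaussianPrior (E := EuclideanSpace ℝ (Fin n)) hβ
  set μ := Measure.pi fun _ : Fin t => Measure.pi fun _ : Fin d => ρ
  set D := {z : EuclideanSpace ℝ (Fin n) | ‖op X z‖ ≤ 4 * ‖X‖}
  have hD : MeasurableSet D := measurableSet_norm_op_le X _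
  set π := (gaussianPrior (EuclideanSpace ℝ (Fin n)) (stableRank X)).restrict D with hπ
  have hπ1 : π Set.univ ≤ 1 := by
    rw [hπ, Measure.restrict_apply_univ]; exact prob_le_one
  let F : (Fin t → Fin d → ℝ) → EuclideanSpace ℝ (Fin n) → EuclideanSpace ℝ (Fin n) → ℝ≥0∞ :=
    fun M z z' => ENNReal.ofReal (Real.exp (l * (inner ℝ (op (scaledMatrix v M) (op X z))
      (op (scaledMatrix v M) (op X z')) - inner ℝ (op X z) (op X z'))))
  have hop : Measurable (op X) := (LinearMap.continuous_of_finiteDimensional _).measurable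
  have hF3 : Measurable fun p : ((Fin t → Fin d → ℝ) × EuclideanSpace ℝ (Fin n)) ×
      EuclideanSpace ℝ (Fin n) => F p.1.1 p.1.2 p.2 := by
    exact measurable_exp_inner_op_scaledMatrix v l (by fun_prop) (hop.comp (by fun_prop))
      (hop.comp (by fun_prop))
  have hF2 : Measurable fun p : (Fin t → Fin d → ℝ) × EuclideanSpace ℝ (Fin n) =>
      ∫⁻ z', F p.1 p.2 z' ∂π := hF3.lintegral_prod_right'
  have hF1 : Measurable fun M => ∫⁻ z, ∫⁻ z', F M z z' ∂π ∂π := hF2.lintegral_prod_right'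
  set b := 65536 * l ^ 2 * K ^ 2 * ‖X‖ ^ 4 / t with hb
  have hupper : ∫⁻ M, ∫⁻ z, ∫⁻ z', F M z z' ∂π ∂π ∂μ ≤ ENNReal.ofReal (Real.exp b) := by
    rw [lintegral_lintegral_swap hF2.aemeasurable]
    have hz : ∀ z ∈ D, ∫⁻ M, ∫⁻ z', F M z z' ∂π ∂μ ≤ ENNReal.ofReal (Real.exp b) := by
      intro z hz
      have hFz : Measurable (Function.uncurry fun M z' => F M z z') :=
        measurable_exp_inner_op_scaledMatrix v l (by fun_prop) measurable_const
          (hop.comp (by fun_prop))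
      rw [lintegral_lintegral_swap hFz.aemeasurable]
      calc _ ≤ ∫⁻ _, ENNReal.ofReal (Real.exp b) ∂π := by
            refine setLIntegral_mono measurable_const fun z' hz' => ?_
            refine (lintegral_exp_inner_scaledMatrix_le hv0 hv hK hρ ht (r := 4 * ‖X‖)
              (by positivity) hl (hlt.trans_eq ?_) hz hz').trans_eq ?_
            · congr 1; ring
            · rw [hb]; congr 3; ring
        _ ≤ _ := by
            rw [lintegral_const]
            exact mul_le_of_le_one_right' hπ1
    calc _ ≤ ∫⁻ _, ENNReal.ofReal (Real.exp b) ∂π := setLIntegral_mono measurable_const hz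
      _ ≤ _ := by
          rw [lintegral_const]
          exact mul_le_of_le_one_right' hπ1
  have hmarkov := (mul_meas_ge_le_lintegral hF1 (ENNReal.ofReal
    (Real.exp (l * κ / 2 - stableRank X) / 4)) (μ := μ)).trans hupper
  have hsub : {M | κ ≤ ‖Xᵀ * (scaledMatrix v M)ᵀ * scaledMatrix v M * X - Xᵀ * X‖} ⊆
      {M | ENNReal.ofReal (Real.exp (l * κ / 2 - stableRank X) / 4) ≤
        ∫⁻ z, ∫⁻ z', F M z z' ∂π ∂π} := by
    intro M hM
    have h := le_lintegral_exp_bilinear hX hl hκ hM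
    simp only [inner_op_gram_sub] at h
    exact h
  refine (measure_mono hsub).trans ?_
  rw [mul_comm, ← ENNReal.le_div_iff_mul_le (Or.inl (ENNReal.ofReal_pos.2 (by positivity)).ne')
    (Or.inl ENNReal.ofReal_ne_top), ← ENNReal.ofReal_div_of_pos (by positivity)] at hmarkov
  refine hmarkov.trans_eq ?_
  rw [Real.exp_sub b]
  congr 1
  field_simp

theorem hasApproxGram_subgaussianMap {K : ℝ≥0} (hv0 : 0 < v) (hv : variance id ρ = v)
    (hK : 1 ≤ K) (hρ : HasSubgaussianMGF id (K * v) ρ) {X : Matrix (Fin d) (Fin n) ℝ}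
    (hX : X ≠ 0) {ε δ : ℝ} (hε : 0 < ε) (hε1 : ε ≤ 1) (hδ : 0 < δ)
    (ht : 1048576 * K ^ 2 / ε ^ 2 * (stableRank X + Real.log (4 / δ)) ≤ t) (ht0 : 0 < t) :
    HasApproxGram (subgaussianMap ρ t d) X ε δ := by
  have hXn : 0 < ‖X‖ := norm_pos_iff.2 hX
  have hK1 : (1 : ℝ) ≤ K := hK
  have hK0 : (0 : ℝ) < K := by linarith
  have ht' : (0 : ℝ) < t := Nat.cast_pos.2 ht0
  have hmeas : Measurable fun M : Fin t → Fin d → ℝ =>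
      (⟨t, scaledMatrix v M⟩ : Sketch d) := by
    refine (measurableEmbedding_sketch_mk t).measurable.comp ?_
    refine measurable_pi_lambda _ fun i => measurable_pi_lambda _ fun j => ?_
    change Measurable fun M : Fin t → Fin d → ℝ => (1 / √(t * v)) * M i j
    fun_prop
  have hmap : subgaussianMap ρ t d =
      (Measure.pi fun _ : Fin t => Measure.pi fun _ : Fin d => ρ).map fun M =>
        (⟨t, scaledMatrix v M⟩ : Sketch d) := by
    rw [subgaussianMap, hv]; rfl
  rw [HasApproxGram, hmap, Measure.map_apply hmeas (measurableSet_sketch_gram X _)]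
  -- This l minimizes the exponent 65536 l² K² ‖X‖⁴ / t - l ε ‖X‖² / 2, with minimum -t ε² /
  -- (1048576 K²). It is admissible because ε ≤ 1 ≤ K.
  have hlt : t * ε / (262144 * K ^ 2 * ‖X‖ ^ 2) ≤ t / (128 * K * ‖X‖ ^ 2) := by
    gcongr
    · exact mul_le_of_le_one_right ht'.le hε1
    · norm_num
    · nlinarith
  refine (measure_gram_scaledMatrix_le hv0 hv (zero_lt_one.trans_le hK) hρ ht0 hX
    (l := t * ε / (262144 * K ^ 2 * ‖X‖ ^ 2)) (κ := ε * ‖X‖ ^ 2) (by positivity) hlt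
    (by positivity)).trans (ENNReal.ofReal_le_ofReal ?_)
  have he : 65536 * (t * ε / (262144 * K ^ 2 * ‖X‖ ^ 2)) ^ 2 * K ^ 2 * ‖X‖ ^ 4 / t -
      (t * ε / (262144 * K ^ 2 * ‖X‖ ^ 2) * (ε * ‖X‖ ^ 2) / 2 - stableRank X) =
      stableRank X - t * ε ^ 2 / (1048576 * K ^ 2) := by
    field_simp
    ring
  have hle : stableRank X + Real.log (4 / δ) ≤ t * ε ^ 2 / (1048576 * K ^ 2) := by
    rw [le_div_iff₀ (by positivity)]
    rw [div_mul_eq_mul_div, div_le_iff₀ (by positivity)] at ht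
    linarith
  rw [he]
  calc 4 * Real.exp (stableRank X - t * ε ^ 2 / (1048576 * K ^ 2))
      ≤ 4 * Real.exp (-Real.log (4 / δ)) := by gcongr; linarith
    _ = δ := by rw [Real.exp_neg, Real.exp_log (by positivity)]; field_simp

theorem stableRank_transpose (A : Matrix (Fin n) (Fin d) ℝ) : stableRank Aᵀ = stableRank A := by
  rw [stableRank, stableRank, norm_transpose, Finset.sum_comm]
  rfl

/-- The constant is 1048576 · 9 · 4: the 9 comes from `eps2` ≥ ν / 3 times the gap, and the 4 from
log(8 / δ) ≤ 4 log(1 / δ), valid as δ < 1/2. Replacing K by max K 1 only weakens the subgaussian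
condition. -/
theorem hasApproxGram_subgaussianMap_of_gap {K : ℝ≥0} (hv0 : 0 < v) (hv : variance id ρ = v)
    (hρ : HasSubgaussianMGF id (K * v) ρ) {k : ℕ} (hk : 1 ≤ k) (A : Matrix (Fin n) (Fin d) ℝ)
    (hgap : sv A (k + 1) < sv A k) {ν δ : ℝ} (hν : ν ∈ Set.Ioo (0 : ℝ) (1 / 2))
    (hδ : δ ∈ Set.Ioo (0 : ℝ) (1 / 2))
    (ht : 37748736 * ((max K 1 : ℝ≥0) : ℝ) ^ 2 * ((stableRank A + Real.log (1 / δ)) /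
      (gap A k ^ 2 * ν ^ 2)) ≤ t) :
    HasApproxGram (subgaussianMap ρ t d) Aᵀ (eps2 A k ν) (δ / 2) := by
  have hν0 := hν.1
  have hδ0 := hδ.1
  have hg : 0 < gap A k := (gap_pos_iff A hk).2
    (sub_pos.2 (pow_lt_pow_left₀ hgap (sv_nonneg A _) two_ne_zero))
  have hA : A ≠ 0 := by
    rintro rfl
    rw [gap_pos_iff _ hk, ← gap_mul_norm_sq _ hk] at hg
    simp at hg
  have hAn : 0 < ‖A‖ := norm_pos_iff.2 hA
  have hF : 0 < ∑ i, ∑ j, A i j ^ 2 := (by positivity : 0 < ‖A‖ ^ 2).trans_le (norm_sq_le_sum_sq A)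
  have hsr : 0 < stableRank A := div_pos hF (by positivity)
  have hlog2 : Real.log 2 ≤ Real.log (1 / δ) := by
    refine Real.log_le_log two_pos ?_
    rw [le_div_iff₀ hδ0]; linarith [hδ.2]
  have hlog : Real.log (4 / (δ / 2)) = 3 * Real.log 2 + Real.log (1 / δ) := by
    rw [show 4 / (δ / 2) = 2 ^ 3 * (1 / δ) by field_simp; norm_num,
      Real.log_mul (by norm_num) (by positivity), Real.log_pow]
    norm_num
  have hlog0 : 0 < Real.log (1 / δ) := (Real.log_pos one_lt_two).trans_le hlog2
  have hε1 : eps2 A k ν ≤ 1 := by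
    refine mul_le_one₀ ?_ hg.le (gap_le_one A hk)
    rw [div_le_one (by positivity)]; linarith
  have hε : ν / 3 * gap A k ≤ eps2 A k ν := by
    unfold eps2
    gcongr
    linarith [hν.2]
  have hp : 0 < ν / 3 * gap A k := by positivity
  have hK0 : 0 < ((max K 1 : ℝ≥0) : ℝ) := lt_of_lt_of_le zero_lt_one (le_max_right K 1)
  refine hasApproxGram_subgaussianMap hv0 hv (le_max_right K 1)
    (hasSubgaussianMGF_mono hρ (by gcongr; exact le_max_left K 1))
    (fun h => hA (Matrix.transpose_eq_zero.1 h)) (hp.trans_le hε) hε1 (by positivity)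
    (le_trans ?_ ht) (Nat.cast_pos.1 (lt_of_lt_of_le (by positivity) ht))
  rw [stableRank_transpose, hlog]
  calc _ ≤ 1048576 * ((max K 1 : ℝ≥0) : ℝ) ^ 2 / (ν / 3 * gap A k) ^ 2 *
        (4 * (stableRank A + Real.log (1 / δ))) := by
        gcongr
        linarith
    _ = _ := by field_simp; norm_num

end SubgaussianMap

end SketchedPCR

theorem mainTheorem6 :
    (∀ (n d k : ℕ) (A : Matrix (Fin n) (Fin d) ℝ) (_ : 1 ≤ k) (hk : k ≤ min n d)
      (_ : k ≤ A.rank) (_ : sv A (k + 1) < sv A k)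
      (ν δ : ℝ) (_ : ν ∈ Set.Ioo (0 : ℝ) (1 / 2)) (_ : δ ∈ Set.Ioo (0 : ℝ) (1 / 2))
      (μ : Measure (Sketch d)) [IsProbabilityMeasure μ]
      (κ : Kernel (Sketch d) (Sketch n)) [IsMarkovKernel κ]
      (_ : HasApproxGram μ Aᵀ (eps2 A k ν) (δ / 2))
      (_ : ∀ᵐ G ∂μ, 0 < gap (A * G.2ᵀ) k →
        HasApproxGram (κ G) (A * G.2ᵀ) (eps1 (A * G.2ᵀ) k ν) (δ / 2))
      (Ω : Type*) [MeasurableSpace Ω] (P : Measure Ω) [IsProbabilityMeasure P]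
      (ξ : Fin n → Ω → ℝ) (σ : ℝ) (_ : IsNoise P ξ σ),
      (μ ⊗ₘ κ) {p | ¬ TwoSidedGuarantee P ξ A hk ν p.1 p.2} ≤ ENNReal.ofReal δ) ∧
    (∃ C : ℝ, 0 < C ∧
      ∀ (n d k : ℕ) (A : Matrix (Fin n) (Fin d) ℝ) (_ : 1 ≤ k)
        (ν δ : ℝ) (_ : ν ∈ Set.Ioo (0 : ℝ) (1 / 2)) (_ : δ ∈ Set.Ioo (0 : ℝ) (1 / 2))
        (G : Sketch d) (_ : 0 < gap (A * G.2ᵀ) k) (s : ℕ)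
        (_ : C * (stableRank (A * G.2ᵀ) ^ 2 /
          (gap (A * G.2ᵀ) k ^ 2 * ν ^ 2 * δ)) ≤ s),
        HasApproxGram (countSketch s n) (A * G.2ᵀ)
          (eps1 (A * G.2ᵀ) k ν) (δ / 2)) ∧
    (∀ K : ℝ≥0, ∃ C : ℝ, 0 < C ∧
      ∀ (ρ : Measure ℝ) [IsProbabilityMeasure ρ] (v : ℝ≥0) (_ : 0 < v) (_ : variance id ρ = v)
        (_ : HasSubgaussianMGF id (K * v) ρ)
        (n d k : ℕ) (A : Matrix (Fin n) (Fin d) ℝ) (_ : 1 ≤ k) (_ : k ≤ A.rank)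
        (_ : sv A (k + 1) < sv A k)
        (ν δ : ℝ) (_ : ν ∈ Set.Ioo (0 : ℝ) (1 / 2)) (_ : δ ∈ Set.Ioo (0 : ℝ) (1 / 2)) (t : ℕ)
        (_ : C * ((stableRank A + Real.log (1 / δ)) /
          (gap A k ^ 2 * ν ^ 2)) ≤ t),
        HasApproxGram (subgaussianMap ρ t d) Aᵀ
          (eps2 A k ν) (δ / 2)) := by
  refine ⟨?_, ?_, ?_⟩
  · intro n d k A hk hk' _ hgap ν δ hν hδ μ _ κ _ hμ hκ Ω _ P _ ξ σ hξ
    exact measure_not_twoSidedGuarantee_le hk hk' hgap hν hδ.1.le μ κ hμ hκ P hξ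
  · exact ⟨36, by norm_num, fun n d k A hk ν δ hν hδ G hG s hs =>
      hasApproxGram_countSketch_of_gap hk _ hν hδ.1 hG hs⟩
  -- The constant is found by unification as 37748736 (max K 1)², which depends on K alone.
  · exact fun K => ⟨_, by positivity, fun ρ _ v hv hvar hρ n d k A hk _ hgap ν δ hν hδ t ht =>
      hasApproxGram_subgaussianMap_of_gap hv hvar hρ hk A hgap hν hδ ht⟩
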